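/- Let $(M,g)$ be a smooth Riemannian $4$-manifold that is (locally) conformally flat, that is, every point has a coordinate chart in which $g=\Omega^2\delta$ for a smooth positive function $\Omega$ and the Euclidean metric $\delta$. Let $\Sigma\subset M$ be a smoothly embedded hypersurface, and let $\sigma$ be a conformal unit defining function for $\Sigma$ in the scale $g$: $\sigma$ is a smooth function on an open neighbourhood $U$ of $\Sigma$ whose zero locus in $U$ is $\Sigma$, with $d\sigma\neq 0$ along $\Sigma$, and $$ |d\sigma|_g^2-\tfrac{1}{2}\,\sigma\Big(\Delta^g+\tfrac{\operatorname{Sc}^g}{6}\Big)\sigma \;=\; 1+\sigma^4 B \qquad\text{on } U $$ for some smooth function $B$ on $U$ (here $\Delta^g=\nabla^a\nabla_a$ and $\operatorname{Sc}^g$ is the scalar curvature, positive on round spheres). Then the obstruction density $\mathcal B:=B|_\Sigma$, computed in the scale $g$, is $$ \mathcal B=\frac16\Big((\bar\nabla_c\mathring{\mathrm{I\!I}}_{ab})(\bar\nabla^c\mathring{\mathrm{I\!I}}{}^{ab})+2\,\mathring{\mathrm{I\!I}}{}^{ab}\bar\Delta\mathring{\mathrm{I\!I}}_{ab}+\frac32\,(\bar\nabla^b\mathring{\mathrm{I\!I}}_{ba})(\bar\nabla_c\mathring{\mathrm{I\!I}}{}^{ca})-2\bar{\mathrm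 J}\,K+K^2\Big). $$ Here $\bar g$ is the metric induced on $\Sigma$, $\bar\nabla$ its Levi-Civita connection, $\bar\Delta=\bar\nabla^c\bar\nabla_c$ the Laplacian acting on tensors, $\bar{\mathrm J}=\operatorname{Sc}^{\bar g}/4$ the trace of the Schouten tensor of the $3$-dimensional metric $\bar g$; $\mathrm{I\!I}_{ab}=\nabla^{\top}_a\hat n_b|_\Sigma$ is the second fundamental form with respect to the unit conormal $\hat n=d\sigma/|d\sigma|_g$; $\mathring{\mathrm{I\!I}}_{ab}=\mathrm{I\!I}_{ab}-\frac13(\bar g^{cd}\mathrm{I\!I}_{cd})\,\bar g_{ab}$ is its trace-free part, and $K=\mathring{\mathrm{I\!I}}_{ab}\mathring{\mathrm{I\!I}}{}^{ab}$; indices are raised with $\bar g$. -/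

import Mathlib

open scoped Manifold ContDiff

noncomputable section

namespace ConfHyp

/-- The model space `ℝⁿ`. -/
abbrev E (n : ℕ) : Type := EuclideanSpace ℝ (Fin n)

/-! ### Tensor calculus in local coordinates

A metric on an open piece of `ℝⁿ` is given by its matrix of components `h : E n → Matrix _ _ ℝ`,
a covariant tensor of rank `k` by its components `T x a`, where `a : Fin k → Fin n` is the
multi-index.  In `covDeriv` the slot of the derivative is the first one:
`covDeriv h T x (c, a₁, …, a_k) = (∇_c T)_{a₁ … a_k}`. -/

/-- Components of a covariant tensor field of rank `k` on `ℝⁿ`. -/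
abbrev CoordTensor (n k : ℕ) : Type := E n → (Fin k → Fin n) → ℝ

/-- A function, seen as a tensor field of rank `0`. -/
def ofFun {n : ℕ} (f : E n → ℝ) : CoordTensor n 0 := fun x _ => f x

/-- The partial derivative `∂_i f`. -/
def pd {n : ℕ} (f : E n → ℝ) (i : Fin n) (x : E n) : ℝ :=
  fderiv ℝ f x (EuclideanSpace.single i 1)

/-- The Christoffel symbol `Γ^k_{ij}` of the Levi-Civita connection of `h`. -/
def christoffel {n : ℕ} (h : E n → Matrix (Fin n) (Fin n) ℝ) (k i j : Fin n) (x : E n) : ℝ :=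
  (1 / 2) * ∑ l, (h x)⁻¹ k l *
    (pd (fun y => h y j l) i x + pd (fun y => h y i l) j x - pd (fun y => h y i j) l x)

/-- The Levi-Civita covariant derivative of a covariant tensor field. -/
def covDeriv {n k : ℕ} (h : E n → Matrix (Fin n) (Fin n) ℝ) (T : CoordTensor n k) :
    CoordTensor n (k + 1) := fun x a =>
  pd (fun y => T y (Fin.tail a)) (a 0) x
    - ∑ m : Fin k, ∑ l : Fin n,
        christoffel h l (a 0) (a m.succ) x * T x (Function.update (Fin.tail a) m l)

/-- The metric pairing of two covariant tensor fields of the same rank: contraction of all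
indices. -/
def pairing {n k : ℕ} (h : E n → Matrix (Fin n) (Fin n) ℝ) (T S : CoordTensor n k)
    (x : E n) : ℝ :=
  ∑ a : Fin k → Fin n, ∑ b : Fin k → Fin n, (∏ m, (h x)⁻¹ (a m) (b m)) * T x a * S x b

/-- The trace over the first two indices. -/
def traceFirstTwo {n k : ℕ} (h : E n → Matrix (Fin n) (Fin n) ℝ) (T : CoordTensor n (k + 2)) :
    CoordTensor n k := fun x a =>
  ∑ i, ∑ j, (h x)⁻¹ i j * T x (Fin.cons i (Fin.cons j a))

/-- The divergence `∇^c T_{c a₂ …}`. -/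
def divergence {n k : ℕ} (h : E n → Matrix (Fin n) (Fin n) ℝ) (T : CoordTensor n (k + 1)) :
    CoordTensor n k :=
  traceFirstTwo h (covDeriv h T)

/-- The (rough, negative) Laplacian `∇^c ∇_c T`. -/
def laplacian {n k : ℕ} (h : E n → Matrix (Fin n) (Fin n) ℝ) (T : CoordTensor n k) :
    CoordTensor n k :=
  traceFirstTwo h (covDeriv h (covDeriv h T))

/-- The Ricci curvature (positive on round spheres). -/
def ricci {n : ℕ} (h : E n → Matrix (Fin n) (Fin n) ℝ) (i j : Fin n) (x : E n) : ℝ :=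
  ∑ k, (pd (christoffel h k i j) k x - pd (christoffel h k k j) i x
    + ∑ l, (christoffel h k k l x * christoffel h l i j x
      - christoffel h k i l x * christoffel h l k j x))

/-- The scalar curvature (positive on round spheres). -/
def scalarCurv {n : ℕ} (h : E n → Matrix (Fin n) (Fin n) ℝ) (x : E n) : ℝ :=
  ∑ i, ∑ j, (h x)⁻¹ i j * ricci h i j x

/-- The trace of the Schouten tensor of an `n`-dimensional metric, `J = Sc / (2 (n - 1))`. -/
def schoutenTrace {n : ℕ} (h : E n → Matrix (Fin n) (Fin n) ℝ) (x : E n) : ℝ :=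
  scalarCurv h x / (2 * ((n : ℝ) - 1))

/-- The singular Yamabe expression
`S(h, s) = |ds|² - (2/n) s (Δ + Sc / (2 (n - 1))) s`. -/
def yamabeS {n : ℕ} (h : E n → Matrix (Fin n) (Fin n) ℝ) (s : E n → ℝ) (x : E n) : ℝ :=
  pairing h (covDeriv h (ofFun s)) (covDeriv h (ofFun s)) x
    - 2 / (n : ℝ) * s x * (laplacian h (ofFun s) x ![] + schoutenTrace h x * s x)

/-- The unit conormal extension `n̂ = ds / |ds|` of the level sets of `s`. -/
def unitConormal {n : ℕ} (h : E n → Matrix (Fin n) (Fin n) ℝ) (s : E n → ℝ) :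
    CoordTensor n 1 := fun x a =>
  covDeriv h (ofFun s) x a
    / Real.sqrt (pairing h (covDeriv h (ofFun s)) (covDeriv h (ofFun s)) x)

/-- The pullback of a covariant 2-tensor along a map `X : ℝᵐ → ℝⁿ`. -/
def pullback₂ {m n : ℕ} (X : E m → E n) (T : CoordTensor n 2) : CoordTensor m 2 := fun u a =>
  ∑ i, ∑ j, pd (fun v => X v i) (a 0) u * pd (fun v => X v j) (a 1) u * T (X u) ![i, j]

/-- The trace-free part `T_{ab} - (1/n) (tr T) h_{ab}` of a covariant 2-tensor. -/
def traceFree {n : ℕ} (h : E n → Matrix (Fin n) (Fin n) ℝ) (T : CoordTensor n 2) :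
    CoordTensor n 2 := fun x a =>
  T x a - traceFirstTwo h T x ![] / (n : ℝ) * h x (a 0) (a 1)

/-- The expression
`(1/6) (|∇A|² + 2 ⟨A, ΔA⟩ + (3/2) |div A|² - 2 J |A|² + |A|⁴)` for a metric `h` and a covariant
2-tensor `A`. -/
def willmoreExpr {n : ℕ} (h : E n → Matrix (Fin n) (Fin n) ℝ) (A : CoordTensor n 2)
    (x : E n) : ℝ :=
  (1 / 6) * (pairing h (covDeriv h A) (covDeriv h A) x
    + 2 * pairing h A (laplacian h A) x
    + (3 / 2) * pairing h (divergence h A) (divergence h A) x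
    - 2 * schoutenTrace h x * pairing h A A x
    + (pairing h A A x) ^ 2)

/-! ### Riemannian manifolds and hypersurfaces -/

/-- A smooth Riemannian metric on the `n`-manifold `M`. -/
abbrev Metric (n : ℕ) (M : Type*) [TopologicalSpace M] [ChartedSpace (E n) M]
    [IsManifold 𝓘(ℝ, E n) ∞ M] : Type _ :=
  Bundle.ContMDiffRiemannianMetric 𝓘(ℝ, E n) ∞ (E n) (TangentSpace 𝓘(ℝ, E n) (M := M))

/-- `Chart n M e`: `e` belongs to the smooth maximal atlas of the `n`-manifold `M`. -/
def Chart (n : ℕ) (M : Type*) [TopologicalSpace M] [ChartedSpace (E n) M]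
    (e : OpenPartialHomeomorph M (E n)) : Prop :=
  e ∈ IsManifold.maximalAtlas 𝓘(ℝ, E n) ∞ M

/-- The matrix of components `g(∂_i X, ∂_j X)` of the pullback of the metric `g` along a
parametrization `X : ℝᵐ → M`.  For `X = e.symm`, with `e` a chart, these are the components of `g`
in that chart; for `X = ι ∘ c.symm`, with `ι : N → M` an immersion and `c` a chart of `N`, these
are the components of the metric induced on `N`. -/
def gram {m n : ℕ} {M : Type*} [TopologicalSpace M] [ChartedSpace (E n) M]
    [IsManifold 𝓘(ℝ, E n) ∞ M] (g : Metric n M) (X : E m → M) (u : E m) :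
    Matrix (Fin m) (Fin m) ℝ :=
  Matrix.of fun i j => g.inner (X u)
    (mfderiv 𝓘(ℝ, E m) 𝓘(ℝ, E n) X u (EuclideanSpace.single i (1 : ℝ) : E m))
    (mfderiv 𝓘(ℝ, E m) 𝓘(ℝ, E n) X u (EuclideanSpace.single j (1 : ℝ) : E m))

/-- `(M, g)` is (locally) conformally flat: around each point there is a chart in which
`g = Ω² δ` for a smooth positive function `Ω`. -/
def IsConformallyFlat {n : ℕ} {M : Type*} [TopologicalSpace M] [ChartedSpace (E n) M]
    [IsManifold 𝓘(ℝ, E n) ∞ M] (g : Metric n M) : Prop :=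
  ∀ p : M, ∃ e : OpenPartialHomeomorph M (E n), Chart n M e ∧ p ∈ e.source ∧
    ∃ Ω : E n → ℝ, ContDiffOn ℝ ∞ Ω e.target ∧
      ∀ y ∈ e.target, 0 < Ω y ∧ gram g e.symm y = (Ω y) ^ 2 • (1 : Matrix (Fin n) (Fin n) ℝ)

/-- `σ` is a smooth function on the open set `U`, a defining function for the hypersurface `S ⊆ U`:
`S` is its zero locus in `U`, and `dσ` vanishes nowhere on `S`. -/
structure IsDefiningFunction {n : ℕ} {M : Type*} [TopologicalSpace M] [ChartedSpace (E n) M]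
    (S U : Set M) (σ : M → ℝ) : Prop where
  isOpen : IsOpen U
  subset : S ⊆ U
  smooth : ContMDiffOn 𝓘(ℝ, E n) 𝓘(ℝ, ℝ) ∞ σ U
  zero_iff : ∀ p ∈ U, σ p = 0 ↔ p ∈ S
  mfderiv_ne : ∀ p ∈ S, mfderiv 𝓘(ℝ, E n) 𝓘(ℝ, ℝ) σ p ≠ 0

/-- `σ` is a conformal unit defining function on `U`, with smooth remainder `B`, in the scale of
the metric `g`: in every chart `S(g, σ) = 1 + σⁿ B`, where `n` is the dimension. -/
def SolvesSingularYamabe {n : ℕ} {M : Type*} [TopologicalSpace M] [ChartedSpace (E n) M]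
    [IsManifold 𝓘(ℝ, E n) ∞ M] (g : Metric n M) (U : Set M) (σ B : M → ℝ) : Prop :=
  ContMDiffOn 𝓘(ℝ, E n) 𝓘(ℝ, ℝ) ∞ B U ∧
    ∀ e : OpenPartialHomeomorph M (E n), Chart n M e → ∀ p ∈ U ∩ e.source,
      yamabeS (gram g e.symm) (σ ∘ e.symm) (e p) = 1 + σ p ^ n * B p

/-- The components, in the chart `c` of the hypersurface `ι : N → M`, of its second fundamental
form `II_{ab} = ∇ᵀ_a n̂_b` with respect to the unit conormal `n̂ = dσ / |dσ|`; the ambient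
covariant derivative is computed in the chart `e` of `M`. -/
def secondFF {m n : ℕ} {M N : Type*} [TopologicalSpace M] [ChartedSpace (E n) M]
    [IsManifold 𝓘(ℝ, E n) ∞ M] [TopologicalSpace N] (g : Metric n M) (σ : M → ℝ) (ι : N → M)
    (c : OpenPartialHomeomorph N (E m)) (e : OpenPartialHomeomorph M (E n)) : CoordTensor m 2 :=
  pullback₂ (e ∘ ι ∘ c.symm)
    (covDeriv (gram g e.symm) (unitConormal (gram g e.symm) (σ ∘ e.symm)))

end ConfHyp

end

/-! The equation `S(g, σ) = 1 + σ⁴B` is conformally covariant. In a chart with `g = e^{2φ}δ`, the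
substitution `σ = e^φ s` turns it (`yamabeS_confMetric`) into the flat equation `|∇s|² - ½ sΔs = 1 +
s⁴b` with `b = e^{4φ}B`. Put `ρ = -Δs/4`, and let `P = Hess s + ρδ` be the trace-free Hessian; the
equation reads `|∇s|² + 2ρs = 1 + s⁴b`.

Analytic side. Half the gradient of this equation is `P(∇s) + s∇ρ = O(s³)`. Its divergence, using
`tr P = 0` and the flat Codazzi consequence `div P = -3∇ρ`, is `|P|² - 2⟨∇s,∇ρ⟩ + sΔρ = s²(6b +
O(s))`. The Laplacian of that on the zero set isolates the remainder: `12 b = Δ|P|² - 4⟨P, Hess ρ⟩ +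
8|∇ρ|²` (`remainder_eq`).

Geometric side. On the zero set the `g`-Hessian of `e^φ s` is `e^φ P` plus a multiple of the metric,
so the trace-free second fundamental form is the pullback of the ambient tensor `e^φ P`
(`traceFree_secondFF_eq`). Its intrinsic derivatives are computed in the ambient space, without
straightening the hypersurface. The Levi-Civita symbols of `e^{2φ}δ`, corrected by the second
fundamental form times the normal, give symbols `C` with `∂_a∂_b X + C(∂_a X, ∂_b X) = Γ^d_{ab} ∂_d
X` for a parametrization `X` (`related_ambSymbols`). For symbols related in this way, covariant
derivatives and curvature commute with pullback (`covWith_pull`, `sum_riem_of_related`); the second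
statement takes the place of the Gauss equation. The Willmore expression at a point thus becomes a
polynomial in the jets of `s` and `φ`.

Comparison. A rotation of the flat chart makes `∇s` the last coordinate vector at the given point.
The derivatives of `P(∇s) + s∇ρ = O(s³)` and the Codazzi symmetry express the components of `∇P` and
`∇²P` with normal indices through tangential data and `ρ`. What remains is a polynomial identity in
three dimensions (`jet_identity`), in which every derivative of `φ` cancels. -/

open scoped Topology

namespace ConfHyp

/-! ### Partial derivatives -/

section PartialDerivatives

variable {m n : ℕ} {f g : E n → ℝ} {x : E n}

theorem smooth_differentiableAt {F G : Type*} [NormedAddCommGroup F] [NormedSpace ℝ F]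
    [NormedAddCommGroup G] [NormedSpace ℝ G] {f : F → G} {x : F}
    (hf : ContDiffAt ℝ ∞ f x) : DifferentiableAt ℝ f x :=
  hf.differentiableAt (by simp)

@[fun_prop]
theorem contDiffAt_pd (hf : ContDiffAt ℝ ∞ f x) (i : Fin n) :
    ContDiffAt ℝ ∞ (fun y => pd f i y) x := by
  unfold pd
  exact (hf.fderiv_right (m := ∞) (by simp)).clm_apply contDiffAt_const

theorem pd_congr (h : f =ᶠ[𝓝 x] g) (i : Fin n) : pd f i x = pd g i x := by
  unfold pd; rw [h.fderiv_eq]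

theorem pd_congr_eventually (h : f =ᶠ[𝓝 x] g) (i : Fin n) :
    (fun y => pd f i y) =ᶠ[𝓝 x] fun y => pd g i y := by
  filter_upwards [h.eventually_nhds] with y hy using pd_congr hy i

theorem pd_const (c : ℝ) (i : Fin n) : pd (fun _ => c) i x = 0 := by
  simp [pd]

theorem pd_add (hf : ContDiffAt ℝ ∞ f x) (hg : ContDiffAt ℝ ∞ g x) (i : Fin n) :
    pd (fun y => f y + g y) i x = pd f i x + pd g i x := by
  unfold pd
  rw [fderiv_fun_add (smooth_differentiableAt hf) (smooth_differentiableAt hg)]; rfl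

theorem pd_sub (hf : ContDiffAt ℝ ∞ f x) (hg : ContDiffAt ℝ ∞ g x) (i : Fin n) :
    pd (fun y => f y - g y) i x = pd f i x - pd g i x := by
  unfold pd
  rw [fderiv_fun_sub (smooth_differentiableAt hf) (smooth_differentiableAt hg)]; rfl

theorem pd_mul (hf : ContDiffAt ℝ ∞ f x) (hg : ContDiffAt ℝ ∞ g x) (i : Fin n) :
    pd (fun y => f y * g y) i x = pd f i x * g x + f x * pd g i x := by
  unfold pd
  rw [fderiv_fun_mul (smooth_differentiableAt hf) (smooth_differentiableAt hg)]
  simp; ring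

theorem pd_const_mul (c : ℝ) (hf : ContDiffAt ℝ ∞ f x) (i : Fin n) :
    pd (fun y => c * f y) i x = c * pd f i x := by
  rw [pd_mul contDiffAt_const hf, pd_const]; ring

theorem pd_pow (hf : ContDiffAt ℝ ∞ f x) (k : ℕ) (i : Fin n) :
    pd (fun y => f y ^ k) i x = k * f x ^ (k - 1) * pd f i x := by
  unfold pd
  rw [fderiv_fun_pow k (smooth_differentiableAt hf)]
  simp

theorem pd_exp (hf : ContDiffAt ℝ ∞ f x) (i : Fin n) :
    pd (fun y => Real.exp (f y)) i x = Real.exp (f x) * pd f i x := by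
  unfold pd
  rw [fderiv_exp (smooth_differentiableAt hf)]
  simp

theorem pd_sum {ι : Type*} (s : Finset ι) {F : ι → E n → ℝ}
    (hF : ∀ a ∈ s, ContDiffAt ℝ ∞ (F a) x) (i : Fin n) :
    pd (fun y => ∑ a ∈ s, F a y) i x = ∑ a ∈ s, pd (F a) i x := by
  unfold pd
  rw [fderiv_fun_sum fun a ha => smooth_differentiableAt (hF a ha)]
  simp

theorem pd_prod {ι : Type*} [DecidableEq ι] (s : Finset ι) {F : ι → E n → ℝ}
    (hF : ∀ a ∈ s, ContDiffAt ℝ ∞ (F a) x) (i : Fin n) :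
    pd (fun y => ∏ a ∈ s, F a y) i x
      = ∑ a ∈ s, (∏ b ∈ s.erase a, F b x) * pd (F a) i x := by
  unfold pd
  rw [fderiv_finsetProd fun a ha => smooth_differentiableAt (hF a ha)]
  simp

theorem pd_comm (hf : ContDiffAt ℝ ∞ f x) (i j : Fin n) :
    pd (fun y => pd f i y) j x = pd (fun y => pd f j y) i x := by
  have h := hf.isSymmSndFDerivAt (by
    rw [minSmoothness_of_isRCLikeNormedField]; exact WithTop.coe_le_coe.2 (le_top (a := (2 : ℕ∞))))
  have hd : DifferentiableAt ℝ (fderiv ℝ f) x :=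
    smooth_differentiableAt (hf.fderiv_right (m := ∞) (by simp))
  unfold pd
  rw [fderiv_clm_apply hd (by fun_prop), fderiv_clm_apply hd (by fun_prop)]
  simpa using h (EuclideanSpace.single j 1) (EuclideanSpace.single i 1)

theorem sum_pd_mul_eq_fderiv (f : E n → ℝ) (v : E n) :
    fderiv ℝ f x v = ∑ i, v i * pd f i x := by
  have h : v = ∑ i, v i • EuclideanSpace.single i (1 : ℝ) := by
    simpa using ((EuclideanSpace.basisFun (Fin n) ℝ).sum_repr v).symm
  conv_lhs => rw [h]
  simp [pd]

theorem contDiffAt_coord {X : E m → E n} {u : E m} (hX : ContDiffAt ℝ ∞ X u) (k : Fin n) :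
    ContDiffAt ℝ ∞ (fun v => X v k) u :=
  (contDiffAt_piLp (p := 2)).1 hX k

theorem pd_coord {X : E m → E n} {u : E m} (hX : DifferentiableAt ℝ X u) (k : Fin n)
    (a : Fin m) :
    pd (fun v => X v k) a u = fderiv ℝ X u (EuclideanSpace.single a 1) k := by
  have h := ((EuclideanSpace.proj (𝕜 := ℝ) k : E n →L[ℝ] ℝ).hasFDerivAt.comp u
    hX.hasFDerivAt).fderiv
  exact congrArg (fun L => L (EuclideanSpace.single a (1 : ℝ))) h

theorem pd_comp {X : E m → E n} {u : E m} (hf : ContDiffAt ℝ ∞ f (X u))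
    (hX : ContDiffAt ℝ ∞ X u) (a : Fin m) :
    pd (fun v => f (X v)) a u = ∑ k, pd (fun v => X v k) a u * pd f k (X u) := by
  have h := fderiv_comp u (smooth_differentiableAt hf) (smooth_differentiableAt hX)
  unfold pd
  change fderiv ℝ (f ∘ X) u _ = _
  rw [h, ContinuousLinearMap.comp_apply, sum_pd_mul_eq_fderiv]
  refine Finset.sum_congr rfl fun k _ => ?_
  rw [← pd_coord (smooth_differentiableAt hX)]
  rfl

end PartialDerivatives

end ConfHyp

namespace ConfHyp

/-! ### Pulling back covariant derivatives -/

section Pullback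

variable {m n k : ℕ}

/-- Connection symbols `C^k_{pq}`, as functions `C k p q`. -/
abbrev Symbols (n : ℕ) : Type := Fin n → Fin n → Fin n → E n → ℝ

/-- The covariant derivative defined by connection symbols. -/
noncomputable def covWith (C : Symbols n) (T : CoordTensor n k) : CoordTensor n (k + 1) := fun x a =>
  pd (fun y => T y (Fin.tail a)) (a 0) x
    - ∑ r : Fin k, ∑ l : Fin n,
        C l (a 0) (a r.succ) x * T x (Function.update (Fin.tail a) r l)

theorem covDeriv_eq_covWith (h : E n → Matrix (Fin n) (Fin n) ℝ) (T : CoordTensor n k) :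
    covDeriv h T = covWith (christoffel h) T := rfl

/-- The entry `∂_a X^k` of the Jacobian matrix. -/
noncomputable def jac (X : E m → E n) (k : Fin n) (a : Fin m) (u : E m) : ℝ := pd (fun v => X v k) a u

@[fun_prop]
theorem contDiffAt_jac {X : E m → E n} {u : E m} (hX : ContDiffAt ℝ ∞ X u) (k : Fin n)
    (a : Fin m) : ContDiffAt ℝ ∞ (fun v => jac X k a v) u :=
  contDiffAt_pd (contDiffAt_coord hX k) a

theorem pd_jac_comm {X : E m → E n} {u : E m} (hX : ContDiffAt ℝ ∞ X u) (k : Fin n)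
    (a b : Fin m) : pd (fun v => jac X k a v) b u = pd (fun v => jac X k b v) a u :=
  pd_comm (contDiffAt_coord hX k) a b

theorem pd_comp_jac {X : E m → E n} {u : E m} {f : E n → ℝ} (hf : ContDiffAt ℝ ∞ f (X u))
    (hX : ContDiffAt ℝ ∞ X u) (a : Fin m) :
    pd (fun v => f (X v)) a u = ∑ k, jac X k a u * pd f k (X u) :=
  pd_comp hf hX a

/-- The pullback of a covariant tensor field along a map. -/
noncomputable def pull (X : E m → E n) (T : CoordTensor n k) : CoordTensor m k := fun u a =>
  ∑ i : Fin k → Fin n, (∏ r, jac X (i r) (a r) u) * T (X u) i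

/-- The symbols `Γ` on the source and `C` on the target are related by the map `X`:
`∂_a ∂_b X + C(∂_a X, ∂_b X) = Γ^d_{ab} ∂_d X`. -/
def Related (X : E m → E n) (Γ : Symbols m) (C : Symbols n) (u : E m) : Prop :=
  ∀ k a b, pd (fun v => jac X k b v) a u
      + ∑ p, ∑ q, C k p q (X u) * jac X p a u * jac X q b u
    = ∑ d, Γ d a b u * jac X k d u

/-- Exchanging the entry in slot `r` with the free index is an involution of the pairs `(i, l)`. It
moves a contraction with a connection symbol from a slot of the tensor to the matching Jacobian
factor. -/
theorem sum_update_swap (r : Fin k) (f : (Fin k → Fin n) → Fin n → ℝ) :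
    ∑ i, ∑ l, f i l = ∑ i, ∑ l, f (Function.update i r l) (i r) := by
  rw [← Fintype.sum_prod_type', ← Fintype.sum_prod_type']
  refine Finset.sum_bij' (fun z _ => (Function.update z.1 r z.2, z.1 r))
    (fun z _ => (Function.update z.1 r z.2, z.1 r)) ?_ ?_ ?_ ?_ ?_ <;> simp

theorem sum_cons (f : (Fin (k + 1) → Fin n) → ℝ) :
    ∑ i, f i = ∑ p, ∑ i, f (Fin.cons p i) := by
  rw [← Fintype.sum_prod_type' (f := fun p i => f (Fin.cons p i))]
  exact (Fintype.sum_equiv (Fin.consEquiv fun _ => Fin n) _ _ fun _ => rfl).symm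

/-- Differentiating a pullback produces, besides the derivative of `T` along `∂_a X`, a second
derivative of `X` in each slot. `Related` says exactly that this second derivative, minus the
intrinsic symbol term, is the ambient symbol term. No relation between the dimensions enters, so the
same lemma serves changes of coordinates and hypersurfaces. -/
theorem covWith_pull {X : E m → E n} {Γ : Symbols m} {C : Symbols n} {T : CoordTensor n k}
    {u : E m} (hX : ContDiffAt ℝ ∞ X u) (hT : ∀ i, ContDiffAt ℝ ∞ (fun y => T y i) (X u))
    (hR : Related X Γ C u) (a : Fin (k + 1) → Fin m) :
    covWith Γ (pull X T) u a = pull X (covWith C T) u a := by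
  set t := Fin.tail a with ht
  have hJ : ∀ p b, ContDiffAt ℝ ∞ (fun v => jac X p b v) u := fun p b => contDiffAt_jac hX p b
  have hTX : ∀ i, ContDiffAt ℝ ∞ (fun v => T (X v) i) u := fun i => (hT i).comp u hX
  -- Product rule: the first sum collects the terms in which the derivative hits the Jacobian factor
  -- of slot `r`, the second those in which it hits `T`.
  have h1 : pd (fun v => pull X T v t) (a 0) u
      = (∑ r, ∑ i : Fin k → Fin n, (∏ r' ∈ Finset.univ.erase r, jac X (i r') (t r') u)
            * pd (fun v => jac X (i r) (t r) v) (a 0) u * T (X u) i)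
        + ∑ p, ∑ i : Fin k → Fin n, jac X p (a 0) u * (∏ r, jac X (i r) (t r) u)
            * pd (fun y => T y i) p (X u) := by
    unfold pull
    rw [pd_sum _ fun i _ => (contDiffAt_prod fun r _ => hJ _ _).mul (hTX i),
      Finset.sum_comm, Finset.sum_comm (γ := Fin n), ← Finset.sum_add_distrib]
    refine Finset.sum_congr rfl fun i _ => ?_
    rw [pd_mul (contDiffAt_prod fun r _ => hJ _ _) (hTX i), pd_prod _ fun r _ => hJ _ _,
      pd_comp_jac (hT i) hX, Finset.sum_mul, Finset.mul_sum]
    congr 1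
    exact Finset.sum_congr rfl fun p _ => by ring
  have h2 : ∀ r, (∑ l, Γ l (a 0) (t r) u * pull X T u (Function.update t r l))
      = ∑ i : Fin k → Fin n, (∏ r' ∈ Finset.univ.erase r, jac X (i r') (t r') u)
            * (∑ l, Γ l (a 0) (t r) u * jac X (i r) l u) * T (X u) i := by
    intro r
    unfold pull
    simp only [Finset.mul_sum, Finset.sum_mul]
    rw [Finset.sum_comm]
    refine Finset.sum_congr rfl fun i _ => Finset.sum_congr rfl fun l _ => ?_
    rw [← Finset.prod_erase_mul Finset.univ _ (Finset.mem_univ r), Function.update_self]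
    rw [Finset.prod_congr rfl fun r' hr' => by
      rw [Function.update_of_ne (Finset.ne_of_mem_erase hr')]]
    ring
  have h3 : pull X (covWith C T) u a
      = (∑ p, ∑ i : Fin k → Fin n, jac X p (a 0) u * (∏ r, jac X (i r) (t r) u)
            * pd (fun y => T y i) p (X u))
        - ∑ r, ∑ i : Fin k → Fin n, (∏ r' ∈ Finset.univ.erase r, jac X (i r') (t r') u)
            * (∑ p, ∑ q, C (i r) p q (X u) * jac X p (a 0) u * jac X q (t r) u)
            * T (X u) i := by
    unfold pull covWith
    rw [sum_cons]
    simp only [Fin.prod_univ_succ, Fin.cons_zero, Fin.cons_succ, Fin.tail_cons, mul_sub,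
      Finset.sum_sub_distrib]
    congr 1
    simp only [Finset.mul_sum]
    rw [Finset.sum_congr rfl fun p _ => Finset.sum_comm, Finset.sum_comm]
    refine Finset.sum_congr rfl fun r _ => ?_
    simp only [Finset.sum_mul]
    conv_rhs => rw [Finset.sum_comm]
    refine Finset.sum_congr rfl fun p _ => ?_
    rw [sum_update_swap r]
    refine Finset.sum_congr rfl fun i _ => Finset.sum_congr rfl fun l _ => ?_
    rw [← Finset.prod_erase_mul Finset.univ _ (Finset.mem_univ r), Function.update_self,
      Function.update_idem, Function.update_eq_self]
    rw [Finset.prod_congr rfl fun r' hr' => by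
      rw [Function.update_of_ne (Finset.ne_of_mem_erase hr')]]
    simp only [ht, Fin.tail]
    ring
  rw [h3]
  unfold covWith
  change pd (fun v => pull X T v t) (a 0) u
    - ∑ r, ∑ l, Γ l (a 0) (t r) u * pull X T u (Function.update t r l) = _
  rw [h1, Finset.sum_congr rfl fun r _ => h2 r]
  rw [add_comm, add_sub_assoc]
  congr 1
  rw [← Finset.sum_sub_distrib, ← Finset.sum_neg_distrib]
  refine Finset.sum_congr rfl fun r _ => ?_
  rw [← Finset.sum_sub_distrib, ← Finset.sum_neg_distrib]
  refine Finset.sum_congr rfl fun i _ => ?_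
  rw [← hR (i r) (a 0) (t r)]
  ring

end Pullback

end ConfHyp

namespace ConfHyp

/-! ### Christoffel symbols and curvature of a pulled back metric -/

section PullbackMetric

variable {m n : ℕ}

/-- The Jacobian matrix of `X`. -/
noncomputable def jacMat (X : E m → E n) (u : E m) : Matrix (Fin n) (Fin m) ℝ :=
  Matrix.of fun k a => jac X k a u

/-- The matrix of the pullback of the metric `G` along `X`. -/
noncomputable def pullMetric (X : E m → E n) (G : E n → Matrix (Fin n) (Fin n) ℝ) (u : E m) :
    Matrix (Fin m) (Fin m) ℝ :=
  (jacMat X u).transpose * G (X u) * jacMat X u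

theorem pullMetric_apply (X : E m → E n) (G : E n → Matrix (Fin n) (Fin n) ℝ) (u : E m)
    (a b : Fin m) :
    pullMetric X G u a b = ∑ k, ∑ l, jac X k a u * jac X l b u * G (X u) k l := by
  simp only [pullMetric, jacMat, Matrix.mul_apply, Matrix.transpose_apply, Matrix.of_apply,
    Finset.sum_mul]
  rw [Finset.sum_comm]
  exact Finset.sum_congr rfl fun k _ => Finset.sum_congr rfl fun l _ => by ring

/-- The Christoffel symbols of the first kind, `Γ_{l, ab}`. -/
noncomputable def christoffelLow (h : E n → Matrix (Fin n) (Fin n) ℝ) (l a b : Fin n) (x : E n) :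
    ℝ :=
  (1 / 2) * (pd (fun y => h y b l) a x + pd (fun y => h y a l) b x - pd (fun y => h y a b) l x)

theorem christoffel_eq_sum (h : E n → Matrix (Fin n) (Fin n) ℝ) (k a b : Fin n) (x : E n) :
    christoffel h k a b x = ∑ l, (h x)⁻¹ k l * christoffelLow h l a b x := by
  unfold christoffel christoffelLow
  rw [Finset.mul_sum]
  exact Finset.sum_congr rfl fun l _ => by ring

theorem sum_mul_christoffel {h : E n → Matrix (Fin n) (Fin n) ℝ} {x : E n}
    (hx : IsUnit (h x).det) (l a b : Fin n) :
    ∑ k, h x l k * christoffel h k a b x = christoffelLow h l a b x := by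
  simp only [christoffel_eq_sum, Finset.mul_sum]
  rw [Finset.sum_comm]
  simp only [← mul_assoc, ← Finset.sum_mul]
  simp only [← Matrix.mul_apply, Matrix.mul_nonsing_inv _ hx]
  simp [Matrix.one_apply]

/-- In the Koszul combination of the derivatives of `⟨∂_a X, ∂_b X⟩`, the symmetry of second
derivatives cancels all occurrences of `∂∂X` but one, leaving `⟨∂_c X, ∂_a∂_b X + Γ(∂_a X, ∂_b X)⟩`.
-/
theorem christoffelLow_pullMetric {X : E m → E n} {G : E n → Matrix (Fin n) (Fin n) ℝ}
    {h : E m → Matrix (Fin m) (Fin m) ℝ} {u : E m} (hX : ContDiffAt ℝ ∞ X u)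
    (hG : ∀ k l, ContDiffAt ℝ ∞ (fun y => G y k l) (X u)) (hs : ∀ y k l, G y k l = G y l k)
    (hh : h =ᶠ[𝓝 u] pullMetric X G) (c a b : Fin m) :
    christoffelLow h c a b u = ∑ l, jac X l c u * ((∑ k, G (X u) l k *
      pd (fun v => jac X k b v) a u)
        + ∑ p, ∑ q, christoffelLow G l p q (X u) * jac X p a u * jac X q b u) := by
  have hJ : ∀ p b, ContDiffAt ℝ ∞ (fun v => jac X p b v) u := fun p b => contDiffAt_jac hX p b
  have hGX : ∀ k l, ContDiffAt ℝ ∞ (fun v => G (X v) k l) u := fun k l => (hG k l).comp u hX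
  have hpd : ∀ a b c : Fin m, pd (fun v => h v b c) a u
      = (∑ k, ∑ l, pd (fun v => jac X k b v) a u * jac X l c u * G (X u) k l)
        + (∑ k, ∑ l, pd (fun v => jac X k c v) a u * jac X l b u * G (X u) k l)
        + ∑ k, ∑ l, ∑ p, jac X k b u * jac X l c u * jac X p a u
            * pd (fun y => G y k l) p (X u) := by
    intro a b c
    have e : (fun v => h v b c) =ᶠ[𝓝 u] fun v => ∑ k, ∑ l, jac X k b v * jac X l c v *
        G (X v) k l := by
      filter_upwards [hh] with v hv
      rw [hv, pullMetric_apply]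
    rw [pd_congr e, pd_sum _ fun k _ => ContDiffAt.sum fun l _ =>
      ((hJ k b).mul (hJ l c)).mul (hGX k l)]
    have e2 : (∑ k, ∑ l, pd (fun v => jac X k c v) a u * jac X l b u * G (X u) k l)
        = ∑ k, ∑ l, pd (fun v => jac X l c v) a u * jac X k b u * G (X u) k l := by
      rw [Finset.sum_comm]
      simp only [hs]
    rw [e2, ← Finset.sum_add_distrib, ← Finset.sum_add_distrib]
    refine Finset.sum_congr rfl fun k _ => ?_
    rw [pd_sum _ fun l _ => ((hJ k b).mul (hJ l c)).mul (hGX k l),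
      ← Finset.sum_add_distrib, ← Finset.sum_add_distrib]
    refine Finset.sum_congr rfl fun l _ => ?_
    rw [pd_mul ((hJ k b).mul (hJ l c)) (hGX k l), pd_mul (hJ k b) (hJ l c),
      pd_comp_jac (hG k l) hX, Finset.mul_sum]
    have : ∀ p, jac X k b u * jac X l c u * (jac X p a u * pd (fun y => G y k l) p (X u))
      = jac X k b u * jac X l c u * jac X p a u * pd (fun y => G y k l) p (X u) :=
        fun p => by ring
    simp only [this]
    ring
  -- Three labellings of the same triple sum, matching the three positions of the differentiated
  -- index in the Christoffel symbol of `G`.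
  have hD : ∀ a b c : Fin m, (∑ k, ∑ l, ∑ p, jac X k b u * jac X l c u * jac X p a u
            * pd (fun y => G y k l) p (X u))
        = ∑ l, ∑ p, ∑ q, jac X l c u * jac X p a u * jac X q b u
            * pd (fun y => G y q l) p (X u) := by
    intro a b c
    rw [Finset.sum_comm]
    refine Finset.sum_congr rfl fun l _ => ?_
    rw [Finset.sum_comm]
    exact Finset.sum_congr rfl fun p _ => Finset.sum_congr rfl fun q _ => by ring
  have hD' : ∀ a b c : Fin m, (∑ k, ∑ l, ∑ p, jac X k b u * jac X l c u * jac X p a u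
            * pd (fun y => G y k l) p (X u))
        = ∑ l, ∑ p, ∑ q, jac X l c u * jac X p b u * jac X q a u
            * pd (fun y => G y p l) q (X u) := by
    intro a b c
    rw [Finset.sum_comm]
    exact Finset.sum_congr rfl fun l _ => Finset.sum_congr rfl fun p _ =>
      Finset.sum_congr rfl fun q _ => by ring
  have hD'' : ∀ a b c : Fin m, (∑ k, ∑ l, ∑ p, jac X k b u * jac X l c u * jac X p a u
            * pd (fun y => G y k l) p (X u))
        = ∑ l, ∑ p, ∑ q, jac X l a u * jac X p b u * jac X q c u
            * pd (fun y => G y p q) l (X u) := by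
    intro a b c
    rw [Finset.sum_congr rfl fun k _ => Finset.sum_comm, Finset.sum_comm]
    exact Finset.sum_congr rfl fun l _ => Finset.sum_congr rfl fun p _ =>
      Finset.sum_congr rfl fun q _ => by ring
  have hL : (∑ l, jac X l c u * ((∑ k, G (X u) l k * pd (fun v => jac X k b v) a u)
        + ∑ p, ∑ q, christoffelLow G l p q (X u) * jac X p a u * jac X q b u))
      = (∑ k, ∑ l, pd (fun v => jac X k b v) a u * jac X l c u * G (X u) k l)
        + (1 / 2) * ((∑ l, ∑ p, ∑ q, jac X l c u * jac X p a u * jac X q b u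
            * pd (fun y => G y q l) p (X u))
          + (∑ l, ∑ p, ∑ q, jac X l c u * jac X p a u * jac X q b u
            * pd (fun y => G y p l) q (X u))
          - ∑ l, ∑ p, ∑ q, jac X l c u * jac X p a u * jac X q b u
            * pd (fun y => G y p q) l (X u)) := by
    simp only [mul_add, Finset.sum_add_distrib, Finset.mul_sum]
    rw [Finset.sum_comm]
    congr 1
    · exact Finset.sum_congr rfl fun l _ => Finset.sum_congr rfl fun k _ => by
        rw [hs]; ring
    · rw [← Finset.sum_add_distrib, ← Finset.sum_sub_distrib, Finset.mul_sum]
      refine Finset.sum_congr rfl fun l _ => ?_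
      rw [← Finset.sum_add_distrib, ← Finset.sum_sub_distrib, Finset.mul_sum]
      refine Finset.sum_congr rfl fun p _ => ?_
      rw [← Finset.sum_add_distrib, ← Finset.sum_sub_distrib, Finset.mul_sum]
      refine Finset.sum_congr rfl fun q _ => ?_
      unfold christoffelLow
      ring
  rw [hL, ← hD a b c, ← hD' b a c, ← hD'' c a b]
  unfold christoffelLow
  rw [hpd a b c, hpd b a c, hpd c a b]
  simp only [pd_jac_comm hX _ c, pd_jac_comm hX _ a b]
  ring

/-- The tangential projection: Christoffel symbols of a pulled back metric. -/
theorem sum_christoffel_pullMetric {X : E m → E n} {G : E n → Matrix (Fin n) (Fin n) ℝ}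
    {h : E m → Matrix (Fin m) (Fin m) ℝ} {u : E m} (hX : ContDiffAt ℝ ∞ X u)
    (hG : ∀ k l, ContDiffAt ℝ ∞ (fun y => G y k l) (X u)) (hs : ∀ y k l, G y k l = G y l k)
    (hGu : IsUnit (G (X u)).det) (hh : h =ᶠ[𝓝 u] pullMetric X G) (k : Fin n) (a b : Fin m) :
    ∑ d, christoffel h d a b u * jac X k d u
      = ∑ l, (jacMat X u * (h u)⁻¹ * (jacMat X u).transpose * G (X u)) k l
        * (pd (fun v => jac X l b v) a u
          + ∑ p, ∑ q, christoffel G l p q (X u) * jac X p a u * jac X q b u) := by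
  have h1 : ∀ c, christoffelLow h c a b u = ∑ l, ((jacMat X u).transpose * G (X u)) c l
        * (pd (fun v => jac X l b v) a u
          + ∑ p, ∑ q, christoffel G l p q (X u) * jac X p a u * jac X q b u) := by
    intro c
    rw [christoffelLow_pullMetric hX hG hs hh]
    simp only [Matrix.mul_apply, Finset.sum_mul]
    rw [Finset.sum_comm (γ := Fin n)]
    refine Finset.sum_congr rfl fun j _ => ?_
    simp only [mul_assoc]
    rw [← Finset.mul_sum]
    simp only [Matrix.transpose_apply, jacMat, Matrix.of_apply]
    congr 1
    simp only [mul_add, Finset.sum_add_distrib]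
    congr 1
    simp only [← sum_mul_christoffel hGu, Finset.mul_sum, Finset.sum_mul]
    rw [Finset.sum_congr rfl fun p _ => Finset.sum_comm, Finset.sum_comm]
    exact Finset.sum_congr rfl fun l _ => Finset.sum_congr rfl fun p _ =>
      Finset.sum_congr rfl fun q _ => by ring
  simp only [christoffel_eq_sum h, h1]
  rw [Matrix.mul_assoc (jacMat X u * (h u)⁻¹)]
  have e : ∀ l, (jacMat X u * (h u)⁻¹ * ((jacMat X u).transpose * G (X u))) k l
      = ∑ d, ∑ c, jac X k d u * (h u)⁻¹ d c * ((jacMat X u).transpose * G (X u)) c l := by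
    intro l
    rw [Matrix.mul_assoc, Matrix.mul_apply]
    refine Finset.sum_congr rfl fun d _ => ?_
    rw [Matrix.mul_apply, Finset.mul_sum]
    exact Finset.sum_congr rfl fun c _ => by simp [jacMat, mul_assoc]
  simp only [e, Finset.sum_mul, Finset.mul_sum]
  conv_rhs => rw [Finset.sum_comm]
  refine Finset.sum_congr rfl fun d _ => ?_
  conv_rhs => rw [Finset.sum_comm]
  exact Finset.sum_congr rfl fun c _ => Finset.sum_congr rfl fun l _ => by ring

/-- When the tangential projection is the identity, the projected formula is the usual
transformation law of Christoffel symbols. This is the case of a change of coordinates. -/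
theorem related_of_proj_eq {X : E m → E n} {G : E n → Matrix (Fin n) (Fin n) ℝ}
    {h : E m → Matrix (Fin m) (Fin m) ℝ} {u : E m} (hX : ContDiffAt ℝ ∞ X u)
    (hG : ∀ k l, ContDiffAt ℝ ∞ (fun y => G y k l) (X u)) (hs : ∀ y k l, G y k l = G y l k)
    (hGu : IsUnit (G (X u)).det) (hh : h =ᶠ[𝓝 u] pullMetric X G)
    (h1 : jacMat X u * (h u)⁻¹ * (jacMat X u).transpose * G (X u) = 1) :
    Related X (christoffel h) (christoffel G) u := by
  intro k a b
  rw [sum_christoffel_pullMetric hX hG hs hGu hh, h1]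
  simp [Matrix.one_apply]

/-- The curvature tensor `R_{ca}{}^d{}_b` of connection symbols. -/
noncomputable def riem (C : Symbols n) (d c a b : Fin n) (x : E n) : ℝ :=
  pd (C d a b) c x - pd (C d c b) a x
    + ∑ l, (C d c l x * C l a b x - C d a l x * C l c b x)

theorem ricci_eq_sum_riem (h : E n → Matrix (Fin n) (Fin n) ℝ) (i j : Fin n) (x : E n) :
    ricci h i j x = ∑ k, riem (christoffel h) k k i j x := rfl

/-- Differentiate `∂_a∂_b X + C(∂_a X, ∂_b X) = Γ^d_{ab} ∂_d X` along `∂_c` and antisymmetrize in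
`c` and `a`. The third derivatives of `X` cancel; the second derivatives are eliminated by the
relation itself, and the mixed products of `Γ` and `C` cancel. -/
theorem sum_riem_of_related {X : E m → E n} {Γ : Symbols m} {C : Symbols n} {u : E m}
    (hX : ContDiffAt ℝ ∞ X u) (hΓ : ∀ d a b, ContDiffAt ℝ ∞ (Γ d a b) u)
    (hC : ∀ k p q, ContDiffAt ℝ ∞ (C k p q) (X u)) (hR : ∀ᶠ v in 𝓝 u, Related X Γ C v)
    (k : Fin n) (c a b : Fin m) :
    ∑ d, riem Γ d c a b u * jac X k d u
      = ∑ p, ∑ q, ∑ r, riem C k p q r (X u) * jac X p c u * jac X q a u * jac X r b u := by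
  have hJ : ∀ p b, ContDiffAt ℝ ∞ (fun v => jac X p b v) u := fun p b => contDiffAt_jac hX p b
  have hCX : ∀ k p q, ContDiffAt ℝ ∞ (fun v => C k p q (X v)) u :=
    fun k p q => (hC k p q).comp u hX
  have hdiff : ∀ c a, pd (fun v => pd (fun w => jac X k b w) a v) c u
      + ((∑ p, ∑ q, (∑ r, jac X r c u * pd (C k p q) r (X u)) * jac X p a u * jac X q b u)
        + (∑ p, ∑ q, C k p q (X u) * pd (fun v => jac X p a v) c u * jac X q b u)
        + ∑ p, ∑ q, C k p q (X u) * jac X p a u * pd (fun v => jac X q b v) c u)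
      = (∑ d, pd (Γ d a b) c u * jac X k d u)
        + ∑ d, Γ d a b u * pd (fun v => jac X k d v) c u := by
    intro c a
    have e : (fun v => pd (fun w => jac X k b w) a v
        + ∑ p, ∑ q, C k p q (X v) * jac X p a v * jac X q b v)
        =ᶠ[𝓝 u] fun v => ∑ d, Γ d a b v * jac X k d v := by
      filter_upwards [hR] with v hv using hv k a b
    have e' := pd_congr e c
    have hs1 : ∀ p q, ContDiffAt ℝ ∞ (fun v => C k p q (X v) * jac X p a v * jac X q b v) u :=
      fun p q => ((hCX k p q).mul (hJ p a)).mul (hJ q b)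
    have hs2 : ∀ p, ContDiffAt ℝ ∞
        (fun v => ∑ q, C k p q (X v) * jac X p a v * jac X q b v) u :=
      fun p => ContDiffAt.sum fun q _ => hs1 p q
    rw [pd_add (contDiffAt_pd (hJ k b) a) (ContDiffAt.sum fun p _ => hs2 p),
      pd_sum _ fun p _ => hs2 p, pd_sum _ fun d _ => (hΓ d a b).mul (hJ k d)] at e'
    rw [← Finset.sum_add_distrib, ← Finset.sum_add_distrib, ← Finset.sum_add_distrib]
    convert e' using 2
    · refine Finset.sum_congr rfl fun p _ => ?_
      rw [pd_sum _ fun q _ => hs1 p q, ← Finset.sum_add_distrib, ← Finset.sum_add_distrib]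
      refine Finset.sum_congr rfl fun q _ => ?_
      rw [pd_mul ((hCX k p q).mul (hJ p a)) (hJ q b), pd_mul (hCX k p q) (hJ p a),
        pd_comp_jac (hC k p q) hX]
      ring
    · rename_i d _
      rw [pd_mul (hΓ d a b) (hJ k d)]
  -- The undifferentiated relation, solved for the second derivatives of `X`.
  have hu : ∀ q c, pd (fun v => jac X q b v) c u = (∑ d, Γ d c b u * jac X q d u)
      - ∑ r, ∑ s, C q r s (X u) * jac X r c u * jac X s b u := by
    intro q c
    rw [← hR.self_of_nhds q c b]; ring
  have hu' : ∀ d c, pd (fun v => jac X k d v) c u = (∑ e, Γ e c d u * jac X k e u)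
      - ∑ p, ∑ q, C k p q (X u) * jac X p c u * jac X q d u := by
    intro d c
    rw [← hR.self_of_nhds k c d]; ring
  have h1 : ∀ c a, (∑ p, ∑ q, C k p q (X u) * jac X p a u * pd (fun v => jac X q b v) c u)
      = (∑ d, Γ d c b u * ∑ p, ∑ q, C k p q (X u) * jac X p a u * jac X q d u)
        - ∑ r, ∑ p, ∑ s, (∑ q, C k p q (X u) * C q r s (X u)) * jac X r c u * jac X p a u
          * jac X s b u := by
    intro c a
    simp only [hu, mul_sub, Finset.sum_sub_distrib, Finset.mul_sum, Finset.sum_mul]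
    congr 1
    · rw [Finset.sum_congr rfl fun p _ => Finset.sum_comm, Finset.sum_comm]
      exact Finset.sum_congr rfl fun d _ => Finset.sum_congr rfl fun p _ =>
        Finset.sum_congr rfl fun q _ => by ring
    · rw [Finset.sum_congr rfl fun p _ => Finset.sum_comm, Finset.sum_comm]
      refine Finset.sum_congr rfl fun r _ => Finset.sum_congr rfl fun p _ => ?_
      rw [Finset.sum_comm]
      exact Finset.sum_congr rfl fun s _ => Finset.sum_congr rfl fun q _ => by ring
  have h2 : ∀ c a, (∑ d, Γ d a b u * pd (fun v => jac X k d v) c u)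
      = (∑ e, (∑ d, Γ e c d u * Γ d a b u) * jac X k e u)
        - ∑ d, Γ d a b u * ∑ p, ∑ q, C k p q (X u) * jac X p c u * jac X q d u := by
    intro c a
    simp only [hu', mul_sub, Finset.sum_sub_distrib]
    congr 1
    simp only [Finset.mul_sum, Finset.sum_mul]
    rw [Finset.sum_comm]
    exact Finset.sum_congr rfl fun d _ => Finset.sum_congr rfl fun p _ => by ring
  have h3 : ∀ c a, (∑ p, ∑ q, (∑ r, jac X r c u * pd (C k p q) r (X u)) * jac X p a u
        * jac X q b u)
      = ∑ r, ∑ p, ∑ q, pd (C k p q) r (X u) * jac X r c u * jac X p a u * jac X q b u := by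
    intro c a
    simp only [Finset.sum_mul]
    rw [Finset.sum_congr rfl fun p _ => Finset.sum_comm, Finset.sum_comm]
    exact Finset.sum_congr rfl fun d _ => Finset.sum_congr rfl fun p _ =>
      Finset.sum_congr rfl fun q _ => by ring
  -- This term is symmetric in `c` and `a`, so it disappears after antisymmetrization.
  have h4 : (∑ p, ∑ q, C k p q (X u) * pd (fun v => jac X p a v) c u * jac X q b u)
      = ∑ p, ∑ q, C k p q (X u) * pd (fun v => jac X p c v) a u * jac X q b u := by
    simp only [pd_jac_comm hX _ a c]
  have hL : ∑ d, riem Γ d c a b u * jac X k d u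
      = (∑ d, pd (Γ d a b) c u * jac X k d u) - (∑ d, pd (Γ d c b) a u * jac X k d u)
        + (∑ e, (∑ d, Γ e c d u * Γ d a b u) * jac X k e u)
        - (∑ e, (∑ d, Γ e a d u * Γ d c b u) * jac X k e u) := by
    rw [← Finset.sum_sub_distrib, ← Finset.sum_add_distrib, ← Finset.sum_sub_distrib]
    refine Finset.sum_congr rfl fun d _ => ?_
    unfold riem
    rw [Finset.sum_sub_distrib]
    ring
  have hsw : ∀ f : Fin n → Fin n → Fin n → ℝ, (∑ r, ∑ p, ∑ s, f r p s)
      = ∑ p, ∑ r, ∑ s, f r p s := fun f => Finset.sum_comm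
  have hRR : (∑ p, ∑ q, ∑ r, riem C k p q r (X u) * jac X p c u * jac X q a u * jac X r b u)
      = (∑ r, ∑ p, ∑ q, pd (C k p q) r (X u) * jac X r c u * jac X p a u * jac X q b u)
        - (∑ r, ∑ p, ∑ q, pd (C k p q) r (X u) * jac X r a u * jac X p c u * jac X q b u)
        + (∑ r, ∑ p, ∑ s, (∑ q, C k p q (X u) * C q r s (X u)) * jac X r a u * jac X p c u
          * jac X s b u)
        - (∑ r, ∑ p, ∑ s, (∑ q, C k p q (X u) * C q r s (X u)) * jac X r c u * jac X p a u
          * jac X s b u) := by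
    rw [hsw fun r p q => pd (C k p q) r (X u) * jac X r a u * jac X p c u * jac X q b u,
      hsw fun r p s => (∑ q, C k p q (X u) * C q r s (X u)) * jac X r a u * jac X p c u
          * jac X s b u]
    simp only [← Finset.sum_sub_distrib, ← Finset.sum_add_distrib]
    refine Finset.sum_congr rfl fun p _ => Finset.sum_congr rfl fun q _ =>
      Finset.sum_congr rfl fun r _ => ?_
    unfold riem
    rw [Finset.sum_sub_distrib]
    ring
  have d1 := hdiff c a
  have d2 := hdiff a c
  have hc : pd (fun v => pd (fun w => jac X k b w) a v) c u
      = pd (fun v => pd (fun w => jac X k b w) c v) a u := pd_comm (hJ k b) a c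
  rw [h1 c a, h2 c a, h3 c a, h4] at d1
  rw [h1 a c, h2 a c, h3 a c] at d2
  rw [hL, hRR]
  linarith

end PullbackMetric

end ConfHyp

namespace ConfHyp

/-! ### Contractions of pulled back tensors -/

section Contractions

variable {m n k : ℕ}

theorem contDiffAt_det {ι : Type*} [Fintype ι] [DecidableEq ι] {F : Type*}
    [NormedAddCommGroup F] [NormedSpace ℝ F] {A : F → Matrix ι ι ℝ} {x : F}
    (hA : ∀ i j, ContDiffAt ℝ ∞ (fun y => A y i j) x) :
    ContDiffAt ℝ ∞ (fun y => (A y).det) x := by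
  simp only [Matrix.det_apply]
  exact ContDiffAt.sum fun σ _ => ContDiffAt.const_smul _ (contDiffAt_prod fun i _ => hA _ _)

theorem contDiffAt_matrix_inv {ι : Type*} [Fintype ι] [DecidableEq ι] {F : Type*}
    [NormedAddCommGroup F] [NormedSpace ℝ F] {A : F → Matrix ι ι ℝ} {x : F}
    (hA : ∀ i j, ContDiffAt ℝ ∞ (fun y => A y i j) x) (hx : IsUnit (A x).det) (i j : ι) :
    ContDiffAt ℝ ∞ (fun y => (A y)⁻¹ i j) x := by
  simp only [Matrix.inv_def, Ring.inverse_eq_inv, Matrix.smul_apply, smul_eq_mul,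
    Matrix.adjugate_apply]
  refine ((contDiffAt_det hA).inv hx.ne_zero).mul (contDiffAt_det fun p q => ?_)
  by_cases h : p = j
  · subst h; simpa using contDiffAt_const
  · simpa [Matrix.updateRow_ne h] using hA p q

theorem contDiffAt_christoffel {h : E n → Matrix (Fin n) (Fin n) ℝ} {x : E n}
    (hh : ∀ i j, ContDiffAt ℝ ∞ (fun y => h y i j) x) (hx : IsUnit (h x).det)
    (k i j : Fin n) : ContDiffAt ℝ ∞ (christoffel h k i j) x := by
  have : christoffel h k i j = fun x => christoffel h k i j x := rfl
  rw [this]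
  unfold christoffel
  refine contDiffAt_const.mul (ContDiffAt.sum fun l _ => ?_)
  exact (contDiffAt_matrix_inv hh hx k l).mul
    (((contDiffAt_pd (hh _ _) _).add (contDiffAt_pd (hh _ _) _)).sub (contDiffAt_pd (hh _ _) _))

theorem contDiffAt_pullMetric {X : E m → E n} {G : E n → Matrix (Fin n) (Fin n) ℝ} {u : E m}
    (hX : ContDiffAt ℝ ∞ X u) (hG : ∀ k l, ContDiffAt ℝ ∞ (fun y => G y k l) (X u))
    (a b : Fin m) : ContDiffAt ℝ ∞ (fun v => pullMetric X G v a b) u := by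
  simp only [pullMetric_apply]
  exact ContDiffAt.sum fun k _ => ContDiffAt.sum fun l _ =>
    ((contDiffAt_jac hX k a).mul (contDiffAt_jac hX l b)).mul ((hG k l).comp u hX)

theorem prod_sum_sum (f : Fin k → Fin m → Fin n → ℝ) :
    ∏ r, ∑ x, ∑ y, f r x y
      = ∑ a : Fin k → Fin m, ∑ b : Fin k → Fin n, ∏ r, f r (a r) (b r) := by
  rw [Finset.prod_univ_sum, Fintype.piFinset_univ]
  refine Finset.sum_congr rfl fun a _ => ?_
  rw [Finset.prod_univ_sum, Fintype.piFinset_univ]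

/-- The intrinsic inverse metric enters a full contraction only through `J h⁻¹ Jᵀ`, its push-forward
to the ambient space, which for a hypersurface is a multiple of the orthogonal projection. -/
theorem pairing_pull (X : E m → E n) (h : E m → Matrix (Fin m) (Fin m) ℝ)
    (T S : CoordTensor n k) (u : E m) :
    pairing h (pull X T) (pull X S) u
      = ∑ i : Fin k → Fin n, ∑ j : Fin k → Fin n,
        (∏ r, (jacMat X u * (h u)⁻¹ * (jacMat X u).transpose) (i r) (j r))
          * T (X u) i * S (X u) j := by
  have e : ∀ p q, (jacMat X u * (h u)⁻¹ * (jacMat X u).transpose) p q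
      = ∑ a, ∑ b, jac X p a u * (h u)⁻¹ a b * jac X q b u := by
    intro p q
    rw [Matrix.mul_apply]
    simp only [Matrix.mul_apply, Finset.sum_mul, Matrix.transpose_apply, jacMat, Matrix.of_apply]
    exact Finset.sum_comm
  simp only [e, prod_sum_sum]
  unfold pairing pull
  simp only [Finset.sum_mul, Finset.mul_sum]
  rw [Finset.sum_congr rfl fun a _ => Finset.sum_comm, Finset.sum_comm]
  conv_rhs => rw [Finset.sum_congr rfl fun a _ => Finset.sum_comm]
  conv_lhs => enter [2, j]; rw [Finset.sum_congr rfl fun a _ => Finset.sum_comm, Finset.sum_comm]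
  conv_lhs => rw [Finset.sum_comm]
  refine Finset.sum_congr rfl fun i _ => ?_
  conv_rhs => rw [Finset.sum_comm]
  refine Finset.sum_congr rfl fun j _ => Finset.sum_congr rfl fun a _ =>
    Finset.sum_congr rfl fun b _ => ?_
  simp only [Finset.prod_mul_distrib]
  ring

theorem pull_congr {X : E m → E n} {T S : CoordTensor n k} {u : E m} (h : T (X u) = S (X u)) :
    pull X T u = pull X S u := by
  unfold pull; rw [h]

theorem traceFirstTwo_pull (X : E m → E n) (h : E m → Matrix (Fin m) (Fin m) ℝ)
    (T : CoordTensor n (k + 2)) (u : E m) :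
    traceFirstTwo h (pull X T) u
      = pull X (fun x i => ∑ p, ∑ q, (jacMat X u * (h u)⁻¹ * (jacMat X u).transpose) p q
          * T x (Fin.cons p (Fin.cons q i))) u := by
  have e : ∀ p q, (jacMat X u * (h u)⁻¹ * (jacMat X u).transpose) p q
      = ∑ a, ∑ b, jac X p a u * (h u)⁻¹ a b * jac X q b u := by
    intro p q
    rw [Matrix.mul_apply]
    simp only [Matrix.mul_apply, Finset.sum_mul, Matrix.transpose_apply, jacMat, Matrix.of_apply]
    exact Finset.sum_comm
  ext a
  simp only [e]
  unfold traceFirstTwo pull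
  simp only [sum_cons, Fin.prod_univ_succ, Fin.cons_zero, Fin.cons_succ]
  simp only [Finset.sum_mul, Finset.mul_sum]
  have c1 : ∀ f : Fin m → Fin m → Fin n → Fin n → (Fin k → Fin n) → ℝ,
      ∑ a, ∑ b, ∑ p, ∑ q, ∑ i, f a b p q i = ∑ i, ∑ p, ∑ q, ∑ a, ∑ b, f a b p q i := by
    intro f
    simp only [← Fintype.sum_prod_type']
    exact Fintype.sum_equiv ⟨fun z => (z.2.2.2.2, z.2.2.1, z.2.2.2.1, z.1, z.2.1),
      fun z => (z.2.2.2.1, z.2.2.2.2, z.2.1, z.2.2.1, z.1), fun _ => rfl, fun _ => rfl⟩ _ _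
      fun _ => rfl
  rw [c1]
  refine Finset.sum_congr rfl fun i _ => Finset.sum_congr rfl fun p _ =>
    Finset.sum_congr rfl fun q _ => Finset.sum_congr rfl fun a _ =>
    Finset.sum_congr rfl fun b _ => ?_
  ring

theorem scalarCurv_of_related {X : E m → E n} {h : E m → Matrix (Fin m) (Fin m) ℝ}
    {C : Symbols n} {u : E m} {G : Matrix (Fin n) (Fin n) ℝ}
    (hh : (h u)⁻¹ * ((jacMat X u).transpose * G * jacMat X u) = 1)
    (hR : ∀ k c a b, ∑ d, riem (christoffel h) d c a b u * jac X k d u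
      = ∑ p, ∑ q, ∑ r, riem C k p q r (X u) * jac X p c u * jac X q a u * jac X r b u) :
    scalarCurv h u = ∑ q, ∑ r, (jacMat X u * (h u)⁻¹ * (jacMat X u).transpose) q r
      * ∑ p, ∑ k, (jacMat X u * (h u)⁻¹ * (jacMat X u).transpose * G) p k
        * riem C k p q r (X u) := by
  -- `Y` is a left inverse of the Jacobian. It recovers the intrinsic curvature components from
  -- `hR`, which only gives their images under the differential of `X`.
  set Y : Matrix (Fin m) (Fin n) ℝ := (h u)⁻¹ * (jacMat X u).transpose * G with hY
  have hYJ : Y * jacMat X u = 1 := by rw [hY, ← hh]; simp only [Matrix.mul_assoc]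
  have hJY : jacMat X u * (h u)⁻¹ * (jacMat X u).transpose * G = jacMat X u * Y := by
    rw [hY]; simp only [Matrix.mul_assoc]
  have h1 : ∀ d c a b, riem (christoffel h) d c a b u = ∑ k, Y d k *
      ∑ p, ∑ q, ∑ r, riem C k p q r (X u) * jac X p c u * jac X q a u * jac X r b u := by
    intro d c a b
    simp only [← hR, Finset.mul_sum]
    rw [Finset.sum_comm]
    have : ∀ d', (∑ k, Y d k * (riem (christoffel h) d' c a b u * jac X k d' u))
        = riem (christoffel h) d' c a b u * (Y * jacMat X u) d d' := by
      intro d'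
      rw [Matrix.mul_apply, Finset.mul_sum]
      exact Finset.sum_congr rfl fun k _ => by simp only [jacMat, Matrix.of_apply]; ring
    simp only [this, hYJ, Matrix.one_apply]
    simp
  have h2 : ∀ a b, ricci h a b u = ∑ q, ∑ r, jac X q a u * jac X r b u *
      ∑ p, ∑ k, (jacMat X u * Y) p k * riem C k p q r (X u) := by
    intro a b
    rw [ricci_eq_sum_riem]
    simp only [h1, Matrix.mul_apply, Finset.sum_mul, Finset.mul_sum, jacMat, Matrix.of_apply]
    have c1 : ∀ f : Fin m → Fin n → Fin n → Fin n → Fin n → ℝ,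
        ∑ d, ∑ k, ∑ p, ∑ q, ∑ r, f d k p q r = ∑ q, ∑ r, ∑ p, ∑ k, ∑ d, f d k p q r := by
      intro f
      simp only [← Fintype.sum_prod_type']
      exact Fintype.sum_equiv ⟨fun z => (z.2.2.2.1, z.2.2.2.2, z.2.2.1, z.2.1, z.1),
        fun z => (z.2.2.2.2, z.2.2.2.1, z.2.2.1, z.1, z.2.1), fun _ => rfl, fun _ => rfl⟩ _ _
        fun _ => rfl
    rw [c1]
    refine Finset.sum_congr rfl fun q _ => Finset.sum_congr rfl fun r _ =>
      Finset.sum_congr rfl fun p _ => Finset.sum_congr rfl fun k _ =>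
      Finset.sum_congr rfl fun d _ => ?_
    ring
  rw [hJY]
  unfold scalarCurv
  simp only [h2, Finset.mul_sum]
  have e : ∀ p q, (jacMat X u * (h u)⁻¹ * (jacMat X u).transpose) p q
      = ∑ a, ∑ b, jac X p a u * (h u)⁻¹ a b * jac X q b u := by
    intro p q
    rw [Matrix.mul_apply]
    simp only [Matrix.mul_apply, Finset.sum_mul, Matrix.transpose_apply, jacMat, Matrix.of_apply]
    exact Finset.sum_comm
  simp only [e, Finset.sum_mul]
  have c2 : ∀ f : Fin m → Fin m → Fin n → Fin n → Fin n → Fin n → ℝ,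
      ∑ a, ∑ b, ∑ q, ∑ r, ∑ p, ∑ k, f a b q r p k
        = ∑ q, ∑ r, ∑ p, ∑ k, ∑ a, ∑ b, f a b q r p k := by
    intro f
    simp only [← Fintype.sum_prod_type']
    exact Fintype.sum_equiv ⟨fun z => (z.2.2.1, z.2.2.2.1, z.2.2.2.2.1, z.2.2.2.2.2, z.1, z.2.1),
      fun z => (z.2.2.2.2.1, z.2.2.2.2.2, z.1, z.2.1, z.2.2.1, z.2.2.2.1),
      fun _ => rfl, fun _ => rfl⟩ _ _ fun _ => rfl
  rw [c2]
  refine Finset.sum_congr rfl fun q _ => Finset.sum_congr rfl fun r _ =>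
    Finset.sum_congr rfl fun p _ => Finset.sum_congr rfl fun k _ =>
    Finset.sum_congr rfl fun a _ => Finset.sum_congr rfl fun b _ => ?_
  ring

/-- The orthogonal projection onto the tangent space of a hypersurface. -/
theorem mul_inv_mul_transpose {J : Matrix (Fin (m + 1)) (Fin m) ℝ} {v : Fin (m + 1) → ℝ}
    (hJ : IsUnit (J.transpose * J).det) (hv : ∑ i, v i * v i = 1)
    (hJv : ∀ a, ∑ i, v i * J i a = 0) :
    J * (J.transpose * J)⁻¹ * J.transpose = 1 - Matrix.of fun i j => v i * v j := by
  set D := (J.transpose * J)⁻¹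
  -- The block matrix with rows `D Jᵀ` and `vᵀ` is a left inverse of the square matrix `(J | v)`. A
  -- left inverse of a square matrix is also a right inverse, and that product expands to `J D Jᵀ +
  -- v vᵀ = 1`.
  have h1 : Matrix.fromRows (D * J.transpose) (Matrix.replicateRow Unit v)
      * Matrix.fromCols J (Matrix.replicateCol Unit v) = 1 := by
    rw [Matrix.fromRows_mul_fromCols, ← Matrix.fromBlocks_one]
    congr 1
    · rw [Matrix.mul_assoc]; exact Matrix.nonsing_inv_mul _ hJ
    · rw [Matrix.mul_assoc]
      have : J.transpose * Matrix.replicateCol Unit v = 0 := by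
        ext a _
        simp only [Matrix.mul_apply, Matrix.transpose_apply, Matrix.replicateCol_apply,
          Matrix.zero_apply, ← hJv a]
        exact Finset.sum_congr rfl fun i _ => mul_comm _ _
      rw [this, Matrix.mul_zero]
    · ext _ a
      simp [Matrix.mul_apply, hJv a]
    · ext _ _
      simp [Matrix.mul_apply, hv]
  have hc : Fintype.card (Fin m ⊕ Unit) = Fintype.card (Fin (m + 1)) := by simp
  have h2 := (Matrix.mul_eq_one_comm_of_card_eq _ _ _ hc).1 h1
  rw [Matrix.fromCols_mul_fromRows] at h2
  rw [eq_sub_iff_add_eq, ← h2, Matrix.mul_assoc]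
  congr 1
  ext i j
  simp [Matrix.mul_apply]

/-- `c` times the projection onto the first `m` coordinates. -/
def IsTangential (N : Matrix (Fin (m + 1)) (Fin (m + 1)) ℝ) (c : ℝ) : Prop :=
  ∀ p q, N p q = c * ∑ a : Fin m, (if p = a.castSucc then 1 else 0)
    * (if q = a.castSucc then 1 else 0)

theorem IsTangential.sum_mul {N : Matrix (Fin (m + 1)) (Fin (m + 1)) ℝ} {c : ℝ}
    (hN : IsTangential N c) (f : Fin (m + 1) → Fin (m + 1) → ℝ) :
    ∑ p, ∑ q, N p q * f p q = c * ∑ a : Fin m, f a.castSucc a.castSucc := by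
  simp only [hN _ _, Finset.sum_mul, Finset.mul_sum]
  rw [Finset.sum_congr rfl fun p _ => Finset.sum_comm, Finset.sum_comm]
  refine Finset.sum_congr rfl fun a _ => ?_
  simp [Finset.sum_ite_eq', mul_ite, ite_mul]

theorem IsTangential.pairing_pull {X : E m → E (m + 1)} {h : E m → Matrix (Fin m) (Fin m) ℝ}
    {u : E m} {c : ℝ} (hN : IsTangential (jacMat X u * (h u)⁻¹ * (jacMat X u).transpose) c)
    (T S : CoordTensor (m + 1) k) :
    pairing h (pull X T) (pull X S) u
      = c ^ k * ∑ a : Fin k → Fin m, T (X u) (fun r => (a r).castSucc)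
          * S (X u) (fun r => (a r).castSucc) := by
  rw [ConfHyp.pairing_pull]
  have h1 : ∀ i j : Fin k → Fin (m + 1),
      (∏ r, (jacMat X u * (h u)⁻¹ * (jacMat X u).transpose) (i r) (j r))
      = ∑ a : Fin k → Fin m, c ^ k * ((if i = fun r => (a r).castSucc then 1 else 0)
        * (if j = fun r => (a r).castSucc then 1 else 0)) := by
    intro i j
    simp only [hN _ _]
    rw [Finset.prod_mul_distrib, Finset.prod_const, Finset.card_univ, Fintype.card_fin,
      Finset.prod_univ_sum, Fintype.piFinset_univ, Finset.mul_sum]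
    refine Finset.sum_congr rfl fun a _ => ?_
    have : ∀ i : Fin k → Fin (m + 1), (∏ r, if i r = (a r).castSucc then (1 : ℝ) else 0)
        = if i = fun r => (a r).castSucc then 1 else 0 := by
      intro i
      rw [Finset.prod_ite_zero]
      simp [funext_iff]
    rw [Finset.prod_mul_distrib, this, this]
  simp only [h1, Finset.sum_mul, Finset.mul_sum]
  rw [Finset.sum_congr rfl fun p _ => Finset.sum_comm, Finset.sum_comm]
  refine Finset.sum_congr rfl fun a _ => ?_
  simp [Finset.sum_ite_eq', mul_ite, ite_mul, mul_assoc]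

theorem IsTangential.traceFirstTwo_pull {X : E m → E (m + 1)}
    {h : E m → Matrix (Fin m) (Fin m) ℝ} {u : E m} {c : ℝ}
    (hN : IsTangential (jacMat X u * (h u)⁻¹ * (jacMat X u).transpose) c)
    (T : CoordTensor (m + 1) (k + 2)) :
    traceFirstTwo h (pull X T) u
      = pull X (fun x i => c * ∑ a : Fin m, T x (Fin.cons a.castSucc (Fin.cons a.castSucc i)))
          u := by
  rw [ConfHyp.traceFirstTwo_pull]
  exact pull_congr (by ext i; exact hN.sum_mul _)

end Contractions

end ConfHyp

namespace ConfHyp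

/-! ### The Willmore expression of a pulled back tensor -/

section Willmore

variable {m n k : ℕ}

theorem contDiffAt_covWith {C : Symbols n} {T : CoordTensor n k} {x : E n}
    (hC : ∀ l p q, ContDiffAt ℝ ∞ (C l p q) x) (hT : ∀ i, ContDiffAt ℝ ∞ (fun y => T y i) x)
    (a : Fin (k + 1) → Fin n) : ContDiffAt ℝ ∞ (fun y => covWith C T y a) x := by
  unfold covWith
  exact (contDiffAt_pd (hT _) _).sub (ContDiffAt.sum fun r _ => ContDiffAt.sum fun l _ =>
    (hC _ _ _).mul (hT _))

theorem covWith_congr {C : Symbols n} {T S : CoordTensor n k} {x : E n} (h : T =ᶠ[𝓝 x] S) :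
    covWith C T =ᶠ[𝓝 x] covWith C S := by
  filter_upwards [h.eventually_nhds] with y hy
  ext a
  unfold covWith
  rw [pd_congr (by filter_upwards [hy] with z hz; rw [hz]), hy.self_of_nhds]

theorem covWith_pull_eventually {X : E m → E n} {Γ : Symbols m} {C : Symbols n}
    {T : CoordTensor n k} {A : CoordTensor m k} {u : E m}
    (hX : ∀ᶠ v in 𝓝 u, ContDiffAt ℝ ∞ X v)
    (hT : ∀ᶠ v in 𝓝 u, ∀ i, ContDiffAt ℝ ∞ (fun y => T y i) (X v))
    (hR : ∀ᶠ v in 𝓝 u, Related X Γ C v) (hA : A =ᶠ[𝓝 u] pull X T) :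
    covWith Γ A =ᶠ[𝓝 u] pull X (covWith C T) := by
  filter_upwards [hX, hT, hR, covWith_congr (C := Γ) hA] with v h1 h2 h3 h4
  rw [h4]
  ext a
  exact covWith_pull h1 h2 h3 a

theorem pairing_congr {h : E n → Matrix (Fin n) (Fin n) ℝ} {T T' S S' : CoordTensor n k} {x : E n}
    (hT : T x = T' x) (hS : S x = S' x) : pairing h T S x = pairing h T' S' x := by
  unfold pairing; rw [hT, hS]

theorem traceFirstTwo_congr {h : E n → Matrix (Fin n) (Fin n) ℝ} {T S : CoordTensor n (k + 2)}
    {x : E n} (hT : T x = S x) : traceFirstTwo h T x = traceFirstTwo h S x := by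
  unfold traceFirstTwo; rw [hT]

theorem sum_castSucc_one (f : (Fin 1 → Fin (m + 1)) → ℝ) :
    ∑ a : Fin 1 → Fin m, f (fun r => (a r).castSucc) = ∑ a : Fin m, f ![a.castSucc] := by
  rw [sum_cons]
  refine Finset.sum_congr rfl fun a _ => ?_
  rw [Fintype.sum_unique]
  congr 1; ext r; fin_cases r; rfl

theorem sum_castSucc_two (f : (Fin 2 → Fin (m + 1)) → ℝ) :
    ∑ a : Fin 2 → Fin m, f (fun r => (a r).castSucc)
      = ∑ a : Fin m, ∑ b : Fin m, f ![a.castSucc, b.castSucc] := by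
  rw [sum_cons]
  refine Finset.sum_congr rfl fun a _ => ?_
  rw [sum_cons]
  refine Finset.sum_congr rfl fun b _ => ?_
  rw [Fintype.sum_unique]
  congr 1; ext r; fin_cases r <;> rfl

theorem sum_castSucc_three (f : (Fin 3 → Fin (m + 1)) → ℝ) :
    ∑ a : Fin 3 → Fin m, f (fun r => (a r).castSucc)
      = ∑ a : Fin m, ∑ b : Fin m, ∑ c : Fin m, f ![a.castSucc, b.castSucc, c.castSucc] := by
  rw [sum_cons]
  refine Finset.sum_congr rfl fun a _ => ?_
  rw [sum_cons]
  refine Finset.sum_congr rfl fun b _ => ?_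
  rw [sum_cons]
  refine Finset.sum_congr rfl fun c _ => ?_
  rw [Fintype.sum_unique]
  congr 1; ext r; fin_cases r <;> rfl

/-- The Willmore expression of the pullback of an ambient tensor `T`, at a point where the tangent
space of the hypersurface is spanned by the first three coordinate directions. -/
theorem willmoreExpr_pull {X : E 3 → E 4} {h : E 3 → Matrix (Fin 3) (Fin 3) ℝ} {C : Symbols 4}
    {T : CoordTensor 4 2} {A : CoordTensor 3 2} {u : E 3} {c : ℝ} (hc : c ≠ 0)
    (hX : ∀ᶠ v in 𝓝 u, ContDiffAt ℝ ∞ X v)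
    (hT : ∀ᶠ v in 𝓝 u, ∀ i, ContDiffAt ℝ ∞ (fun y => T y i) (X v))
    (hC : ∀ᶠ v in 𝓝 u, ∀ l p q, ContDiffAt ℝ ∞ (C l p q) (X v))
    (hR : ∀ᶠ v in 𝓝 u, Related X (christoffel h) C v) (hA : A =ᶠ[𝓝 u] pull X T)
    (hN : IsTangential (jacMat X u * (h u)⁻¹ * (jacMat X u).transpose) c)
    (hh : (h u)⁻¹ * ((jacMat X u).transpose * (c⁻¹ • 1 : Matrix (Fin 4) (Fin 4) ℝ) * jacMat X u)
      = 1)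
    (hΓ : ∀ d a b, ContDiffAt ℝ ∞ (christoffel h d a b) u) :
    willmoreExpr h A u = (1 / 6) *
      (c ^ 3 * (∑ a : Fin 3, ∑ b : Fin 3, ∑ d : Fin 3,
          covWith C T (X u) ![a.castSucc, b.castSucc, d.castSucc] ^ 2)
        + 2 * c ^ 3 * (∑ a : Fin 3, ∑ b : Fin 3, T (X u) ![a.castSucc, b.castSucc]
          * ∑ d : Fin 3, covWith C (covWith C T) (X u)
            ![d.castSucc, d.castSucc, a.castSucc, b.castSucc])
        + (3 / 2) * c ^ 3 * (∑ b : Fin 3, (∑ a : Fin 3,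
          covWith C T (X u) ![a.castSucc, a.castSucc, b.castSucc]) ^ 2)
        - (1 / 2) * c ^ 3 * (∑ q : Fin 3, ∑ p : Fin 3,
            riem C p.castSucc p.castSucc q.castSucc q.castSucc (X u))
          * (∑ a : Fin 3, ∑ b : Fin 3, T (X u) ![a.castSucc, b.castSucc] ^ 2)
        + (c ^ 2 * ∑ a : Fin 3, ∑ b : Fin 3, T (X u) ![a.castSucc, b.castSucc] ^ 2) ^ 2) := by
  have hA1 : covDeriv h A =ᶠ[𝓝 u] pull X (covWith C T) :=
    covWith_pull_eventually hX hT hR hA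
  have hT1 : ∀ᶠ v in 𝓝 u, ∀ i, ContDiffAt ℝ ∞ (fun y => covWith C T y i) (X v) := by
    filter_upwards [hT, hC] with v h1 h2 i using contDiffAt_covWith h2 h1 i
  have hA2 : covDeriv h (covDeriv h A) =ᶠ[𝓝 u] pull X (covWith C (covWith C T)) :=
    covWith_pull_eventually hX hT1 hR hA1
  have e0 := hA.self_of_nhds
  have e1 := hA1.self_of_nhds
  have e2 := hA2.self_of_nhds
  have k1 : pairing h (covDeriv h A) (covDeriv h A) u = c ^ 3 * ∑ a : Fin 3, ∑ b : Fin 3,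
      ∑ d : Fin 3, covWith C T (X u) ![a.castSucc, b.castSucc, d.castSucc] ^ 2 := by
    rw [pairing_congr e1 e1, hN.pairing_pull,
      sum_castSucc_three fun i => covWith C T (X u) i * covWith C T (X u) i]
    simp only [sq]
  have k2 : pairing h A A u
      = c ^ 2 * ∑ a : Fin 3, ∑ b : Fin 3, T (X u) ![a.castSucc, b.castSucc] ^ 2 := by
    rw [pairing_congr e0 e0, hN.pairing_pull, sum_castSucc_two fun i => T (X u) i * T (X u) i]
    simp only [sq]
  have k3 : pairing h A (laplacian h A) u = c ^ 3 * ∑ a : Fin 3, ∑ b : Fin 3,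
      T (X u) ![a.castSucc, b.castSucc] * ∑ d : Fin 3, covWith C (covWith C T) (X u)
            ![d.castSucc, d.castSucc, a.castSucc, b.castSucc] := by
    have : laplacian h A u = pull X (fun x i => c * ∑ a : Fin 3,
        covWith C (covWith C T) x (Fin.cons a.castSucc (Fin.cons a.castSucc i))) u := by
      unfold laplacian
      rw [traceFirstTwo_congr e2, hN.traceFirstTwo_pull]
    rw [pairing_congr e0 this, hN.pairing_pull, sum_castSucc_two fun i => T (X u) i *
      (c * ∑ a : Fin 3, covWith C (covWith C T) (X u)
        (Fin.cons a.castSucc (Fin.cons a.castSucc i)))]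
    simp only [Finset.mul_sum]
    exact Finset.sum_congr rfl fun a _ => Finset.sum_congr rfl fun b _ =>
      Finset.sum_congr rfl fun d _ => by
        rw [pow_succ c 2]
        simp only [Matrix.vecCons]
        ring
  have k4 : pairing h (divergence h A) (divergence h A) u = c ^ 3 * ∑ b : Fin 3,
      (∑ a : Fin 3, covWith C T (X u) ![a.castSucc, a.castSucc, b.castSucc]) ^ 2 := by
    have : divergence h A u = pull X (fun x i => c * ∑ a : Fin 3,
        covWith C T x (Fin.cons a.castSucc (Fin.cons a.castSucc i))) u := by
      unfold divergence
      rw [traceFirstTwo_congr e1, hN.traceFirstTwo_pull]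
    rw [pairing_congr this this, hN.pairing_pull, sum_castSucc_one fun i =>
      (c * ∑ a : Fin 3, covWith C T (X u) (Fin.cons a.castSucc (Fin.cons a.castSucc i)))
      * (c * ∑ a : Fin 3, covWith C T (X u) (Fin.cons a.castSucc (Fin.cons a.castSucc i)))]
    rw [Finset.mul_sum _ _ (c ^ 1), Finset.mul_sum _ _ (c ^ 3)]
    exact Finset.sum_congr rfl fun b _ => by
      simp only [Matrix.vecCons]
      ring
  -- Of the two contractions, the one with `J h⁻¹ Jᵀ G` has weight `c · c⁻¹ = 1`, so a single factor
  -- `c` survives.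
  have k5 : scalarCurv h u = c * ∑ q : Fin 3, ∑ p : Fin 3,
      riem C p.castSucc p.castSucc q.castSucc q.castSucc (X u) := by
    rw [scalarCurv_of_related hh fun k c a b =>
      sum_riem_of_related hX.self_of_nhds hΓ hC.self_of_nhds hR k c a b, hN.sum_mul]
    congr 1
    refine Finset.sum_congr rfl fun q _ => ?_
    simp only [Matrix.mul_smul, Matrix.mul_one, Matrix.smul_apply, smul_eq_mul, mul_assoc]
    simp only [← Finset.mul_sum]
    rw [hN.sum_mul fun p k => riem C k p q.castSucc q.castSucc (X u)]
    field_simp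
  unfold willmoreExpr schoutenTrace
  rw [k1, k2, k3, k4, k5]
  push_cast
  ring

end Willmore

end ConfHyp

namespace ConfHyp

/-! ### Conformally flat metrics on `ℝⁿ` -/

section Conformal

variable {n : ℕ} {φ : E n → ℝ} {x : E n}

/-- The conformally flat metric `e^{2φ} δ`. -/
noncomputable def confMetric (φ : E n → ℝ) (y : E n) : Matrix (Fin n) (Fin n) ℝ :=
  Real.exp (2 * φ y) • 1

theorem confMetric_apply (y : E n) (i j : Fin n) :
    confMetric φ y i j = Real.exp (2 * φ y) * if i = j then 1 else 0 := by
  simp [confMetric, Matrix.one_apply]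

theorem confMetric_symm (y : E n) (i j : Fin n) : confMetric φ y i j = confMetric φ y j i := by
  simp [confMetric_apply, eq_comm]

theorem confMetric_inv (y : E n) :
    (confMetric φ y)⁻¹ = Real.exp (-(2 * φ y)) • (1 : Matrix (Fin n) (Fin n) ℝ) := by
  refine Matrix.inv_eq_right_inv ?_
  rw [confMetric, Matrix.smul_mul, Matrix.one_mul, smul_smul, ← Real.exp_add]
  simp

theorem confMetric_inv_apply (y : E n) (i j : Fin n) :
    (confMetric φ y)⁻¹ i j = Real.exp (-(2 * φ y)) * if i = j then 1 else 0 := by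
  simp [confMetric_inv, Matrix.one_apply]

theorem isUnit_det_confMetric (y : E n) : IsUnit (confMetric φ y).det := by
  rw [confMetric, Matrix.det_smul, Matrix.det_one, mul_one]
  exact (pow_ne_zero _ (Real.exp_pos _).ne').isUnit

theorem contDiffAt_confMetric (hφ : ContDiffAt ℝ ∞ φ x) (i j : Fin n) :
    ContDiffAt ℝ ∞ (fun y => confMetric φ y i j) x := by
  simp only [confMetric_apply]
  fun_prop

/-- The Christoffel symbols of `e^{2φ} δ`. -/
noncomputable def confSymbols (φ : E n → ℝ) : Symbols n := fun k i j y =>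
  (if k = i then 1 else 0) * pd φ j y + (if k = j then 1 else 0) * pd φ i y
    - (if i = j then 1 else 0) * pd φ k y

theorem christoffel_confMetric (hφ : ContDiffAt ℝ ∞ φ x) (k i j : Fin n) :
    christoffel (confMetric φ) k i j x = confSymbols φ k i j x := by
  have hpd : ∀ i j l, pd (fun y => confMetric φ y i j) l x
      = 2 * Real.exp (2 * φ x) * pd φ l x * if i = j then 1 else 0 := by
    intro i j l
    simp only [confMetric_apply]
    rw [pd_mul (by fun_prop) contDiffAt_const, pd_const, pd_exp (by fun_prop),
      pd_const_mul _ hφ]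
    ring
  have he : Real.exp (-(2 * φ x)) * Real.exp (2 * φ x) = 1 := by
    rw [← Real.exp_add]; simp
  unfold christoffel
  simp only [hpd, confMetric_inv_apply]
  rw [Finset.sum_eq_single k (fun b _ hb => by simp [hb.symm]) (by simp)]
  have e1 : (j = k) = (k = j) := propext eq_comm
  have e2 : (i = k) = (k = i) := propext eq_comm
  simp only [e1, e2, if_true, confSymbols]
  generalize (if k = i then (1 : ℝ) else 0) = A
  generalize (if k = j then (1 : ℝ) else 0) = B
  generalize (if i = j then (1 : ℝ) else 0) = D
  linear_combination (pd φ j x * A + pd φ i x * B - pd φ k x * D) * he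

@[fun_prop]
theorem contDiffAt_confSymbols (hφ : ContDiffAt ℝ ∞ φ x) (k i j : Fin n) :
    ContDiffAt ℝ ∞ (fun y => confSymbols φ k i j y) x := by
  unfold confSymbols
  fun_prop

theorem covDeriv_ofFun (h : E n → Matrix (Fin n) (Fin n) ℝ) (f : E n → ℝ) (y : E n)
    (a : Fin 1 → Fin n) : covDeriv h (ofFun f) y a = pd f (a 0) y := by
  simp [covDeriv, ofFun]

theorem covWith_one (C : Symbols n) (T : CoordTensor n 1) (y : E n) (i j : Fin n) :
    covWith C T y ![i, j] = pd (fun z => T z ![j]) i y - ∑ l, C l i j y * T y ![l] := by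
  have ht : Fin.tail ![i, j] = ![j] := by ext r; fin_cases r; rfl
  have hu : ∀ l, Function.update ![j] (0 : Fin 1) l = ![l] := by
    intro l; ext r; fin_cases r; rfl
  simp only [covWith, ht, Fin.sum_univ_one, hu]
  rfl

theorem pairing_one (h : E n → Matrix (Fin n) (Fin n) ℝ) (T S : CoordTensor n 1) (y : E n) :
    pairing h T S y = ∑ i, ∑ j, (h y)⁻¹ i j * T y ![i] * S y ![j] := by
  unfold pairing
  rw [sum_cons]
  refine Finset.sum_congr rfl fun i _ => ?_
  rw [Fintype.sum_unique, sum_cons]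
  refine Finset.sum_congr rfl fun j _ => ?_
  rw [Fintype.sum_unique]
  have : ∀ i : Fin n, (Fin.cons i default : Fin 1 → Fin n) = ![i] := by
    intro i; ext r; fin_cases r; rfl
  simp [this]

theorem pairing_one_confMetric (T S : CoordTensor n 1) (y : E n) :
    pairing (confMetric φ) T S y = Real.exp (-(2 * φ y)) * ∑ i, T y ![i] * S y ![i] := by
  rw [pairing_one]
  simp only [confMetric_inv_apply, mul_ite, mul_one, mul_zero, ite_mul, zero_mul,
    Finset.sum_ite_eq, Finset.mem_univ, if_true, mul_assoc, Finset.mul_sum]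

theorem laplacian_ofFun_confMetric (hφ : ContDiffAt ℝ ∞ φ x) (f : E n → ℝ) :
    laplacian (confMetric φ) (ofFun f) x ![] = Real.exp (-(2 * φ x)) *
      ∑ i, (pd (fun y => pd f i y) i x - ∑ l, confSymbols φ l i i x * pd f l x) := by
  unfold laplacian traceFirstTwo
  simp only [confMetric_inv_apply, mul_ite, mul_one, mul_zero, ite_mul, zero_mul,
    Finset.sum_ite_eq, Finset.mem_univ, if_true, Finset.mul_sum]
  refine Finset.sum_congr rfl fun i _ => ?_
  have e : (Fin.cons i (Fin.cons i ![]) : Fin 2 → Fin n) = ![i, i] := rfl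
  rw [e, covDeriv_eq_covWith, covWith_one]
  simp only [covDeriv_ofFun, christoffel_confMetric hφ, Matrix.cons_val_fin_one]

theorem ricci_confMetric (hφ : ∀ᶠ y in 𝓝 x, ContDiffAt ℝ ∞ φ y) (i j : Fin n) :
    ricci (confMetric φ) i j x = ∑ k, riem (confSymbols φ) k k i j x := by
  have e : ∀ k i j, christoffel (confMetric φ) k i j =ᶠ[𝓝 x] confSymbols φ k i j := by
    intro k i j
    filter_upwards [hφ] with y hy using christoffel_confMetric hy k i j
  rw [ricci_eq_sum_riem]
  refine Finset.sum_congr rfl fun k _ => ?_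
  unfold riem
  simp only [pd_congr (e _ _ _), christoffel_confMetric hφ.self_of_nhds]

theorem pd_confSymbols (hφ : ContDiffAt ℝ ∞ φ x) (k i j l : Fin n) :
    pd (confSymbols φ k i j) l x = (if k = i then 1 else 0) * pd (fun y => pd φ j y) l x
      + (if k = j then 1 else 0) * pd (fun y => pd φ i y) l x
      - (if i = j then 1 else 0) * pd (fun y => pd φ k y) l x := by
  change pd (fun y => confSymbols φ k i j y) l x = _
  unfold confSymbols
  rw [pd_sub (by fun_prop) (by fun_prop), pd_add (by fun_prop) (by fun_prop),
    pd_const_mul _ (by fun_prop), pd_const_mul _ (by fun_prop), pd_const_mul _ (by fun_prop)]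

theorem scalarCurv_confMetric {φ : E 4 → ℝ} {x : E 4} (hφ : ∀ᶠ y in 𝓝 x, ContDiffAt ℝ ∞ φ y) :
    scalarCurv (confMetric φ) x = -6 * Real.exp (-(2 * φ x)) *
      ∑ i, (pd (fun y => pd φ i y) i x + pd φ i x ^ 2) := by
  have hs := hφ.self_of_nhds
  unfold scalarCurv
  simp only [confMetric_inv_apply, mul_ite, mul_one, mul_zero, ite_mul, zero_mul,
    Finset.sum_ite_eq, Finset.mem_univ, if_true, ricci_confMetric hφ]
  rw [← Finset.mul_sum, mul_comm (-6 : ℝ), mul_assoc]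
  congr 1
  simp only [riem, pd_confSymbols hs]
  simp only [confSymbols, Fin.sum_univ_four]
  simp
  ring

/-- Conformal covariance of the singular Yamabe expression, in dimension four. -/
theorem yamabeS_confMetric {φ s f : E 4 → ℝ} {x : E 4}
    (hφ : ∀ᶠ y in 𝓝 x, ContDiffAt ℝ ∞ φ y) (hs : ∀ᶠ y in 𝓝 x, ContDiffAt ℝ ∞ s y)
    (hf : f =ᶠ[𝓝 x] fun y => Real.exp (φ y) * s y) :
    yamabeS (confMetric φ) f x = (∑ i, pd s i x ^ 2)
      - (1 / 2) * s x * ∑ i, pd (fun y => pd s i y) i x := by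
  have hφx := hφ.self_of_nhds
  have hsx := hs.self_of_nhds
  have f1 : ∀ i, (fun y => pd f i y) =ᶠ[𝓝 x]
      fun y => Real.exp (φ y) * (pd φ i y * s y + pd s i y) := by
    intro i
    filter_upwards [hf.eventually_nhds, hφ, hs] with y h1 h2 h3
    rw [pd_congr h1, pd_mul (by fun_prop) h3, pd_exp h2]
    ring
  have f2 : ∀ i, pd (fun y => pd f i y) i x = Real.exp (φ x) * (pd φ i x *
      (pd φ i x * s x + pd s i x) + pd (fun y => pd φ i y) i x * s x + pd φ i x * pd s i x
      + pd (fun y => pd s i y) i x) := by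
    intro i
    rw [pd_congr (f1 i), pd_mul (by fun_prop) (by fun_prop), pd_exp hφx,
      pd_add (by fun_prop) (by fun_prop), pd_mul (by fun_prop) (by fun_prop)]
    ring
  have f1x : ∀ i, pd f i x = Real.exp (φ x) * (pd φ i x * s x + pd s i x) :=
    fun i => (f1 i).self_of_nhds
  have fx : f x = Real.exp (φ x) * s x := hf.self_of_nhds
  have he : Real.exp (-(2 * φ x)) * Real.exp (φ x) ^ 2 = 1 := by
    rw [← Real.exp_nat_mul, ← Real.exp_add]; simp
  unfold yamabeS schoutenTrace
  rw [pairing_one_confMetric, laplacian_ofFun_confMetric hφx, scalarCurv_confMetric hφ]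
  simp only [covDeriv_ofFun, Matrix.cons_val_fin_one, f1x, f2, fx, confSymbols, Fin.sum_univ_four]
  simp
  -- After the common factor `e^{-2φ}(e^φ)² = 1` is removed, the terms with derivatives of `φ` from
  -- the gradient, the Laplacian and the scalar curvature cancel.
  linear_combination (pd s 0 x ^ 2 + pd s 1 x ^ 2 + pd s 2 x ^ 2 + pd s 3 x ^ 2
    - (1 / 2) * s x * (pd (fun y => pd s 0 y) 0 x + pd (fun y => pd s 1 y) 1 x
      + pd (fun y => pd s 2 y) 2 x + pd (fun y => pd s 3 y) 3 x)) * he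

end Conformal

end ConfHyp

namespace ConfHyp

/-! ### Jets of a conformal unit defining function in flat space -/

section Jets

variable {n : ℕ}

/-- The second partial derivative `∂_j ∂_i s`. -/
noncomputable def pd₂ (s : E n → ℝ) (i j : Fin n) (y : E n) : ℝ := pd (fun z => pd s i z) j y

@[fun_prop]
theorem contDiffAt_pd₂ {s : E n → ℝ} {y : E n} (hs : ContDiffAt ℝ ∞ s y) (i j : Fin n) :
    ContDiffAt ℝ ∞ (fun z => pd₂ s i j z) y := by
  unfold pd₂; fun_prop

theorem pd₂_comm {s : E n → ℝ} {y : E n} (hs : ContDiffAt ℝ ∞ s y) (i j : Fin n) :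
    pd₂ s i j y = pd₂ s j i y := pd_comm hs i j

theorem pd_pd₂_comm {s : E n → ℝ} {y : E n} (hs : ∀ᶠ z in 𝓝 y, ContDiffAt ℝ ∞ s z)
    (i j k : Fin n) : pd (fun z => pd₂ s i j z) k y = pd (fun z => pd₂ s k j z) i y := by
  have h := hs.self_of_nhds
  have e : ∀ i j, (fun z => pd₂ s i j z) =ᶠ[𝓝 y] fun z => pd₂ s j i z := by
    intro i j
    filter_upwards [hs] with z hz using pd₂_comm hz i j
  rw [pd_congr (e i j)]
  change pd (fun z => pd (fun w => pd s j w) i z) k y = _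
  rw [pd_comm (by fun_prop) i k]
  exact pd_congr (e j k) i

theorem pd_sq_mul {s D : E n → ℝ} {y : E n} (hs : ContDiffAt ℝ ∞ s y)
    (hD : ContDiffAt ℝ ∞ D y) (i : Fin n) :
    pd (fun z => s z ^ 2 * D z) i y = s y * (2 * pd s i y * D y + s y * pd D i y) := by
  rw [pd_mul (by fun_prop) hD, pd_pow hs]
  push_cast
  ring

/-- A function divisible by `s²` has second derivatives on the zero set that see only the value of
the cofactor. This extracts the remainder without differentiating it, and it makes terms divisible
by `s³` invisible to second order. -/
theorem pd₂_sq_mul {s D : E n → ℝ} {x : E n} (hs : ∀ᶠ y in 𝓝 x, ContDiffAt ℝ ∞ s y)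
    (hD : ∀ᶠ y in 𝓝 x, ContDiffAt ℝ ∞ D y) (h0 : s x = 0) (i j : Fin n) :
    pd₂ (fun z => s z ^ 2 * D z) i j x = 2 * pd s i x * pd s j x * D x := by
  have e : (fun y => pd (fun z => s z ^ 2 * D z) i y) =ᶠ[𝓝 x]
      fun y => s y * (2 * pd s i y * D y + s y * pd D i y) := by
    filter_upwards [hs, hD] with y h1 h2 using pd_sq_mul h1 h2 i
  have h1 := hs.self_of_nhds
  have h2 := hD.self_of_nhds
  unfold pd₂
  rw [pd_congr e, pd_mul h1 (by fun_prop), h0]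
  ring

/-- `ρ = -Δs / 4`. -/
noncomputable def rho (s : E 4 → ℝ) (y : E 4) : ℝ := -(1 / 4) * ∑ i, pd₂ s i i y

/-- The trace-free Hessian `P = Hess s + ρ δ`. -/
noncomputable def tfHess (s : E 4 → ℝ) (i j : Fin 4) (y : E 4) : ℝ :=
  pd₂ s i j y + (if i = j then 1 else 0) * rho s y

variable {s b : E 4 → ℝ} {x y : E 4}

@[fun_prop]
theorem contDiffAt_rho (hs : ContDiffAt ℝ ∞ s y) : ContDiffAt ℝ ∞ (fun z => rho s z) y := by
  unfold rho; fun_prop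

@[fun_prop]
theorem contDiffAt_tfHess (hs : ContDiffAt ℝ ∞ s y) (i j : Fin 4) :
    ContDiffAt ℝ ∞ (fun z => tfHess s i j z) y := by
  unfold tfHess; fun_prop

theorem pd₂_eq_tfHess (i j : Fin 4) :
    pd₂ s i j y = tfHess s i j y - (if i = j then 1 else 0) * rho s y := by
  unfold tfHess; ring

theorem tfHess_symm (hs : ContDiffAt ℝ ∞ s y) (i j : Fin 4) :
    tfHess s i j y = tfHess s j i y := by
  unfold tfHess
  rw [pd₂_comm hs]
  simp [eq_comm]

theorem sum_tfHess : ∑ i, tfHess s i i y = 0 := by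
  simp only [tfHess, rho, Fin.sum_univ_four]
  simp
  ring

theorem pd_tfHess (hs : ContDiffAt ℝ ∞ s y) (i j k : Fin 4) :
    pd (fun z => tfHess s i j z) k y
      = pd (fun z => pd₂ s i j z) k y + (if i = j then 1 else 0) * pd (fun z => rho s z) k y := by
  unfold tfHess
  rw [pd_add (by fun_prop) (by fun_prop), pd_const_mul _ (by fun_prop)]

/-- Third derivatives of `s` are totally symmetric, so the failure of `∇P` to be so comes only from
the trace part `ρδ`. -/
theorem tfHess_codazzi (hs : ∀ᶠ z in 𝓝 y, ContDiffAt ℝ ∞ s z) (i j k : Fin 4) :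
    pd (fun z => tfHess s i j z) k y = pd (fun z => tfHess s k j z) i y
      + (if i = j then 1 else 0) * pd (fun z => rho s z) k y
      - (if k = j then 1 else 0) * pd (fun z => rho s z) i y := by
  rw [pd_tfHess hs.self_of_nhds, pd_tfHess hs.self_of_nhds, pd_pd₂_comm hs]
  ring

theorem pd_tfHess_symm (hs : ∀ᶠ z in 𝓝 y, ContDiffAt ℝ ∞ s z) (i j k : Fin 4) :
    pd (fun z => tfHess s i j z) k y = pd (fun z => tfHess s j i z) k y :=
  pd_congr (by filter_upwards [hs] with z hz using tfHess_symm hz i j) k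

theorem sum_pd_tfHess (hs : ContDiffAt ℝ ∞ s y) (k : Fin 4) :
    ∑ i, pd (fun z => tfHess s i i z) k y = 0 := by
  have h : (fun z => ∑ i, tfHess s i i z) =ᶠ[𝓝 y] fun _ => 0 :=
    Filter.Eventually.of_forall fun z => sum_tfHess
  rw [← pd_sum _ fun i _ => by fun_prop, pd_congr h, pd_const]

/-- Trace of the Codazzi relation, in which `tr P = 0`: the two `ρ` terms contribute `1 - 4 = -3` in
dimension four. -/
theorem sum_pd_tfHess_div (hs : ∀ᶠ z in 𝓝 y, ContDiffAt ℝ ∞ s z) (i : Fin 4) :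
    ∑ j, pd (fun z => tfHess s i j z) j y = -3 * pd (fun z => rho s z) i y := by
  have h := sum_pd_tfHess hs.self_of_nhds i
  rw [Finset.sum_congr rfl fun j _ => tfHess_codazzi hs i j j, Finset.sum_sub_distrib,
    Finset.sum_add_distrib, h]
  simp
  ring

/-- The flat singular Yamabe equation with remainder `s⁴ b`, near `x`. -/
structure IsFlatSolution (s b : E 4 → ℝ) (x : E 4) : Prop where
  smooth : ∀ᶠ y in 𝓝 x, ContDiffAt ℝ ∞ s y
  smooth_rem : ∀ᶠ y in 𝓝 x, ContDiffAt ℝ ∞ b y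
  eqn : ∀ᶠ y in 𝓝 x, (∑ i, pd s i y ^ 2) - (1 / 2) * s y * (∑ i, pd₂ s i i y)
    = 1 + s y ^ 4 * b y

namespace IsFlatSolution

theorem eventually (h : IsFlatSolution s b x) : ∀ᶠ y in 𝓝 x, IsFlatSolution s b y := by
  filter_upwards [h.smooth.eventually_nhds, h.smooth_rem.eventually_nhds,
    h.eqn.eventually_nhds] with y h1 h2 h3 using ⟨h1, h2, h3⟩

theorem sum_sq (h : IsFlatSolution s b x) (h0 : s x = 0) : ∑ i, pd s i x ^ 2 = 1 := by
  have := h.eqn.self_of_nhds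
  rw [h0] at this
  linear_combination this

/-- The contraction of the trace-free Hessian with the gradient. -/
theorem sum_tfHess_mul (h : IsFlatSolution s b x) (k : Fin 4) :
    (∑ j, tfHess s k j x * pd s j x) + s x * pd (fun z => rho s z) k x
      = s x ^ 2 * (s x * (2 * b x * pd s k x + (1 / 2) * s x * pd b k x)) := by
  have hs := h.smooth.self_of_nhds
  have hb := h.smooth_rem.self_of_nhds
  -- Since `Δs = -4ρ`, the equation reads `|∇s|² + 2ρs = 1 + s⁴b`; the claim is half its derivative.
  have e : (fun y => (∑ i, pd s i y ^ 2) + 2 * (rho s y * s y)) =ᶠ[𝓝 x]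
      fun y => 1 + s y ^ 4 * b y := by
    filter_upwards [h.eqn] with y hy
    rw [← hy]; unfold rho; ring
  have e' := pd_congr e k
  have hp : ∀ i, pd (fun y => pd s i y) k x = tfHess s k i x
      - (if k = i then 1 else 0) * rho s x := by
    intro i
    rw [← pd₂_eq_tfHess, pd₂_comm hs]; rfl
  simp only [Fin.sum_univ_four] at e' ⊢
  simp (disch := fun_prop) only [pd_add, pd_mul, pd_pow, pd_const, hp] at e'
  fin_cases k <;> simp at e' ⊢ <;> linear_combination (1 / 2) * e'

theorem sum_tfHess_mul_eq_zero (h : IsFlatSolution s b x) (h0 : s x = 0) (k : Fin 4) :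
    ∑ j, tfHess s k j x * pd s j x = 0 := by
  have := h.sum_tfHess_mul k
  rw [h0] at this
  linear_combination this

theorem pd_lhs (hs : ContDiffAt ℝ ∞ s y) (k l : Fin 4) :
    pd (fun y => (∑ j, tfHess s k j y * pd s j y) + s y * pd (fun z => rho s z) k y) l y
      = (∑ j, (pd (fun z => tfHess s k j z) l y * pd s j y + tfHess s k j y * pd₂ s j l y))
        + pd s l y * pd (fun z => rho s z) k y + s y * pd₂ (fun z => rho s z) k l y := by
  simp only [Fin.sum_univ_four]
  simp (disch := fun_prop) only [pd_add, pd_mul]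
  unfold pd₂
  ring

theorem lhs_eventuallyEq (h : IsFlatSolution s b x) (k : Fin 4) :
    (fun y => (∑ j, tfHess s k j y * pd s j y) + s y * pd (fun z => rho s z) k y) =ᶠ[𝓝 x]
      fun y => s y ^ 2 * (s y * (2 * b y * pd s k y + (1 / 2) * s y * pd b k y)) := by
  filter_upwards [h.eventually] with y hy using hy.sum_tfHess_mul k

/-- The right side of `sum_tfHess_mul` is divisible by `s³`, so its first and second derivatives
vanish on the zero set. The two resulting relations determine components of `∇P` and `∇²P` in which
`P` has a normal index. -/
theorem first_order (h : IsFlatSolution s b x) (h0 : s x = 0) (k l : Fin 4) :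
    (∑ j, (pd (fun z => tfHess s k j z) l x * pd s j x + tfHess s k j x * pd₂ s j l x))
      + pd s l x * pd (fun z => rho s z) k x = 0 := by
  have hs := h.smooth.self_of_nhds
  have hb := h.smooth_rem.self_of_nhds
  have e := pd_congr (h.lhs_eventuallyEq k) l
  rw [pd_lhs hs, pd_sq_mul hs (by fun_prop), h0] at e
  linear_combination e

theorem second_order (h : IsFlatSolution s b x) (h0 : s x = 0) (k l m : Fin 4) :
    (∑ j, (pd₂ (fun z => tfHess s k j z) l m x * pd s j x
        + pd (fun z => tfHess s k j z) l x * pd₂ s j m x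
        + pd (fun z => tfHess s k j z) m x * pd₂ s j l x
        + tfHess s k j x * pd (fun z => pd₂ s j l z) m x))
      + pd₂ s l m x * pd (fun z => rho s z) k x
      + pd s l x * pd₂ (fun z => rho s z) k m x + pd s m x * pd₂ (fun z => rho s z) k l x = 0 := by
  have hs := h.smooth.self_of_nhds
  have e1 := (pd_congr_eventually (h.lhs_eventuallyEq k) l)
  have e2 : (fun y => pd (fun y => (∑ j, tfHess s k j y * pd s j y)
      + s y * pd (fun z => rho s z) k y) l y) =ᶠ[𝓝 x] fun y =>
      (∑ j, (pd (fun z => tfHess s k j z) l y * pd s j y + tfHess s k j y * pd₂ s j l y))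
        + pd s l y * pd (fun z => rho s z) k y + s y * pd₂ (fun z => rho s z) k l y := by
    filter_upwards [h.smooth] with y hy using pd_lhs hy k l
  have e3 := pd_congr (e2.symm.trans e1) m
  have e4 : pd₂ (fun y => s y ^ 2 * (s y * (2 * b y * pd s k y + (1 / 2) * s y * pd b k y))) l m x
      = 0 := by
    rw [pd₂_sq_mul h.smooth _ h0, h0]
    · ring
    · filter_upwards [h.smooth, h.smooth_rem] with y h1 h2
      fun_prop
  rw [← pd₂, e4] at e3
  simp only [Fin.sum_univ_four] at e3 ⊢
  simp (disch := fun_prop) only [pd_add, pd_mul] at e3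
  rw [h0] at e3
  unfold pd₂ at e3 ⊢
  linear_combination e3

/-- This is the divergence of `sum_tfHess_mul`. Because `P` is trace-free, its contraction with
`Hess s` is `|P|²`; the coefficient `-2` is `-3` from `div P` plus `1` from differentiating the
factor `s` in `s∇ρ`. -/
theorem norm_tfHess_eventuallyEq (h : IsFlatSolution s b x) :
    (fun y => (∑ i, ∑ j, tfHess s i j y ^ 2) - 2 * (∑ j, pd s j y * pd (fun z => rho s z) j y)
        + s y * ∑ k, pd₂ (fun z => rho s z) k k y) =ᶠ[𝓝 x]
      fun y => s y ^ 2 * ∑ k, (3 * pd s k y * (2 * b y * pd s k y + (1 / 2) * s y * pd b k y)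
        + s y * pd (fun z => 2 * b z * pd s k z + (1 / 2) * s z * pd b k z) k y) := by
  filter_upwards [h.eventually] with y hy
  have hs := hy.smooth.self_of_nhds
  have hb := hy.smooth_rem.self_of_nhds
  have e : ∀ k, (∑ j, (pd (fun z => tfHess s k j z) k y * pd s j y
        + tfHess s k j y * pd₂ s j k y))
        + pd s k y * pd (fun z => rho s z) k y + s y * pd₂ (fun z => rho s z) k k y
      = s y ^ 2 * (3 * pd s k y * (2 * b y * pd s k y + (1 / 2) * s y * pd b k y)
        + s y * pd (fun z => 2 * b z * pd s k z + (1 / 2) * s z * pd b k z) k y) := by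
    intro k
    have e1 := pd_congr (hy.lhs_eventuallyEq k) k
    rw [pd_lhs hs, pd_sq_mul hs (by fun_prop), pd_mul hs (by fun_prop)] at e1
    rw [e1]
    ring
  rw [Finset.mul_sum _ _ (s y ^ 2), ← Finset.sum_congr rfl fun k _ => e k]
  have d : ∀ j, ∑ k, pd (fun z => tfHess s k j z) k y = -3 * pd (fun z => rho s z) j y := by
    intro j
    rw [← sum_pd_tfHess_div hy.smooth j]
    exact Finset.sum_congr rfl fun k _ => pd_tfHess_symm hy.smooth k j k
  have t := sum_tfHess (s := s) (y := y)
  have hsym : ∀ i j, pd₂ s j i y = tfHess s i j y - (if i = j then 1 else 0) * rho s y := by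
    intro i j
    rw [pd₂_comm hs, pd₂_eq_tfHess]
  simp only [hsym, Fin.sum_univ_four] at d t ⊢
  simp
  linear_combination (-pd s 0 y) * d 0 - pd s 1 y * d 1 - pd s 2 y * d 2 - pd s 3 y * d 3
    + rho s y * t

/-- The remainder in terms of the jets of `s`. -/
theorem remainder_eq (h : IsFlatSolution s b x) (h0 : s x = 0) :
    12 * b x = (∑ k, ∑ i, ∑ j, (2 * tfHess s i j x * pd₂ (fun z => tfHess s i j z) k k x
        + 2 * pd (fun z => tfHess s i j z) k x ^ 2))
      - 4 * (∑ i, ∑ j, tfHess s i j x * pd₂ (fun z => rho s z) i j x)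
      + 8 * ∑ i, pd (fun z => rho s z) i x ^ 2 := by
  have hs := h.smooth.self_of_nhds
  have hΦ : ∀ᶠ y in 𝓝 x, ContDiffAt ℝ ∞ (fun y =>
      ∑ k, (3 * pd s k y * (2 * b y * pd s k y + (1 / 2) * s y * pd b k y)
        + s y * pd (fun z => 2 * b z * pd s k z + (1 / 2) * s z * pd b k z) k y)) y := by
    filter_upwards [h.smooth, h.smooth_rem] with y h1 h2
    fun_prop
  -- At the zero the cofactor of `s²` equals `6b|∇s|² = 6b`. Summing over `m` with `|∇s|² = 1` gives
  -- the constant `12`.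
  have hL : ∀ m, 2 * pd s m x * pd s m x * (6 * b x)
      = pd₂ (fun y => (∑ i, ∑ j, tfHess s i j y ^ 2)
        - 2 * (∑ j, pd s j y * pd (fun z => rho s z) j y)
        + s y * ∑ k, pd₂ (fun z => rho s z) k k y) m m x := by
    intro m
    have e := pd_congr (pd_congr_eventually h.norm_tfHess_eventuallyEq m) m
    unfold pd₂ at e ⊢
    rw [e, ← pd₂, pd₂_sq_mul h.smooth hΦ h0, h0]
    have := h.sum_sq h0
    simp only [Fin.sum_univ_four] at this ⊢
    linear_combination -12 * pd s m x * pd s m x * b x * this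
  have hm1 : ∀ m, (fun y => pd (fun y => (∑ i, ∑ j, tfHess s i j y ^ 2)
        - 2 * (∑ j, pd s j y * pd (fun z => rho s z) j y)
        + s y * ∑ k, pd₂ (fun z => rho s z) k k y) m y) =ᶠ[𝓝 x] fun y =>
      (∑ i, ∑ j, 2 * (tfHess s i j y * pd (fun z => tfHess s i j z) m y))
      - 2 * (∑ j, (pd₂ s j m y * pd (fun z => rho s z) j y
        + pd s j y * pd₂ (fun z => rho s z) j m y))
      + (pd s m y * (∑ k, pd₂ (fun z => rho s z) k k y)
        + s y * ∑ k, pd (fun z => pd₂ (fun z => rho s z) k k z) m y) := by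
    intro m
    filter_upwards [h.smooth] with y hy
    simp only [Fin.sum_univ_four]
    simp (disch := fun_prop) only [pd_add, pd_sub, pd_mul, pd_pow, pd_const]
    unfold pd₂
    push_cast
    ring
  have hm2 : ∀ m, pd₂ (fun y => (∑ i, ∑ j, tfHess s i j y ^ 2)
        - 2 * (∑ j, pd s j y * pd (fun z => rho s z) j y)
        + s y * ∑ k, pd₂ (fun z => rho s z) k k y) m m x
      = (∑ i, ∑ j, (2 * tfHess s i j x * pd₂ (fun z => tfHess s i j z) m m x
        + 2 * pd (fun z => tfHess s i j z) m x ^ 2))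
      - 2 * (∑ j, (pd (fun z => pd₂ s j m z) m x * pd (fun z => rho s z) j x
        + 2 * (pd₂ s j m x * pd₂ (fun z => rho s z) j m x)
        + pd s j x * pd (fun z => pd₂ (fun z => rho s z) j m z) m x))
      + (pd₂ s m m x * (∑ k, pd₂ (fun z => rho s z) k k x)
        + 2 * (pd s m x * ∑ k, pd (fun z => pd₂ (fun z => rho s z) k k z) m x)) := by
    intro m
    have e := pd_congr (hm1 m) m
    unfold pd₂ at e ⊢
    rw [e]
    simp only [Fin.sum_univ_four]
    simp (disch := fun_prop) only [pd_add, pd_sub, pd_mul, pd_const]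
    rw [h0]
    ring
  have hρ : ∀ᶠ y in 𝓝 x, ContDiffAt ℝ ∞ (fun z => rho s z) y := by
    filter_upwards [h.smooth] with y hy
    fun_prop
  have c1 : ∀ j, ∑ m, pd (fun z => pd₂ s j m z) m x = -4 * pd (fun z => rho s z) j x := by
    intro j
    rw [Finset.sum_congr rfl fun m _ => pd_pd₂_comm h.smooth j m m]
    unfold rho
    simp only [Fin.sum_univ_four]
    simp (disch := fun_prop) only [pd_add, pd_mul, pd_const]
    ring
  have c2 : ∀ j, ∑ m, pd (fun z => pd₂ (fun z => rho s z) j m z) m x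
      = ∑ m, pd (fun z => pd₂ (fun z => rho s z) m m z) j x :=
    fun j => Finset.sum_congr rfl fun m _ => pd_pd₂_comm hρ j m m
  have c3 : ∑ m, pd₂ s m m x = -4 * rho s x := by unfold rho; ring
  have c4 : ∑ m, ∑ j, pd₂ s j m x * pd₂ (fun z => rho s z) j m x
      = (∑ i, ∑ j, tfHess s i j x * pd₂ (fun z => rho s z) i j x)
        - rho s x * ∑ k, pd₂ (fun z => rho s z) k k x := by
    rw [Finset.sum_comm]
    simp only [pd₂_eq_tfHess (s := s), sub_mul, Finset.sum_sub_distrib]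
    congr 1
    simp [Finset.mul_sum]
  have n2 := h.sum_sq h0
  have key : ∑ m, 2 * pd s m x * pd s m x * (6 * b x) = 12 * b x := by
    rw [← Finset.sum_mul]
    simp only [mul_assoc, ← Finset.mul_sum, ← sq, n2]
    ring
  rw [← key, Finset.sum_congr rfl fun m _ => (hL m).trans (hm2 m)]
  rw [Finset.sum_add_distrib, Finset.sum_sub_distrib]
  simp only [← Finset.mul_sum, ← Finset.sum_mul, Finset.sum_add_distrib]
  rw [c3, c4]
  have c5 : (∑ m, ∑ j, pd (fun z => pd₂ s j m z) m x * pd (fun z => rho s z) j x)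
      = -4 * ∑ j, pd (fun z => rho s z) j x ^ 2 := by
    rw [Finset.sum_comm, Finset.mul_sum]
    refine Finset.sum_congr rfl fun j _ => ?_
    rw [← Finset.sum_mul, c1]; ring
  -- With this, the third derivatives of `ρ` coming from `-2⟨∇s,∇ρ⟩` and from `sΔρ` cancel.
  have c6 : (∑ m, ∑ j, pd s j x * pd (fun z => pd₂ (fun z => rho s z) j m z) m x)
      = ∑ m, pd s m x * ∑ k, pd (fun z => pd₂ (fun z => rho s z) k k z) m x := by
    rw [Finset.sum_comm]
    refine Finset.sum_congr rfl fun j _ => ?_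
    rw [← Finset.mul_sum, c2]
  rw [c5, c6]
  ring

end IsFlatSolution

end Jets

end ConfHyp

namespace ConfHyp

/-! ### The algebraic identity between jets -/

section Algebra

variable {P r2 w2 H N M X Y Z : Fin 3 → Fin 3 → ℝ} {dP U V : Fin 3 → Fin 3 → Fin 3 → ℝ}
  {w r1 : Fin 3 → ℝ} {C dC : Fin 3 → Fin 3 → Fin 3 → ℝ} {r r3 r33 w3 β R : ℝ}

/-- Given `r1`, the symmetry, trace and Codazzi conditions leave seven independent components of
`dP`. Substituting this normal form turns the contractions below into polynomial identities.

Notation of the section: `P`, `H` are the tangential parts of the trace-free and full Hessians of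
`s`; `dP` is the tangential derivative of `P`, `M` its normal derivative, and `N` the tangential
derivative of its mixed components. `w`, `w3`, `w2` are the tangential, normal and second tangential
derivatives of `φ`. `r`, `r1`, `r2`, `r3`, `r33` are jets of `ρ`. `C`, `dC` are the connection
symbols and their derivatives, and `U` is the covariant derivative of the tensor. -/
theorem codazzi_components
    (hdP : ∀ a b c, dP a b c = dP b a c) (hdtr : ∀ c, ∑ a, dP a a c = 0)
    (hcod : ∀ a b c, dP a b c = dP c b a + (if a = b then 1 else 0) * r1 c
      - (if c = b then 1 else 0) * r1 a) :
    (∀ c, dP 1 0 c = dP 0 1 c) ∧ (∀ c, dP 2 0 c = dP 0 2 c) ∧ (∀ c, dP 2 1 c = dP 1 2 c)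
      ∧ dP 0 0 0 = -dP 1 1 0 - dP 2 2 0 ∧ dP 1 1 1 = -dP 0 0 1 - dP 2 2 1
      ∧ dP 2 2 2 = -dP 0 0 2 - dP 1 1 2 ∧ dP 0 1 0 = dP 0 0 1 - r1 1
      ∧ dP 0 2 0 = dP 0 0 2 - r1 2 ∧ dP 0 1 1 = dP 1 1 0 - r1 0
      ∧ dP 1 2 1 = dP 1 1 2 - r1 2 ∧ dP 0 2 2 = dP 2 2 0 - r1 0
      ∧ dP 1 2 2 = dP 2 2 1 - r1 1 ∧ dP 1 2 0 = dP 0 1 2 ∧ dP 0 2 1 = dP 0 1 2 := by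
  have s10 : ∀ c, dP 1 0 c = dP 0 1 c := hdP 1 0
  have s20 : ∀ c, dP 2 0 c = dP 0 2 c := hdP 2 0
  have s21 : ∀ c, dP 2 1 c = dP 1 2 c := hdP 2 1
  have t0 : dP 0 0 0 = -dP 1 1 0 - dP 2 2 0 := by
    have := hdtr 0; rw [Fin.sum_univ_three] at this; linarith
  have t1 : dP 1 1 1 = -dP 0 0 1 - dP 2 2 1 := by
    have := hdtr 1; rw [Fin.sum_univ_three] at this; linarith
  have t2 : dP 2 2 2 = -dP 0 0 2 - dP 1 1 2 := by
    have := hdtr 2; rw [Fin.sum_univ_three] at this; linarith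
  have c010 : dP 0 1 0 = dP 0 0 1 - r1 1 := by
    have := hcod 0 0 1; simp [s10] at this; linarith
  have c020 : dP 0 2 0 = dP 0 0 2 - r1 2 := by
    have := hcod 0 0 2; simp [s20] at this; linarith
  have c011 : dP 0 1 1 = dP 1 1 0 - r1 0 := by
    have := hcod 1 1 0; simp at this; linarith
  have c121 : dP 1 2 1 = dP 1 1 2 - r1 2 := by
    have := hcod 1 1 2; simp [s21] at this; linarith
  have c022 : dP 0 2 2 = dP 2 2 0 - r1 0 := by
    have := hcod 2 2 0; simp at this; linarith
  have c122 : dP 1 2 2 = dP 2 2 1 - r1 1 := by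
    have := hcod 2 2 1; simp at this; linarith
  have c120 : dP 1 2 0 = dP 0 1 2 := by
    have := hcod 0 1 2; simp [s21] at this; linarith
  have c021 : dP 0 2 1 = dP 0 1 2 := by
    have := hcod 0 2 1; simp [c120] at this; linarith
  exact ⟨s10, s20, s21, t0, t1, t2, c010, c020, c011, c121, c022, c122, c120, c021⟩

theorem sum_cube_sq
    (hP : ∀ a b, P a b = P b a) (htr : ∑ a, P a a = 0)
    (hdP : ∀ a b c, dP a b c = dP b a c) (hdtr : ∀ c, ∑ a, dP a a c = 0)
    (hcod : ∀ a b c, dP a b c = dP c b a + (if a = b then 1 else 0) * r1 c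
      - (if c = b then 1 else 0) * r1 a)
    (hU : ∀ c a b, U c a b = dP a b c - w c * P a b - w a * P c b - w b * P a c
      + (if c = a then 1 else 0) * (∑ l, w l * P l b)
      + (if c = b then 1 else 0) * (∑ l, w l * P a l)) :
    ∑ a, ∑ b, ∑ c, U a b c ^ 2 = (∑ a, ∑ b, ∑ c, dP a b c ^ 2)
      - 6 * (∑ c, w c * ∑ a, ∑ b, P a b * dP a b c) - 12 * (∑ a, r1 a * ∑ b, P a b * w b)
      + 3 * (∑ a, w a ^ 2) * (∑ a, ∑ b, P a b ^ 2) + 6 * ∑ a, (∑ b, P a b * w b) ^ 2 := by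
  have p22 : P 2 2 = -P 0 0 - P 1 1 := by rw [Fin.sum_univ_three] at htr; linarith
  have p10 := hP 1 0
  have p20 := hP 2 0
  have p21 := hP 2 1
  obtain ⟨s10, s20, s21, t0, t1, t2, c010, c020, c011, c121, c022, c122, c120, c021⟩ :=
    codazzi_components hdP hdtr hcod
  simp only [hU, Fin.sum_univ_three]
  simp only [p22, p10, p20, p21, s10, s20, s21, t0, t1, t2, c010, c020, c011, c121, c022, c122, c120, c021,
    Fin.isValue, Fin.reduceEq, if_true, if_false, one_mul,
    zero_mul, add_zero, zero_add, sub_zero]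
  ring

/-- The Codazzi relation traced over three directions gives `1 - 3 = -2` times `r1`; the conformal
correction terms add up to `-1 - 1 + 3 + 1 = 2` times `P(w)`. -/
theorem div_eq
    (hP : ∀ a b, P a b = P b a) (htr : ∑ a, P a a = 0)
    (hdP : ∀ a b c, dP a b c = dP b a c) (hdtr : ∀ c, ∑ a, dP a a c = 0)
    (hcod : ∀ a b c, dP a b c = dP c b a + (if a = b then 1 else 0) * r1 c
      - (if c = b then 1 else 0) * r1 a)
    (hU : ∀ c a b, U c a b = dP a b c - w c * P a b - w a * P c b - w b * P a c
      + (if c = a then 1 else 0) * (∑ l, w l * P l b)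
      + (if c = b then 1 else 0) * (∑ l, w l * P a l)) (b : Fin 3) :
    ∑ a, U a a b = 2 * (∑ c, P b c * w c) - 2 * r1 b := by
  have p22 : P 2 2 = -P 0 0 - P 1 1 := by rw [Fin.sum_univ_three] at htr; linarith
  have p10 := hP 1 0
  have p20 := hP 2 0
  have p21 := hP 2 1
  obtain ⟨s10, s20, s21, t0, t1, t2, c010, c020, c011, c121, c022, c122, c120, c021⟩ :=
    codazzi_components hdP hdtr hcod
  fin_cases b <;>
  · simp only [hU, Fin.sum_univ_three]
    simp [-Finset.sum_sub_distrib, p22, p10, p20, p21, s10, s20, s21, t0, t1, t2, c010, c020, c011, c121, c022, c122, c120, c021]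
    ring

/-- The flat Gauss equation contributes `(tr H)² - |H|² = 6r² - |P|²`, and the conformal change in
dimension three contributes `-4Δ̄φ - 2|d̄φ|²`. The intrinsic Laplacian differs from the tangential
trace of the ambient Hessian by `-(tr H) w3 = 3 r w3`, whence the term `-12 r w3`. -/
theorem curvature_eq
    (hP : ∀ a b, P a b = P b a) (htr : ∑ a, P a a = 0)
    (hH : ∀ a b, H a b = P a b - (if a = b then 1 else 0) * r)
    (hC : ∀ l c a, C l c a = (if l = c then 1 else 0) * w a + (if l = a then 1 else 0) * w c
      - (if c = a then 1 else 0) * w l) :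
    (∑ q, ∑ p, ((2 * (if p = q then 1 else 0) * w2 p q - w2 p p + (H q q + w3) * H p p)
      - (w2 q q + (H p q + (if p = q then 1 else 0) * w3) * H p q)
      + ((∑ l, (C p p l * C l q q - C p q l * C l p q)) + w3 * H q q
        - (if p = q then 1 else 0) * w3 * H p q)))
      = -4 * (∑ c, w2 c c) - (∑ a, ∑ b, P a b ^ 2) + 6 * r ^ 2 - 12 * r * w3
        - 2 * ∑ a, w a ^ 2 := by
  have p22 : P 2 2 = -P 0 0 - P 1 1 := by rw [Fin.sum_univ_three] at htr; linarith
  have p10 := hP 1 0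
  have p20 := hP 2 0
  have p21 := hP 2 1
  simp only [hH, hC, Fin.sum_univ_three]
  simp only [p22, p10, p20, p21,
    Fin.isValue, Fin.reduceEq, if_true, if_false, one_mul,
    zero_mul, add_zero, zero_add, sub_zero]
  ring

/-- The quadratic term in `H` gives `tr(P²H²)` with `H = P - r`. A trace-free symmetric `3 × 3`
matrix satisfies `tr P⁴ = ½ (tr P²)²`, by Cayley–Hamilton; this is the source of the coefficient
`1/2` here and in the sums with `H` and `N` below. -/
theorem sum_dC_left
    (hP : ∀ a b, P a b = P b a) (htr : ∑ a, P a a = 0)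
    (hH : ∀ a b, H a b = P a b - (if a = b then 1 else 0) * r)
    (hw2 : ∀ a b, w2 a b = w2 b a)
    (hdC : ∀ l c a, dC l c a = (if l = c then 1 else 0) * w2 a c
      + (if l = a then 1 else 0) * w2 c c - (if c = a then 1 else 0) * w2 l c
      + (H c a + (if c = a then 1 else 0) * w3) * H l c) :
    ∑ a, ∑ b, ∑ c, P a b * ∑ l, dC l c a * P l b
      = (∑ a, ∑ b, P a b ^ 2) * (∑ c, w2 c c) + (1 / 2) * (∑ a, ∑ b, P a b ^ 2) ^ 2 - 2 * r * (∑ a, ∑ b, ∑ c, P a b * P b c * P c a) + r ^ 2 * (∑ a, ∑ b, P a b ^ 2)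
        + w3 * ((∑ a, ∑ b, ∑ c, P a b * P b c * P c a) - r * (∑ a, ∑ b, P a b ^ 2)) := by
  have p22 : P 2 2 = -P 0 0 - P 1 1 := by rw [Fin.sum_univ_three] at htr; linarith
  have p10 := hP 1 0
  have p20 := hP 2 0
  have p21 := hP 2 1
  have v10 := hw2 1 0
  have v20 := hw2 2 0
  have v21 := hw2 2 1
  simp only [hdC, hH, Fin.sum_univ_three]
  simp only [p22, p10, p20, p21, v10, v20, v21,
    Fin.isValue, Fin.reduceEq, if_true, if_false, one_mul,
    zero_mul, add_zero, zero_add, sub_zero]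
  ring

theorem sum_dC_right
    (hP : ∀ a b, P a b = P b a) (htr : ∑ a, P a a = 0)
    (hH : ∀ a b, H a b = P a b - (if a = b then 1 else 0) * r)
    (hw2 : ∀ a b, w2 a b = w2 b a)
    (hdC : ∀ l c a, dC l c a = (if l = c then 1 else 0) * w2 a c
      + (if l = a then 1 else 0) * w2 c c - (if c = a then 1 else 0) * w2 l c
      + (H c a + (if c = a then 1 else 0) * w3) * H l c) :
    ∑ a, ∑ b, ∑ c, P a b * ∑ l, dC l c b * P a l
      = (∑ a, ∑ b, P a b ^ 2) * (∑ c, w2 c c) + (1 / 2) * (∑ a, ∑ b, P a b ^ 2) ^ 2 - 2 * r * (∑ a, ∑ b, ∑ c, P a b * P b c * P c a) + r ^ 2 * (∑ a, ∑ b, P a b ^ 2)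
        + w3 * ((∑ a, ∑ b, ∑ c, P a b * P b c * P c a) - r * (∑ a, ∑ b, P a b ^ 2)) := by
  have p22 : P 2 2 = -P 0 0 - P 1 1 := by rw [Fin.sum_univ_three] at htr; linarith
  have p10 := hP 1 0
  have p20 := hP 2 0
  have p21 := hP 2 1
  have v10 := hw2 1 0
  have v20 := hw2 2 0
  have v21 := hw2 2 1
  simp only [hdC, hH, Fin.sum_univ_three]
  simp only [p22, p10, p20, p21, v10, v20, v21,
    Fin.isValue, Fin.reduceEq, if_true, if_false, one_mul,
    zero_mul, add_zero, zero_add, sub_zero]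
  ring

theorem sum_C_dP_left
    (hP : ∀ a b, P a b = P b a) (htr : ∑ a, P a a = 0)
    (hdP : ∀ a b c, dP a b c = dP b a c) (hdtr : ∀ c, ∑ a, dP a a c = 0)
    (hcod : ∀ a b c, dP a b c = dP c b a + (if a = b then 1 else 0) * r1 c
      - (if c = b then 1 else 0) * r1 a)
    (hC : ∀ l c a, C l c a = (if l = c then 1 else 0) * w a + (if l = a then 1 else 0) * w c
      - (if c = a then 1 else 0) * w l) :
    ∑ a, ∑ b, ∑ c, P a b * ∑ l, C l c a * dP l b c
      = -3 * (∑ a, r1 a * ∑ b, P a b * w b) := by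
  have p22 : P 2 2 = -P 0 0 - P 1 1 := by rw [Fin.sum_univ_three] at htr; linarith
  have p10 := hP 1 0
  have p20 := hP 2 0
  have p21 := hP 2 1
  obtain ⟨s10, s20, s21, t0, t1, t2, c010, c020, c011, c121, c022, c122, c120, c021⟩ :=
    codazzi_components hdP hdtr hcod
  simp only [hC, Fin.sum_univ_three]
  simp only [p22, p10, p20, p21, s10, s20, s21, t0, t1, t2, c010, c020, c011, c121, c022, c122, c120, c021,
    Fin.isValue, Fin.reduceEq, if_true, if_false, one_mul,
    zero_mul, add_zero, zero_add, sub_zero]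
  ring

theorem sum_C_dP_right
    (hP : ∀ a b, P a b = P b a) (htr : ∑ a, P a a = 0)
    (hdP : ∀ a b c, dP a b c = dP b a c) (hdtr : ∀ c, ∑ a, dP a a c = 0)
    (hcod : ∀ a b c, dP a b c = dP c b a + (if a = b then 1 else 0) * r1 c
      - (if c = b then 1 else 0) * r1 a)
    (hC : ∀ l c a, C l c a = (if l = c then 1 else 0) * w a + (if l = a then 1 else 0) * w c
      - (if c = a then 1 else 0) * w l) :
    ∑ a, ∑ b, ∑ c, P a b * ∑ l, C l c b * dP a l c
      = -3 * (∑ a, r1 a * ∑ b, P a b * w b) := by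
  have p22 : P 2 2 = -P 0 0 - P 1 1 := by rw [Fin.sum_univ_three] at htr; linarith
  have p10 := hP 1 0
  have p20 := hP 2 0
  have p21 := hP 2 1
  obtain ⟨s10, s20, s21, t0, t1, t2, c010, c020, c011, c121, c022, c122, c120, c021⟩ :=
    codazzi_components hdP hdtr hcod
  simp only [hC, Fin.sum_univ_three]
  simp only [p22, p10, p20, p21, s10, s20, s21, t0, t1, t2, c010, c020, c011, c121, c022, c122, c120, c021,
    Fin.isValue, Fin.reduceEq, if_true, if_false, one_mul,
    zero_mul, add_zero, zero_add, sub_zero]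
  ring

theorem sum_H_N_left
    (hP : ∀ a b, P a b = P b a) (htr : ∑ a, P a a = 0)
    (hH : ∀ a b, H a b = P a b - (if a = b then 1 else 0) * r)
    (hN : ∀ b c, N b c = -∑ j, P b j * H j c) :
    ∑ a, ∑ b, ∑ c, P a b * (H c a * N b c)
      = -((1 / 2) * (∑ a, ∑ b, P a b ^ 2) ^ 2 - 2 * r * (∑ a, ∑ b, ∑ c, P a b * P b c * P c a) + r ^ 2 * (∑ a, ∑ b, P a b ^ 2)) := by
  have p22 : P 2 2 = -P 0 0 - P 1 1 := by rw [Fin.sum_univ_three] at htr; linarith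
  have p10 := hP 1 0
  have p20 := hP 2 0
  have p21 := hP 2 1
  simp only [hN, hH, Fin.sum_univ_three]
  simp only [p22, p10, p20, p21,
    Fin.isValue, Fin.reduceEq, if_true, if_false, one_mul,
    zero_mul, add_zero, zero_add, sub_zero]
  ring

theorem sum_H_N_right
    (hP : ∀ a b, P a b = P b a) (htr : ∑ a, P a a = 0)
    (hH : ∀ a b, H a b = P a b - (if a = b then 1 else 0) * r)
    (hN : ∀ b c, N b c = -∑ j, P b j * H j c) :
    ∑ a, ∑ b, ∑ c, P a b * (H c b * N a c)
      = -((1 / 2) * (∑ a, ∑ b, P a b ^ 2) ^ 2 - 2 * r * (∑ a, ∑ b, ∑ c, P a b * P b c * P c a) + r ^ 2 * (∑ a, ∑ b, P a b ^ 2)) := by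
  have p22 : P 2 2 = -P 0 0 - P 1 1 := by rw [Fin.sum_univ_three] at htr; linarith
  have p10 := hP 1 0
  have p20 := hP 2 0
  have p21 := hP 2 1
  simp only [hN, hH, Fin.sum_univ_three]
  simp only [p22, p10, p20, p21,
    Fin.isValue, Fin.reduceEq, if_true, if_false, one_mul,
    zero_mul, add_zero, zero_add, sub_zero]
  ring

theorem sum_w_U
    (hP : ∀ a b, P a b = P b a) (htr : ∑ a, P a a = 0)
    (hdP : ∀ a b c, dP a b c = dP b a c) (hdtr : ∀ c, ∑ a, dP a a c = 0)
    (hcod : ∀ a b c, dP a b c = dP c b a + (if a = b then 1 else 0) * r1 c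
      - (if c = b then 1 else 0) * r1 a)
    (hU : ∀ c a b, U c a b = dP a b c - w c * P a b - w a * P c b - w b * P a c
      + (if c = a then 1 else 0) * (∑ l, w l * P l b)
      + (if c = b then 1 else 0) * (∑ l, w l * P a l)) :
    ∑ a, ∑ b, ∑ c, P a b * (w c * U c a b)
      = (∑ c, w c * ∑ a, ∑ b, P a b * dP a b c) - (∑ a, w a ^ 2) * (∑ a, ∑ b, P a b ^ 2) := by
  have p22 : P 2 2 = -P 0 0 - P 1 1 := by rw [Fin.sum_univ_three] at htr; linarith
  have p10 := hP 1 0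
  have p20 := hP 2 0
  have p21 := hP 2 1
  obtain ⟨s10, s20, s21, t0, t1, t2, c010, c020, c011, c121, c022, c122, c120, c021⟩ :=
    codazzi_components hdP hdtr hcod
  simp only [hU, Fin.sum_univ_three]
  simp only [p22, p10, p20, p21, s10, s20, s21, t0, t1, t2, c010, c020, c011, c121, c022, c122, c120, c021,
    Fin.isValue, Fin.reduceEq, if_true, if_false, one_mul,
    zero_mul, add_zero, zero_add, sub_zero]
  ring

theorem sum_C_U
    (hP : ∀ a b, P a b = P b a) (htr : ∑ a, P a a = 0)
    (hdP : ∀ a b c, dP a b c = dP b a c) (hdtr : ∀ c, ∑ a, dP a a c = 0)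
    (hcod : ∀ a b c, dP a b c = dP c b a + (if a = b then 1 else 0) * r1 c
      - (if c = b then 1 else 0) * r1 a)
    (hU : ∀ c a b, U c a b = dP a b c - w c * P a b - w a * P c b - w b * P a c
      + (if c = a then 1 else 0) * (∑ l, w l * P l b)
      + (if c = b then 1 else 0) * (∑ l, w l * P a l))
    (hC : ∀ l c a, C l c a = (if l = c then 1 else 0) * w a + (if l = a then 1 else 0) * w c
      - (if c = a then 1 else 0) * w l) :
    ∑ a, ∑ b, ∑ c, P a b * ∑ l, C l c c * U l a b
      = -((∑ c, w c * ∑ a, ∑ b, P a b * dP a b c) - (∑ a, w a ^ 2) * (∑ a, ∑ b, P a b ^ 2)) := by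
  have p22 : P 2 2 = -P 0 0 - P 1 1 := by rw [Fin.sum_univ_three] at htr; linarith
  have p10 := hP 1 0
  have p20 := hP 2 0
  have p21 := hP 2 1
  obtain ⟨s10, s20, s21, t0, t1, t2, c010, c020, c011, c121, c022, c122, c120, c021⟩ :=
    codazzi_components hdP hdtr hcod
  simp only [hC, hU, Fin.sum_univ_three]
  simp only [p22, p10, p20, p21, s10, s20, s21, t0, t1, t2, c010, c020, c011, c121, c022, c122, c120, c021,
    Fin.isValue, Fin.reduceEq, if_true, if_false, one_mul,
    zero_mul, add_zero, zero_add, sub_zero]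
  ring

theorem sum_H_M
    (hP : ∀ a b, P a b = P b a) (htr : ∑ a, P a a = 0)
    (hH : ∀ a b, H a b = P a b - (if a = b then 1 else 0) * r)
    (hN : ∀ b c, N b c = -∑ j, P b j * H j c)
    (hM : ∀ a b, M a b = N b a + (if a = b then 1 else 0) * r3) :
    ∑ a, ∑ b, ∑ c, P a b * (H c c * (M a b - w3 * P a b))
      = -3 * r * (-((∑ a, ∑ b, ∑ c, P a b * P b c * P c a) - r * (∑ a, ∑ b, P a b ^ 2)) - w3 * (∑ a, ∑ b, P a b ^ 2)) := by
  have p22 : P 2 2 = -P 0 0 - P 1 1 := by rw [Fin.sum_univ_three] at htr; linarith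
  have p10 := hP 1 0
  have p20 := hP 2 0
  have p21 := hP 2 1
  simp only [hM, hN, hH, Fin.sum_univ_three]
  simp only [p22, p10, p20, p21,
    Fin.isValue, Fin.reduceEq, if_true, if_false, one_mul,
    zero_mul, add_zero, zero_add, sub_zero]
  ring

theorem sum_C_U_left
    (hP : ∀ a b, P a b = P b a) (htr : ∑ a, P a a = 0)
    (hdP : ∀ a b c, dP a b c = dP b a c) (hdtr : ∀ c, ∑ a, dP a a c = 0)
    (hcod : ∀ a b c, dP a b c = dP c b a + (if a = b then 1 else 0) * r1 c
      - (if c = b then 1 else 0) * r1 a)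
    (hU : ∀ c a b, U c a b = dP a b c - w c * P a b - w a * P c b - w b * P a c
      + (if c = a then 1 else 0) * (∑ l, w l * P l b)
      + (if c = b then 1 else 0) * (∑ l, w l * P a l))
    (hC : ∀ l c a, C l c a = (if l = c then 1 else 0) * w a + (if l = a then 1 else 0) * w c
      - (if c = a then 1 else 0) * w l) :
    ∑ a, ∑ b, ∑ c, P a b * ∑ l, C l c a * U c l b
      = 3 * (∑ a, (∑ b, P a b * w b) ^ 2) - 3 * (∑ a, r1 a * ∑ b, P a b * w b) := by
  have p22 : P 2 2 = -P 0 0 - P 1 1 := by rw [Fin.sum_univ_three] at htr; linarith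
  have p10 := hP 1 0
  have p20 := hP 2 0
  have p21 := hP 2 1
  obtain ⟨s10, s20, s21, t0, t1, t2, c010, c020, c011, c121, c022, c122, c120, c021⟩ :=
    codazzi_components hdP hdtr hcod
  simp only [hC, hU, Fin.sum_univ_three]
  simp only [p22, p10, p20, p21, s10, s20, s21, t0, t1, t2, c010, c020, c011, c121, c022, c122, c120, c021,
    Fin.isValue, Fin.reduceEq, if_true, if_false, one_mul,
    zero_mul, add_zero, zero_add, sub_zero]
  ring

theorem sum_C_U_right
    (hP : ∀ a b, P a b = P b a) (htr : ∑ a, P a a = 0)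
    (hdP : ∀ a b c, dP a b c = dP b a c) (hdtr : ∀ c, ∑ a, dP a a c = 0)
    (hcod : ∀ a b c, dP a b c = dP c b a + (if a = b then 1 else 0) * r1 c
      - (if c = b then 1 else 0) * r1 a)
    (hU : ∀ c a b, U c a b = dP a b c - w c * P a b - w a * P c b - w b * P a c
      + (if c = a then 1 else 0) * (∑ l, w l * P l b)
      + (if c = b then 1 else 0) * (∑ l, w l * P a l))
    (hC : ∀ l c a, C l c a = (if l = c then 1 else 0) * w a + (if l = a then 1 else 0) * w c
      - (if c = a then 1 else 0) * w l) :
    ∑ a, ∑ b, ∑ c, P a b * ∑ l, C l c b * U c a l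
      = 3 * (∑ a, (∑ b, P a b * w b) ^ 2) - 3 * (∑ a, r1 a * ∑ b, P a b * w b) := by
  have p22 : P 2 2 = -P 0 0 - P 1 1 := by rw [Fin.sum_univ_three] at htr; linarith
  have p10 := hP 1 0
  have p20 := hP 2 0
  have p21 := hP 2 1
  obtain ⟨s10, s20, s21, t0, t1, t2, c010, c020, c011, c121, c022, c122, c120, c021⟩ :=
    codazzi_components hdP hdtr hcod
  simp only [hC, hU, Fin.sum_univ_three]
  simp only [p22, p10, p20, p21, s10, s20, s21, t0, t1, t2, c010, c020, c011, c121, c022, c122, c120, c021,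
    Fin.isValue, Fin.reduceEq, if_true, if_false, one_mul,
    zero_mul, add_zero, zero_add, sub_zero]
  ring

theorem sum_H_P_left
    (hP : ∀ a b, P a b = P b a) (htr : ∑ a, P a a = 0)
    (hH : ∀ a b, H a b = P a b - (if a = b then 1 else 0) * r) :
    ∑ a, ∑ b, ∑ c, P a b * (H c a * (w3 * P c b))
      = w3 * ((∑ a, ∑ b, ∑ c, P a b * P b c * P c a) - r * (∑ a, ∑ b, P a b ^ 2)) := by
  have p22 : P 2 2 = -P 0 0 - P 1 1 := by rw [Fin.sum_univ_three] at htr; linarith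
  have p10 := hP 1 0
  have p20 := hP 2 0
  have p21 := hP 2 1
  simp only [hH, Fin.sum_univ_three]
  simp only [p22, p10, p20, p21,
    Fin.isValue, Fin.reduceEq, if_true, if_false, one_mul,
    zero_mul, add_zero, zero_add, sub_zero]
  ring

theorem sum_H_P_right
    (hP : ∀ a b, P a b = P b a) (htr : ∑ a, P a a = 0)
    (hH : ∀ a b, H a b = P a b - (if a = b then 1 else 0) * r) :
    ∑ a, ∑ b, ∑ c, P a b * (H c b * (w3 * P a c))
      = w3 * ((∑ a, ∑ b, ∑ c, P a b * P b c * P c a) - r * (∑ a, ∑ b, P a b ^ 2)) := by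
  have p22 : P 2 2 = -P 0 0 - P 1 1 := by rw [Fin.sum_univ_three] at htr; linarith
  have p10 := hP 1 0
  have p20 := hP 2 0
  have p21 := hP 2 1
  simp only [hH, Fin.sum_univ_three]
  simp only [p22, p10, p20, p21,
    Fin.isValue, Fin.reduceEq, if_true, if_false, one_mul,
    zero_mul, add_zero, zero_add, sub_zero]
  ring

/-- `V` is the second covariant derivative with the plain second derivatives of `P` removed. Its
contraction with `P` is the sum of the contractions computed above. -/
theorem sum_second_derivatives
    (hP : ∀ a b, P a b = P b a) (htr : ∑ a, P a a = 0)
    (hdP : ∀ a b c, dP a b c = dP b a c) (hdtr : ∀ c, ∑ a, dP a a c = 0)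
    (hcod : ∀ a b c, dP a b c = dP c b a + (if a = b then 1 else 0) * r1 c
      - (if c = b then 1 else 0) * r1 a)
    (hU : ∀ c a b, U c a b = dP a b c - w c * P a b - w a * P c b - w b * P a c
      + (if c = a then 1 else 0) * (∑ l, w l * P l b)
      + (if c = b then 1 else 0) * (∑ l, w l * P a l))
    (hH : ∀ a b, H a b = P a b - (if a = b then 1 else 0) * r)
    (hN : ∀ b c, N b c = -∑ j, P b j * H j c)
    (hM : ∀ a b, M a b = N b a + (if a = b then 1 else 0) * r3)
    (hC : ∀ l c a, C l c a = (if l = c then 1 else 0) * w a + (if l = a then 1 else 0) * w c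
      - (if c = a then 1 else 0) * w l)
    (hw2 : ∀ a b, w2 a b = w2 b a)
    (hdC : ∀ l c a, dC l c a = (if l = c then 1 else 0) * w2 a c
      + (if l = a then 1 else 0) * w2 c c - (if c = a then 1 else 0) * w2 l c
      + (H c a + (if c = a then 1 else 0) * w3) * H l c)
    (hV : ∀ c a b, V c a b = w2 c c * P a b + w c * dP a b c
      - (∑ l, (dC l c a * P l b + C l c a * dP l b c)) - H c a * N b c
      - (∑ l, (dC l c b * P a l + C l c b * dP a l c)) - H c b * N a c
      + w c * U c a b - (∑ l, C l c c * U l a b) - H c c * (M a b - w3 * P a b)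
      - (∑ l, C l c a * U c l b) - H c a * (N b c - w3 * P c b)
      - (∑ l, C l c b * U c a l) - H c b * (N a c - w3 * P a c)) :
    ∑ a, ∑ b, P a b * ∑ c, V c a b
      = -((∑ a, ∑ b, P a b ^ 2) * (∑ c, w2 c c)) + 3 * (∑ c, w c * ∑ a, ∑ b, P a b * dP a b c) + 12 * (∑ a, r1 a * ∑ b, P a b * w b)
        - 2 * (∑ a, w a ^ 2) * (∑ a, ∑ b, P a b ^ 2) - 6 * (∑ a, (∑ b, P a b * w b) ^ 2) + (∑ a, ∑ b, P a b ^ 2) ^ 2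
        - 7 * r * (∑ a, ∑ b, ∑ c, P a b * P b c * P c a) + 5 * r ^ 2 * (∑ a, ∑ b, P a b ^ 2)
        - 3 * r * w3 * (∑ a, ∑ b, P a b ^ 2) := by
  have e0 : ∑ a, ∑ b, ∑ c, P a b * (w2 c c * P a b + w c * dP a b c)
      = (∑ a, ∑ b, P a b ^ 2) * (∑ c, w2 c c) + (∑ c, w c * ∑ a, ∑ b, P a b * dP a b c) := by
    simp only [Fin.sum_univ_three]
    ring
  have e : ∑ a, ∑ b, P a b * ∑ c, V c a b
      = (∑ a, ∑ b, ∑ c, P a b * (w2 c c * P a b + w c * dP a b c))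
        - (∑ a, ∑ b, ∑ c, P a b * ∑ l, dC l c a * P l b)
        - (∑ a, ∑ b, ∑ c, P a b * ∑ l, C l c a * dP l b c)
        - (∑ a, ∑ b, ∑ c, P a b * (H c a * N b c))
        - (∑ a, ∑ b, ∑ c, P a b * ∑ l, dC l c b * P a l)
        - (∑ a, ∑ b, ∑ c, P a b * ∑ l, C l c b * dP a l c)
        - (∑ a, ∑ b, ∑ c, P a b * (H c b * N a c))
        + (∑ a, ∑ b, ∑ c, P a b * (w c * U c a b))
        - (∑ a, ∑ b, ∑ c, P a b * ∑ l, C l c c * U l a b)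
        - (∑ a, ∑ b, ∑ c, P a b * (H c c * (M a b - w3 * P a b)))
        - (∑ a, ∑ b, ∑ c, P a b * ∑ l, C l c a * U c l b)
        - ((∑ a, ∑ b, ∑ c, P a b * (H c a * N b c))
          - ∑ a, ∑ b, ∑ c, P a b * (H c a * (w3 * P c b)))
        - (∑ a, ∑ b, ∑ c, P a b * ∑ l, C l c b * U c a l)
        - ((∑ a, ∑ b, ∑ c, P a b * (H c b * N a c))
          - ∑ a, ∑ b, ∑ c, P a b * (H c b * (w3 * P a c))) := by
    simp only [← Finset.sum_sub_distrib, ← Finset.sum_add_distrib]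
    refine Finset.sum_congr rfl fun a _ => Finset.sum_congr rfl fun b _ => ?_
    rw [Finset.mul_sum]
    refine Finset.sum_congr rfl fun c _ => ?_
    rw [hV, Finset.sum_add_distrib, Finset.sum_add_distrib]
    ring
  rw [e, e0, sum_dC_left hP htr hH hw2 hdC, sum_dC_right hP htr hH hw2 hdC,
    sum_C_dP_left hP htr hdP hdtr hcod hC, sum_C_dP_right hP htr hdP hdtr hcod hC,
    sum_H_N_left hP htr hH hN, sum_H_N_right hP htr hH hN, sum_w_U hP htr hdP hdtr hcod hU,
    sum_C_U hP htr hdP hdtr hcod hU hC, sum_H_M hP htr hH hN hM,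
    sum_C_U_left hP htr hdP hdtr hcod hU hC, sum_C_U_right hP htr hdP hdtr hcod hU hC,
    sum_H_P_left hP htr hH, sum_H_P_right hP htr hH]
  ring

/-- The obstruction density in terms of jets equals the Willmore expression in terms of jets. -/
theorem jet_identity
    (hP : ∀ a b, P a b = P b a) (htr : ∑ a, P a a = 0)
    (hdP : ∀ a b c, dP a b c = dP b a c) (hdtr : ∀ c, ∑ a, dP a a c = 0)
    (hcod : ∀ a b c, dP a b c = dP c b a + (if a = b then 1 else 0) * r1 c
      - (if c = b then 1 else 0) * r1 a)
    (hU : ∀ c a b, U c a b = dP a b c - w c * P a b - w a * P c b - w b * P a c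
      + (if c = a then 1 else 0) * (∑ l, w l * P l b)
      + (if c = b then 1 else 0) * (∑ l, w l * P a l))
    (hH : ∀ a b, H a b = P a b - (if a = b then 1 else 0) * r)
    (hN : ∀ b c, N b c = -∑ j, P b j * H j c)
    (hM : ∀ a b, M a b = N b a + (if a = b then 1 else 0) * r3)
    (hMtr : ∑ a, M a a = r3)
    (hX : ∀ a b, X a b = r * N b a - (∑ j, M b j * H j a)
      - (∑ j, P b j * (M j a - (if j = a then 1 else 0) * r3)) - r2 b a)
    (hY : ∀ a b, Y a b = X a b + (if a = b then 1 else 0) * r33)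
    (hZ : ∀ a b, Z a b = -3 * r2 b a - X a b + (if a = b then 1 else 0) * (∑ c, r2 c c) - r2 a b)
    (hr2 : ∀ a b, r2 a b = r2 b a)
    (hC : ∀ l c a, C l c a = (if l = c then 1 else 0) * w a + (if l = a then 1 else 0) * w c
      - (if c = a then 1 else 0) * w l)
    (hw2 : ∀ a b, w2 a b = w2 b a)
    (hdC : ∀ l c a, dC l c a = (if l = c then 1 else 0) * w2 a c
      + (if l = a then 1 else 0) * w2 c c - (if c = a then 1 else 0) * w2 l c
      + (H c a + (if c = a then 1 else 0) * w3) * H l c)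
    (hV : ∀ c a b, V c a b = w2 c c * P a b + w c * dP a b c
      - (∑ l, (dC l c a * P l b + C l c a * dP l b c)) - H c a * N b c
      - (∑ l, (dC l c b * P a l + C l c b * dP a l c)) - H c b * N a c
      + w c * U c a b - (∑ l, C l c c * U l a b) - H c c * (M a b - w3 * P a b)
      - (∑ l, C l c a * U c l b) - H c a * (N b c - w3 * P c b)
      - (∑ l, C l c b * U c a l) - H c b * (N a c - w3 * P a c))
    (hβ : 12 * β = 2 * (∑ a, ∑ b, P a b * (Z a b + Y a b))
      + 2 * ((∑ a, ∑ b, ∑ c, dP a b c ^ 2) + 2 * (∑ a, ∑ b, N a b ^ 2)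
        + (∑ a, ∑ b, M a b ^ 2) + 2 * (∑ a, r1 a ^ 2) + r3 ^ 2)
      - 4 * (∑ a, ∑ b, P a b * r2 a b) + 8 * ((∑ a, r1 a ^ 2) + r3 ^ 2))
    (hR : R = ∑ q, ∑ p, ((2 * (if p = q then 1 else 0) * w2 p q - w2 p p + (H q q + w3) * H p p)
      - (w2 q q + (H p q + (if p = q then 1 else 0) * w3) * H p q)
      + ((∑ l, (C p p l * C l q q - C p q l * C l p q)) + w3 * H q q
        - (if p = q then 1 else 0) * w3 * H p q))) :
    β = (1 / 6) * ((∑ a, ∑ b, ∑ c, U a b c ^ 2)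
      + 2 * (∑ a, ∑ b, P a b * (Z a b + ∑ c, V c a b))
      + (3 / 2) * (∑ b, (∑ a, U a a b) ^ 2) - (1 / 2) * R * (∑ a, ∑ b, P a b ^ 2)
      + (∑ a, ∑ b, P a b ^ 2) ^ 2) := by
  have hSV := sum_second_derivatives hP htr hdP hdtr hcod hU hH hN hM hC hw2 hdC hV
  have hdiv : ∑ b, (∑ a, U a a b) ^ 2 = 4 * (∑ a, (∑ b, P a b * w b) ^ 2) - 8 * (∑ a, r1 a * ∑ b, P a b * w b) + 4 * ∑ a, r1 a ^ 2 := by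
    simp only [div_eq hP htr hdP hdtr hcod hU, Fin.sum_univ_three]
    ring
  have p22 : P 2 2 = -P 0 0 - P 1 1 := by rw [Fin.sum_univ_three] at htr; linarith
  have p10 := hP 1 0
  have p20 := hP 2 0
  have p21 := hP 2 1
  -- The trace of `M = Nᵀ + r3 δ` gives `r3 = tr N + 3 r3`, and `tr N = -tr(PH) = -|P|²`.
  have hr3 : r3 = (1 / 2) * (∑ a, ∑ b, P a b ^ 2) := by
    simp only [hM, hN, hH, Fin.sum_univ_three] at hMtr ⊢
    simp [p22, p10, p20, p21] at hMtr ⊢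
    linarith
  have hPY : ∑ a, ∑ b, P a b * Y a b = ∑ a, ∑ b, P a b * X a b := by
    simp only [hY, Fin.sum_univ_three]
    simp [p22]
    ring
  have hPZ : ∑ a, ∑ b, P a b * Z a b = -4 * (∑ a, ∑ b, P a b * r2 a b)
      - ∑ a, ∑ b, P a b * X a b := by
    have q10 := hr2 1 0
    have q20 := hr2 2 0
    have q21 := hr2 2 1
    simp only [hZ, Fin.sum_univ_three]
    simp [p22, q10, q20, q21]
    ring
  have hPX : ∑ a, ∑ b, P a b * X a b = -(∑ a, ∑ b, P a b * r2 a b)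
      + (1 / 2) * (∑ a, ∑ b, P a b ^ 2) ^ 2 - 4 * r * (∑ a, ∑ b, ∑ c, P a b * P b c * P c a) + 2 * r ^ 2 * (∑ a, ∑ b, P a b ^ 2) := by
    have q10 := hr2 1 0
    have q20 := hr2 2 0
    have q21 := hr2 2 1
    simp only [hX, hM, hN, hH, hr3, Fin.sum_univ_three]
    simp only [p22, p10, p20, p21, q10, q20, q21,
      Fin.isValue, Fin.reduceEq, if_true, if_false, one_mul,
    zero_mul, add_zero, zero_add, sub_zero]
    ring
  have hN2 : ∑ a, ∑ b, N a b ^ 2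
      = (1 / 2) * (∑ a, ∑ b, P a b ^ 2) ^ 2 - 2 * r * (∑ a, ∑ b, ∑ c, P a b * P b c * P c a) + r ^ 2 * (∑ a, ∑ b, P a b ^ 2) := by
    simp only [hN, hH, Fin.sum_univ_three]
    simp only [p22, p10, p20, p21,
      Fin.isValue, Fin.reduceEq, if_true, if_false, one_mul,
    zero_mul, add_zero, zero_add, sub_zero]
    ring
  have hM2 : ∑ a, ∑ b, M a b ^ 2
      = (1 / 2) * (∑ a, ∑ b, P a b ^ 2) ^ 2 - 2 * r * (∑ a, ∑ b, ∑ c, P a b * P b c * P c a) + r ^ 2 * (∑ a, ∑ b, P a b ^ 2)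
        - 2 * r3 * (∑ a, ∑ b, P a b ^ 2) + 3 * r3 ^ 2 := by
    simp only [hM, hN, hH, Fin.sum_univ_three]
    simp only [p22, p10, p20, p21,
      Fin.isValue, Fin.reduceEq, if_true, if_false, one_mul,
    zero_mul, add_zero, zero_add, sub_zero]
    ring
  simp only [mul_add, Finset.sum_add_distrib] at hβ ⊢
  rw [hPZ, hPY, hPX, hN2, hM2, hr3] at hβ
  rw [hR, curvature_eq hP htr hH hC, hSV, hdiv, sum_cube_sq hP htr hdP hdtr hcod hU, hPZ, hPX]
  -- All terms in `w`, `w2`, `w3` have cancelled among `|∇A|²`, `⟨A, ΔA⟩`, `|div A|²` and the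
  -- curvature term: the coefficients `2`, `3/2` and `-2` of the Willmore expression are exactly
  -- those for which this happens.
  linear_combination (1 / 12) * hβ

end Algebra

end ConfHyp

namespace ConfHyp

/-! ### The ambient connection along the level set -/

section Ambient

variable {n : ℕ}

theorem covWith_two (C : Symbols n) (T : CoordTensor n 2) (y : E n) (k i j : Fin n) :
    covWith C T y ![k, i, j] = pd (fun z => T z ![i, j]) k y
      - ((∑ l, C l k i y * T y ![l, j]) + ∑ l, C l k j y * T y ![i, l]) := by
  have ht : Fin.tail ![k, i, j] = ![i, j] := by ext r; fin_cases r <;> rfl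
  have h0 : ∀ l, Function.update ![i, j] (0 : Fin 2) l = ![l, j] := by
    intro l; ext r; fin_cases r <;> rfl
  have h1 : ∀ l, Function.update ![i, j] (1 : Fin 2) l = ![i, l] := by
    intro l; ext r; fin_cases r <;> rfl
  simp only [covWith, ht, Fin.sum_univ_two, h0, h1]
  rfl

theorem covWith_three (C : Symbols n) (T : CoordTensor n 3) (y : E n) (d k i j : Fin n) :
    covWith C T y ![d, k, i, j] = pd (fun z => T z ![k, i, j]) d y
      - ((∑ l, C l d k y * T y ![l, i, j]) + (∑ l, C l d i y * T y ![k, l, j])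
        + ∑ l, C l d j y * T y ![k, i, l]) := by
  have ht : Fin.tail ![d, k, i, j] = ![k, i, j] := by ext r; fin_cases r <;> rfl
  have h0 : ∀ l, Function.update ![k, i, j] (0 : Fin 3) l = ![l, i, j] := by
    intro l; ext r; fin_cases r <;> rfl
  have h1 : ∀ l, Function.update ![k, i, j] (1 : Fin 3) l = ![k, l, j] := by
    intro l; ext r; fin_cases r <;> rfl
  have h2 : ∀ l, Function.update ![k, i, j] (2 : Fin 3) l = ![k, i, l] := by
    intro l; ext r; fin_cases r <;> rfl
  simp only [covWith, ht, Fin.sum_univ_three, h0, h1, h2]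
  rfl

variable {φ s b : E 4 → ℝ} {x y : E 4}

/-- The Levi-Civita connection of `e^{2φ} δ`, corrected by the second fundamental form of the level
sets of `s`. -/
noncomputable def ambSymbols (φ s : E 4 → ℝ) : Symbols 4 := fun k p q y =>
  confSymbols φ k p q y
    + (pd₂ s p q y + (if p = q then 1 else 0) * ∑ i, pd φ i y * pd s i y) * pd s k y

@[fun_prop]
theorem contDiffAt_ambSymbols (hφ : ContDiffAt ℝ ∞ φ y) (hs : ContDiffAt ℝ ∞ s y)
    (k p q : Fin 4) : ContDiffAt ℝ ∞ (fun z => ambSymbols φ s k p q z) y := by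
  unfold ambSymbols
  fun_prop

theorem pd_ambSymbols (hφ : ContDiffAt ℝ ∞ φ y) (hs : ContDiffAt ℝ ∞ s y) (k p q d : Fin 4) :
    pd (fun z => ambSymbols φ s k p q z) d y
      = (if k = p then 1 else 0) * pd₂ φ q d y + (if k = q then 1 else 0) * pd₂ φ p d y
        - (if p = q then 1 else 0) * pd₂ φ k d y
        + (pd (fun z => pd₂ s p q z) d y
          + (if p = q then 1 else 0) * ∑ i, (pd₂ φ i d y * pd s i y + pd φ i y * pd₂ s i d y))
          * pd s k y
        + (pd₂ s p q y + (if p = q then 1 else 0) * ∑ i, pd φ i y * pd s i y) * pd₂ s k d y := by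
  unfold ambSymbols
  rw [pd_add (by fun_prop) (by fun_prop)]
  rw [pd_confSymbols hφ]
  simp only [Fin.sum_univ_four]
  simp (disch := fun_prop) only [pd_add, pd_mul, pd_const]
  unfold pd₂
  ring

/-- The trace-free second fundamental form `e^φ P`, as an ambient tensor. -/
noncomputable def tfTensor (φ s : E 4 → ℝ) : CoordTensor 4 2 := fun y a =>
  Real.exp (φ y) * tfHess s (a 0) (a 1) y

theorem tfTensor_apply (i j : Fin 4) :
    tfTensor φ s y ![i, j] = Real.exp (φ y) * tfHess s i j y := rfl

theorem contDiffAt_tfTensor (hφ : ContDiffAt ℝ ∞ φ y) (hs : ContDiffAt ℝ ∞ s y)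
    (a : Fin 2 → Fin 4) : ContDiffAt ℝ ∞ (fun z => tfTensor φ s z a) y := by
  unfold tfTensor
  fun_prop

/-- The components of `e^{-φ} ∇(e^φ P)`. -/
noncomputable def tfCube (φ s : E 4 → ℝ) (k i j : Fin 4) (y : E 4) : ℝ :=
  pd (fun z => tfHess s i j z) k y + pd φ k y * tfHess s i j y
    - ((∑ l, ambSymbols φ s l k i y * tfHess s l j y)
      + ∑ l, ambSymbols φ s l k j y * tfHess s i l y)

@[fun_prop]
theorem contDiffAt_tfCube (hφ : ContDiffAt ℝ ∞ φ y) (hs : ContDiffAt ℝ ∞ s y)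
    (k i j : Fin 4) : ContDiffAt ℝ ∞ (fun z => tfCube φ s k i j z) y := by
  unfold tfCube
  fun_prop

theorem covWith_tfTensor (hφ : ContDiffAt ℝ ∞ φ y) (hs : ContDiffAt ℝ ∞ s y) (k i j : Fin 4) :
    covWith (ambSymbols φ s) (tfTensor φ s) y ![k, i, j]
      = Real.exp (φ y) * tfCube φ s k i j y := by
  rw [covWith_two]
  simp only [tfTensor_apply, tfCube]
  rw [pd_mul (by fun_prop) (by fun_prop), pd_exp hφ]
  simp only [Fin.sum_univ_four]
  ring

theorem covWith_covWith_tfTensor (hφ : ∀ᶠ y in 𝓝 x, ContDiffAt ℝ ∞ φ y)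
    (hs : ∀ᶠ y in 𝓝 x, ContDiffAt ℝ ∞ s y) (d k i j : Fin 4) :
    covWith (ambSymbols φ s) (covWith (ambSymbols φ s) (tfTensor φ s)) x ![d, k, i, j]
      = Real.exp (φ x) * (pd (fun z => tfCube φ s k i j z) d x + pd φ d x * tfCube φ s k i j x
        - ((∑ l, ambSymbols φ s l d k x * tfCube φ s l i j x)
          + (∑ l, ambSymbols φ s l d i x * tfCube φ s k l j x)
          + ∑ l, ambSymbols φ s l d j x * tfCube φ s k i l x)) := by
  have hφx := hφ.self_of_nhds
  have hsx := hs.self_of_nhds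
  rw [covWith_three]
  have e : (fun z => covWith (ambSymbols φ s) (tfTensor φ s) z ![k, i, j])
      =ᶠ[𝓝 x] fun z => Real.exp (φ z) * tfCube φ s k i j z := by
    filter_upwards [hφ, hs] with z h1 h2 using covWith_tfTensor h1 h2 k i j
  rw [pd_congr e, pd_mul (by fun_prop) (by fun_prop), pd_exp hφx]
  simp only [covWith_tfTensor hφx hsx, Fin.sum_univ_four]
  ring

theorem pd_tfCube (hφ : ContDiffAt ℝ ∞ φ y) (hs : ContDiffAt ℝ ∞ s y) (k i j d : Fin 4) :
    pd (fun z => tfCube φ s k i j z) d y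
      = pd₂ (fun z => tfHess s i j z) k d y + pd₂ φ k d y * tfHess s i j y
        + pd φ k y * pd (fun z => tfHess s i j z) d y
        - ((∑ l, (pd (fun z => ambSymbols φ s l k i z) d y * tfHess s l j y
            + ambSymbols φ s l k i y * pd (fun z => tfHess s l j z) d y))
          + ∑ l, (pd (fun z => ambSymbols φ s l k j z) d y * tfHess s i l y
            + ambSymbols φ s l k j y * pd (fun z => tfHess s i l z) d y)) := by
  unfold tfCube
  simp only [Fin.sum_univ_four]
  simp (disch := fun_prop) only [pd_add, pd_sub, pd_mul]
  unfold pd₂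
  ring

end Ambient

end ConfHyp

namespace ConfHyp

/-! ### The remainder expressed in coordinates adapted to the normal -/

section FlatIdentity

variable {φ s b : E 4 → ℝ} {x : E 4}

/-- The obstruction density at a point where the normal vector is the coordinate vector `L` and the
coordinate vectors `T a` are tangential, in terms of the covariant derivatives of the ambient
extension of the trace-free second fundamental form. -/
theorem remainder_eq_tfCube {T : Fin 3 → Fin 4} {L : Fin 4} (hT : Function.Injective T)
    (hTL : ∀ a, T a ≠ L) (hsum : ∀ f : Fin 4 → ℝ, ∑ i, f i = (∑ a, f (T a)) + f L)
    (hφ : ∀ᶠ y in 𝓝 x, ContDiffAt ℝ ∞ φ y) (h : IsFlatSolution s b x)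
    (h0 : s x = 0) (hn : ∀ i, pd s i x = if i = L then 1 else 0) :
    b x = (1 / 6) * ((∑ c : Fin 3, ∑ a : Fin 3, ∑ b : Fin 3,
          tfCube φ s (T c) (T a) (T b) x ^ 2)
      + 2 * (∑ a : Fin 3, ∑ b : Fin 3, tfHess s (T a) (T b) x * ∑ c : Fin 3,
        (pd (fun z => tfCube φ s (T c) (T a) (T b) z) (T c) x
          + pd φ (T c) x * tfCube φ s (T c) (T a) (T b) x
          - ((∑ l, ambSymbols φ s l (T c) (T c) x
              * tfCube φ s l (T a) (T b) x)
            + (∑ l, ambSymbols φ s l (T c) (T a) x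
              * tfCube φ s (T c) l (T b) x)
            + ∑ l, ambSymbols φ s l (T c) (T b) x
              * tfCube φ s (T c) (T a) l x)))
      + (3 / 2) * (∑ b : Fin 3, (∑ a : Fin 3,
          tfCube φ s (T a) (T a) (T b) x) ^ 2)
      - (1 / 2) * (∑ q : Fin 3, ∑ p : Fin 3,
          riem (ambSymbols φ s) (T p) (T p) (T q) (T q) x)
        * (∑ a : Fin 3, ∑ b : Fin 3, tfHess s (T a) (T b) x ^ 2)
      + (∑ a : Fin 3, ∑ b : Fin 3, tfHess s (T a) (T b) x ^ 2) ^ 2) := by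
  have hs := h.smooth.self_of_nhds
  have hφx := hφ.self_of_nhds
  have tite : ∀ a b : Fin 3, (if T a = T b then (1 : ℝ) else 0) = if a = b then 1 else 0 :=
    fun a b => by simp [hT.eq_iff]
  have nL : pd s L x = 1 := by simp [hn]
  have nT : ∀ a : Fin 3, pd s (T a) x = 0 := fun a => by rw [hn, if_neg (hTL a)]
  have neL : ∀ a : Fin 3, (T a = L) = False :=
    fun a => eq_false (hTL a)
  have neL' : ∀ a : Fin 3, (L = (T a)) = False :=
    fun a => eq_false (hTL a).symm
  -- On the zero set `P` annihilates the gradient, which here is the coordinate vector `L`.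
  have PL : ∀ i, tfHess s i L x = 0 := by
    intro i
    have := h.sum_tfHess_mul_eq_zero h0 i
    simpa [hsum, nL, nT] using this
  have PL' : ∀ i, tfHess s L i x = 0 := fun i => by rw [tfHess_symm hs, PL]
  have HL : ∀ a : Fin 3, pd₂ s (T a) L x = 0 := by
    intro a; rw [pd₂_eq_tfHess, PL]; simp [neL]
  have HL' : ∀ a : Fin 3, pd₂ s L (T a) x = 0 := by
    intro a; rw [pd₂_comm hs, HL]
  have HLL : pd₂ s L L x = -rho s x := by
    rw [pd₂_eq_tfHess, PL]; simp
  have dsym : ∀ i j k, pd (fun z => tfHess s i j z) k x = pd (fun z => tfHess s j i z) k x :=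
    fun i j k => pd_tfHess_symm h.smooth i j k
  have dNT : ∀ b c : Fin 3, pd (fun z => tfHess s (T b) L z) (T c) x
      = -∑ j : Fin 3, tfHess s (T b) (T j) x * pd₂ s (T j) (T c) x := by
    intro b c
    have := h.first_order h0 (T b) (T c)
    simp [hsum, nL, nT, PL] at this
    linear_combination this
  have dLLT : ∀ c : Fin 3, pd (fun z => tfHess s L L z) (T c) x = 0 := by
    intro c
    have := h.first_order h0 L (T c)
    simpa [hsum, nL, nT, PL'] using this
  have dTLL : ∀ b : Fin 3, pd (fun z => tfHess s (T b) L z) L x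
      = -pd (fun z => rho s z) (T b) x := by
    intro b
    have := h.first_order h0 (T b) L
    simp [hsum, nL, nT, PL, HL] at this
    linear_combination this
  have dLLL : pd (fun z => tfHess s L L z) L x
      = -pd (fun z => rho s z) L x := by
    have := h.first_order h0 L L
    simp [hsum, nL, nT, PL'] at this
    linear_combination this
  have cod2 : ∀ i j k l, pd₂ (fun z => tfHess s i j z) k l x
      = pd₂ (fun z => tfHess s k j z) i l x
        + (if i = j then 1 else 0) * pd₂ (fun z => rho s z) k l x
        - (if k = j then 1 else 0) * pd₂ (fun z => rho s z) i l x := by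
    intro i j k l
    have e : (fun y => pd (fun z => tfHess s i j z) k y) =ᶠ[𝓝 x] fun y =>
        pd (fun z => tfHess s k j z) i y
        + (if i = j then 1 else 0) * pd (fun z => rho s z) k y
        - (if k = j then 1 else 0) * pd (fun z => rho s z) i y := by
      filter_upwards [h.smooth.eventually_nhds] with y hy using tfHess_codazzi hy i j k
    unfold pd₂
    rw [pd_congr e, pd_sub (by fun_prop) (by fun_prop), pd_add (by fun_prop) (by fun_prop),
      pd_const_mul _ (by fun_prop), pd_const_mul _ (by fun_prop)]
  have ddsym : ∀ i j k l, pd₂ (fun z => tfHess s i j z) k l x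
      = pd₂ (fun z => tfHess s j i z) k l x := by
    intro i j k l
    have e : (fun z => tfHess s i j z) =ᶠ[𝓝 x] fun z => tfHess s j i z := by
      filter_upwards [h.smooth] with y hy using tfHess_symm hy i j
    exact pd_congr (pd_congr_eventually e k) l
  have ddcomm : ∀ i j k l, pd₂ (fun z => tfHess s i j z) k l x
      = pd₂ (fun z => tfHess s i j z) l k x := fun i j k l => pd₂_comm (by fun_prop) k l
  have dpd₂ : ∀ i j k, pd (fun z => pd₂ s i j z) k x = pd (fun z => tfHess s i j z) k x
      - (if i = j then 1 else 0) * pd (fun z => rho s z) k x := by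
    intro i j k
    rw [pd_tfHess hs]; ring
  have hHT : ∀ a b : Fin 3, pd₂ s (T a) (T b) x = tfHess s (T a) (T b) x
      - (if a = b then 1 else 0) * rho s x := fun a b => by
    rw [pd₂_eq_tfHess, tite]
  -- The second-order relation with one tangential and one normal derivative; since `∇s = L`, it
  -- isolates the mixed derivative of the component of `P` with one normal index.
  have hX : ∀ a b : Fin 3, pd₂ (fun z => tfHess s L (T b) z) (T a)
        L x
      = rho s x * pd (fun z => tfHess s (T b) L z) (T a) x
        - (∑ j : Fin 3, pd (fun z => tfHess s (T b) (T j) z) L x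
          * pd₂ s (T j) (T a) x)
        - (∑ j : Fin 3, tfHess s (T b) (T j) x *
          (pd (fun z => tfHess s (T j) (T a) z) L x
            - (if j = a then 1 else 0) * pd (fun z => rho s z) L x))
        - pd₂ (fun z => rho s z) (T b) (T a) x := by
    intro a b
    have := h.second_order h0 (T b) (T a) L
    simp only [hsum, nL, nT, PL, HL, HL', HLL, dpd₂,
      tite, Finset.sum_add_distrib, mul_zero, zero_mul, add_zero, zero_add,
      Finset.sum_const_zero] at this
    rw [ddsym]
    linear_combination this
  have r2sym : ∀ i j, pd₂ (fun z => rho s z) i j x = pd₂ (fun z => rho s z) j i x :=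
    fun i j => pd₂_comm (by fun_prop) i j
  have dTr : ∀ c : Fin 3, ∑ a : Fin 3, pd (fun z => tfHess s (T a) (T a) z) (T c) x = 0 := by
    intro c
    have := sum_pd_tfHess hs (T c)
    rw [hsum, dLLT] at this
    linear_combination this
  have dTrL : ∑ a : Fin 3, pd (fun z => tfHess s (T a) (T a) z) L x
      = pd (fun z => rho s z) L x := by
    have := sum_pd_tfHess hs L
    rw [hsum, dLLL] at this
    linear_combination this
  have hY : ∀ a b : Fin 3, pd₂ (fun z => tfHess s (T a) (T b) z) L L x
      = pd₂ (fun z => tfHess s L (T b) z) (T a) L x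
        + (if a = b then 1 else 0) * pd₂ (fun z => rho s z) L L x := by
    intro a b
    rw [cod2, tite, if_neg (hTL b).symm]
    ring
  have ddiv : ∀ j k, ∑ i, pd₂ (fun z => tfHess s j i z) i k x
      = -3 * pd₂ (fun z => rho s z) j k x := by
    intro j k
    have e : (fun y => ∑ i, pd (fun z => tfHess s j i z) i y) =ᶠ[𝓝 x]
        fun y => -3 * pd (fun z => rho s z) j y := by
      filter_upwards [h.smooth.eventually_nhds] with y hy using sum_pd_tfHess_div hy j
    have e' := pd_congr e k
    rw [pd_sum _ fun i _ => by fun_prop, pd_const_mul _ (by fun_prop)] at e'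
    exact e'
  -- Codazzi turns the tangential Laplacian of `P` into a derivative of its tangential divergence.
  -- The full divergence is `-3∇ρ`, and its missing normal term is the quantity computed in `hX`.
  have hZ : ∀ a b : Fin 3, ∑ c : Fin 3, pd₂ (fun z => tfHess s (T a) (T b) z) (T c) (T c) x
      = -3 * pd₂ (fun z => rho s z) (T b) (T a) x
        - pd₂ (fun z => tfHess s L (T b) z) (T a) L x
        + (if a = b then 1 else 0) * (∑ c : Fin 3, pd₂ (fun z => rho s z) (T c) (T c) x)
        - pd₂ (fun z => rho s z) (T a) (T b) x := by
    intro a b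
    have e : ∀ c : Fin 3, pd₂ (fun z => tfHess s (T a) (T b) z) (T c) (T c) x
        = pd₂ (fun z => tfHess s (T b) (T c) z) (T c) (T a) x
          + (if a = b then 1 else 0) * pd₂ (fun z => rho s z) (T c) (T c) x
          - (if c = b then 1 else 0) * pd₂ (fun z => rho s z) (T a) (T c) x := by
      intro c
      rw [cod2, ddcomm _ _ (T a), ddsym (T c) (T b), tite, tite]
    have d := ddiv (T b) (T a)
    rw [hsum, ddsym, ddcomm] at d
    rw [Finset.sum_congr rfl fun c _ => e c, Finset.sum_sub_distrib, Finset.sum_add_distrib,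
      ← Finset.mul_sum]
    simp only [ite_mul, one_mul, zero_mul, Finset.sum_ite_eq', Finset.mem_univ, if_true]
    linear_combination d
  have ambT : ∀ l c a : Fin 3, ambSymbols φ s (T l) (T c) (T a) x
      = (if l = c then 1 else 0) * pd φ (T a) x + (if l = a then 1 else 0) * pd φ (T c) x
        - (if c = a then 1 else 0) * pd φ (T l) x := by
    intro l c a
    simp only [ambSymbols, confSymbols, nT, tite]
    ring
  have w3 : ∑ i, pd φ i x * pd s i x = pd φ L x := by
    simp [hsum, nL, nT]
  have ambL : ∀ c a : Fin 3, ambSymbols φ s L (T c) (T a) x = pd₂ s (T c) (T a) x := by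
    intro c a
    simp only [ambSymbols, confSymbols, w3, nL, neL', tite, if_false]
    ring
  have ambR : ∀ l c : Fin 3, ambSymbols φ s (T l) (T c) L x
      = (if l = c then 1 else 0) * pd φ L x := by
    intro l c
    simp only [ambSymbols, confSymbols, nT, neL, tite, if_false]
    ring
  have ambM : ∀ l c : Fin 3, ambSymbols φ s (T l) L (T c) x
      = (if l = c then 1 else 0) * pd φ L x := by
    intro l c
    simp only [ambSymbols, confSymbols, nT, neL, neL', tite, if_false]
    ring
  have damb : ∀ l c a d : Fin 3, pd (fun z => ambSymbols φ s (T l) (T c) (T a) z) (T d) x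
      = (if l = c then 1 else 0) * pd₂ φ (T a) (T d) x
        + (if l = a then 1 else 0) * pd₂ φ (T c) (T d) x
        - (if c = a then 1 else 0) * pd₂ φ (T l) (T d) x
        + (pd₂ s (T c) (T a) x + (if c = a then 1 else 0) * pd φ L x) * pd₂ s (T l) (T d) x := by
    intro l c a d
    rw [pd_ambSymbols hφx hs, w3, nT]
    simp only [tite]
    ring
  have hU : ∀ c a b : Fin 3, tfCube φ s (T c) (T a) (T b) x
      = pd (fun z => tfHess s (T a) (T b) z) (T c) x
        - pd φ (T c) x * tfHess s (T a) (T b) x - pd φ (T a) x * tfHess s (T c) (T b) x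
        - pd φ (T b) x * tfHess s (T a) (T c) x
        + (if c = a then 1 else 0) * (∑ l : Fin 3, pd φ (T l) x * tfHess s (T l) (T b) x)
        + (if c = b then 1 else 0) * (∑ l : Fin 3, pd φ (T l) x * tfHess s (T a) (T l) x) := by
    intro c a b
    simp only [tfCube, hsum, PL, PL', ambT, sub_mul, add_mul, mul_zero, add_zero,
      Finset.sum_sub_distrib, Finset.sum_add_distrib, ite_mul, one_mul, zero_mul,
      Finset.sum_ite_eq', Finset.mem_univ, if_true]
    split_ifs <;> (try simp only [Finset.sum_const_zero]) <;> ring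
  have cubeL : ∀ a b : Fin 3, tfCube φ s L (T a) (T b) x
      = pd (fun z => tfHess s (T a) (T b) z) L x - pd φ L x * tfHess s (T a) (T b) x := by
    intro a b
    simp only [tfCube, hsum, PL, PL', ambM, mul_zero, add_zero, ite_mul, one_mul,
      zero_mul, Finset.sum_ite_eq', Finset.mem_univ, if_true]
    ring
  have cubeM : ∀ c b : Fin 3, tfCube φ s (T c) L (T b) x
      = pd (fun z => tfHess s (T b) L z) (T c) x - pd φ L x * tfHess s (T c) (T b) x := by
    intro c b
    simp only [tfCube, hsum, PL', ambR, mul_zero, add_zero, ite_mul, one_mul,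
      zero_mul, Finset.sum_ite_eq', Finset.mem_univ, if_true, Finset.sum_const_zero]
    rw [dsym L]
  have cubeR : ∀ c a : Fin 3, tfCube φ s (T c) (T a) L x
      = pd (fun z => tfHess s (T a) L z) (T c) x - pd φ L x * tfHess s (T a) (T c) x := by
    intro c a
    simp only [tfCube, hsum, PL, ambR, mul_zero, add_zero, ite_mul, one_mul,
      zero_mul, Finset.sum_ite_eq', Finset.mem_univ, if_true, Finset.sum_const_zero]
    ring
  have key := jet_identity
    (P := fun a b => tfHess s (T a) (T b) x)
    (dP := fun a b c => pd (fun z => tfHess s (T a) (T b) z) (T c) x)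
    (U := fun c a b => tfCube φ s (T c) (T a) (T b) x)
    (w := fun a => pd φ (T a) x) (w3 := pd φ L x) (w2 := fun a b => pd₂ φ (T a) (T b) x)
    (r := rho s x) (r1 := fun a => pd (fun z => rho s z) (T a) x)
    (r3 := pd (fun z => rho s z) L x)
    (r2 := fun a b => pd₂ (fun z => rho s z) (T a) (T b) x)
    (r33 := pd₂ (fun z => rho s z) L L x)
    (H := fun a b => pd₂ s (T a) (T b) x)
    (N := fun a c => pd (fun z => tfHess s (T a) L z) (T c) x)
    (M := fun a c => pd (fun z => tfHess s (T a) (T c) z) L x)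
    (X := fun a c => pd₂ (fun z => tfHess s L (T c) z) (T a) L x)
    (Y := fun a c => pd₂ (fun z => tfHess s (T a) (T c) z) L L x)
    (Z := fun a c => ∑ d : Fin 3, pd₂ (fun z => tfHess s (T a) (T c) z) (T d) (T d) x)
    (C := fun l c a => ambSymbols φ s (T l) (T c) (T a) x)
    (dC := fun l c a => pd (fun z => ambSymbols φ s (T l) (T c) (T a) z) (T c) x)
    -- The plain second derivatives are subtracted because their sum over `c` is the separate
    -- variable `Z`.
    (V := fun c a d => (pd (fun z => tfCube φ s (T c) (T a) (T d) z) (T c) x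
          + pd φ (T c) x * tfCube φ s (T c) (T a) (T d) x
          - ((∑ l, ambSymbols φ s l (T c) (T c) x * tfCube φ s l (T a) (T d) x)
            + (∑ l, ambSymbols φ s l (T c) (T a) x * tfCube φ s (T c) l (T d) x)
            + ∑ l, ambSymbols φ s l (T c) (T d) x * tfCube φ s (T c) (T a) l x))
        - pd₂ (fun z => tfHess s (T a) (T d) z) (T c) (T c) x)
    (R := ∑ q : Fin 3, ∑ p : Fin 3, riem (ambSymbols φ s) (T p) (T p) (T q) (T q) x)
    (β := b x)
    (fun _ _ => tfHess_symm hs _ _) ?_ (fun _ _ _ => dsym _ _ _) dTr ?_ hU hHT dNT ?_ dTrL hX hY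
    hZ (fun _ _ => r2sym _ _) ambT (fun _ _ => pd₂_comm hφx _ _)
    (fun l c a => damb l c a c) ?_ ?_ ?_
  · rw [key]
    simp only [Finset.sum_sub_distrib, add_sub_cancel]
  · have := sum_tfHess (s := s) (y := x)
    rw [hsum, PL] at this
    linear_combination this
  · intro a b c
    rw [tfHess_codazzi h.smooth, tite, tite]
  · intro a b
    rw [tfHess_codazzi h.smooth, tite, if_neg (hTL b).symm, dsym]
    ring
  · intro c a d
    simp only [pd_tfCube hφx hs, hsum, PL, PL', ambL, cubeL, cubeM, cubeR, dsym L]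
    simp only [mul_zero, zero_add]
    ring
  -- Splitting every index into tangential and normal ones gives `|∇P|² = |dP|² + 2|N|² + |M|² +
  -- 2|r1|² + r3²`.
  · have := h.remainder_eq h0
    simp only [hsum, PL, PL', dLLT, dTLL, dLLL, dsym L, mul_zero, zero_mul, zero_add,
      add_zero] at this
    simp only [Fin.sum_univ_three] at this ⊢
    linear_combination this
  · refine Finset.sum_congr rfl fun q _ => Finset.sum_congr rfl fun p _ => ?_
    unfold riem
    simp only [hsum, damb, ambR, ambL, if_true, pd₂_comm hφx (T q) (T p)]
    ring

end FlatIdentity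

end ConfHyp

namespace ConfHyp

/-! ### Parametrized level sets -/

section LevelSet

variable {m n : ℕ}

theorem sum_pd_mul_jac {X : E m → E n} {s : E n → ℝ} {u : E m}
    (hX : ContDiffAt ℝ ∞ X u) (hs : ContDiffAt ℝ ∞ s (X u))
    (h0 : ∀ᶠ v in 𝓝 u, s (X v) = 0) (a : Fin m) :
    ∑ i, pd s i (X u) * jac X i a u = 0 := by
  have e : (fun v => s (X v)) =ᶠ[𝓝 u] fun _ => 0 := h0
  have := pd_congr e a
  rw [pd_const, pd_comp_jac hs hX] at this
  simpa only [mul_comm] using this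

/-- Differentiating `s ∘ X = 0` twice: the normal component of `∂_a∂_b X` is minus the Hessian of
`s` on the tangent vectors. -/
theorem sum_pd_mul_pd_jac {X : E m → E n} {s : E n → ℝ} {u : E m}
    (hX : ∀ᶠ v in 𝓝 u, ContDiffAt ℝ ∞ X v) (hs : ∀ᶠ v in 𝓝 u, ContDiffAt ℝ ∞ s (X v))
    (h0 : ∀ᶠ v in 𝓝 u, s (X v) = 0) (a b : Fin m) :
    ∑ k, pd s k (X u) * pd (fun v => jac X k b v) a u
      = -∑ p, ∑ q, pd₂ s p q (X u) * jac X p a u * jac X q b u := by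
  have e : (fun v => ∑ i, pd s i (X v) * jac X i b v) =ᶠ[𝓝 u] fun _ => 0 := by
    filter_upwards [hX, hs, h0.eventually_nhds] with v h1 h2 h3 using sum_pd_mul_jac h1 h2 h3 b
  have hXu := hX.self_of_nhds
  have hsu := hs.self_of_nhds
  have hpX : ∀ i, ContDiffAt ℝ ∞ (fun v => pd s i (X v)) u :=
    fun i => (contDiffAt_pd hsu i).comp u hXu
  have e' := pd_congr e a
  rw [pd_const, pd_sum _ fun i _ => (hpX i).mul (contDiffAt_jac hXu i b),
    Finset.sum_congr rfl fun i _ => pd_mul (hpX i) (contDiffAt_jac hXu i b) a,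
    Finset.sum_add_distrib] at e'
  rw [eq_neg_iff_add_eq_zero, ← e', add_comm, Finset.sum_comm]
  congr 1
  refine Finset.sum_congr rfl fun i _ => ?_
  rw [pd_comp_jac (f := fun y => pd s i y) (contDiffAt_pd hsu i) hXu, Finset.sum_mul]
  refine Finset.sum_congr rfl fun p _ => ?_
  rw [pd₂_comm hsu]
  unfold pd₂
  ring

theorem pullMetric_confMetric (X : E m → E n) (φ : E n → ℝ) (u : E m) :
    pullMetric X (confMetric φ) u
      = Real.exp (2 * φ (X u)) • ((jacMat X u).transpose * jacMat X u) := by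
  simp [pullMetric, confMetric]

theorem isUnit_det_transpose_mul {X : E m → E n} {φ : E n → ℝ} {u : E m}
    (h : IsUnit (pullMetric X (confMetric φ) u).det) :
    IsUnit ((jacMat X u).transpose * jacMat X u).det := by
  rw [pullMetric_confMetric, Matrix.det_smul] at h
  exact isUnit_of_mul_isUnit_right h

theorem inv_pullMetric_confMetric {X : E m → E n} {φ : E n → ℝ} {u : E m}
    (h : IsUnit (pullMetric X (confMetric φ) u).det) :
    (pullMetric X (confMetric φ) u)⁻¹
      = Real.exp (-(2 * φ (X u))) • ((jacMat X u).transpose * jacMat X u)⁻¹ := by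
  refine Matrix.inv_eq_left_inv ?_
  rw [pullMetric_confMetric, Matrix.smul_mul, Matrix.mul_smul,
    Matrix.nonsing_inv_mul _ (isUnit_det_transpose_mul h), smul_smul, ← Real.exp_add]
  simp

/-- The tangential projection along a level set. -/
theorem jacMat_mul_inv_mul_transpose {X : E m → E (m + 1)} {φ s : E (m + 1) → ℝ} {u : E m}
    (hX : ContDiffAt ℝ ∞ X u) (hs : ContDiffAt ℝ ∞ s (X u))
    (h0 : ∀ᶠ v in 𝓝 u, s (X v) = 0) (h1 : ∑ i, pd s i (X u) ^ 2 = 1)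
    (hu : IsUnit (pullMetric X (confMetric φ) u).det) :
    jacMat X u * (pullMetric X (confMetric φ) u)⁻¹ * (jacMat X u).transpose
      = Real.exp (-(2 * φ (X u))) •
        (1 - Matrix.of fun i j => pd s i (X u) * pd s j (X u)) := by
  rw [← mul_inv_mul_transpose (isUnit_det_transpose_mul hu) (by simpa only [sq] using h1)
    (sum_pd_mul_jac hX hs h0), inv_pullMetric_confMetric hu]
  simp

end LevelSet

/-! ### Induced connection and Willmore expression in a conformally flat chart -/

section FlatHypersurface

variable {φ s b : E 4 → ℝ} {X : E 3 → E 4} {h : E 3 → Matrix (Fin 3) (Fin 3) ℝ} {u : E 3}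

theorem sum_normal_confSymbols {w v j j' : Fin 4 → ℝ} (h1 : ∑ i, v i * j i = 0)
    (h2 : ∑ i, v i * j' i = 0) :
    ∑ l, v l * ∑ p, ∑ q, ((if l = p then 1 else 0) * w q + (if l = q then 1 else 0) * w p
        - (if p = q then 1 else 0) * w l) * j p * j' q
      = -(∑ i, w i * v i) * ∑ p, j p * j' p := by
  simp only [Fin.sum_univ_four] at h1 h2 ⊢
  simp
  linear_combination (w 0 * j' 0 + w 1 * j' 1 + w 2 * j' 2 + w 3 * j' 3) * h1
    + (w 0 * j 0 + w 1 * j 1 + w 2 * j 2 + w 3 * j 3) * h2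

/-- The induced connection is the projection by `1 - n nᵀ`, `n = ∇s`, of `∂_a∂_b X` plus the symbols
of `e^{2φ}δ`. The removed normal component is minus `Hess s + ⟨dφ, ds⟩δ` evaluated on the two
tangent vectors. Adding that tensor times `n` to the symbols therefore makes the relation hold
without a projection. -/
theorem related_ambSymbols (hφ : ContDiffAt ℝ ∞ φ (X u))
    (hs : ∀ᶠ v in 𝓝 u, ContDiffAt ℝ ∞ s (X v)) (hX : ∀ᶠ v in 𝓝 u, ContDiffAt ℝ ∞ X v)
    (h0 : ∀ᶠ v in 𝓝 u, s (X v) = 0) (h1 : ∑ i, pd s i (X u) ^ 2 = 1)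
    (hh : h =ᶠ[𝓝 u] pullMetric X (confMetric φ)) (hu : IsUnit (h u).det) :
    Related X (christoffel h) (ambSymbols φ s) u := by
  have hXu := hX.self_of_nhds
  have hsu := hs.self_of_nhds
  intro k a b
  have hP : jacMat X u * (h u)⁻¹ * (jacMat X u).transpose * confMetric φ (X u)
      = 1 - Matrix.of fun i j => pd s i (X u) * pd s j (X u) := by
    rw [hh.self_of_nhds] at hu ⊢
    rw [jacMat_mul_inv_mul_transpose hXu hsu h0 h1 hu, confMetric]
    simp [smul_smul, ← Real.exp_add]
  rw [sum_christoffel_pullMetric hXu (fun k l => contDiffAt_confMetric hφ k l) confMetric_symm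
    (isUnit_det_confMetric _) hh, hP]
  have hA := sum_pd_mul_jac hXu hsu h0 a
  have hB := sum_pd_mul_jac hXu hsu h0 b
  have hC := sum_normal_confSymbols (w := fun i => pd φ i (X u)) hA hB
  have hD := sum_pd_mul_pd_jac hX hs h0 a b
  simp only [christoffel_confMetric hφ, Matrix.sub_apply, Matrix.one_apply, Matrix.of_apply,
    sub_mul, Finset.sum_sub_distrib, ite_mul, one_mul, zero_mul, Finset.sum_ite_eq,
    Finset.mem_univ, if_true, mul_assoc (pd s k (X u)), ← Finset.mul_sum, mul_add,
    Finset.sum_add_distrib]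
  rw [hD]
  have hC' : ∑ l, pd s l (X u) * ∑ p, ∑ q, confSymbols φ l p q (X u) * jac X p a u * jac X q b u
      = -(∑ i, pd φ i (X u) * pd s i (X u)) * ∑ p, jac X p a u * jac X p b u := hC
  rw [hC']
  have hE : ∑ p, ∑ q, (if p = q then (1 : ℝ) else 0) * jac X p a u * jac X q b u
      = ∑ p, jac X p a u * jac X p b u := by simp
  have hF : ∑ p, ∑ q, ambSymbols φ s k p q (X u) * jac X p a u * jac X q b u
      = (∑ p, ∑ q, confSymbols φ k p q (X u) * jac X p a u * jac X q b u)
        + pd s k (X u) * ((∑ p, ∑ q, pd₂ s p q (X u) * jac X p a u * jac X q b u)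
          + (∑ i, pd φ i (X u) * pd s i (X u))
            * ∑ p, ∑ q, (if p = q then (1 : ℝ) else 0) * jac X p a u * jac X q b u) := by
    simp only [ambSymbols]
    generalize ∑ i, pd φ i (X u) * pd s i (X u) = κ
    simp only [Finset.mul_sum, ← Finset.sum_add_distrib]
    refine Finset.sum_congr rfl fun p _ => Finset.sum_congr rfl fun q _ => ?_
    ring
  rw [hF, hE]
  ring

/-- The obstruction density of a hypersurface in a conformally flat chart, with the coordinates
adapted to the hypersurface at the given point. -/
theorem willmoreExpr_eq_remainder {A : CoordTensor 3 2}
    (hφ : ∀ᶠ y in 𝓝 (X u), ContDiffAt ℝ ∞ φ y) (hsol : IsFlatSolution s b (X u))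
    (hX : ∀ᶠ v in 𝓝 u, ContDiffAt ℝ ∞ X v) (h0 : ∀ᶠ v in 𝓝 u, s (X v) = 0)
    (hh : h =ᶠ[𝓝 u] pullMetric X (confMetric φ)) (hu : IsUnit (h u).det)
    (hA : A =ᶠ[𝓝 u] pull X (tfTensor φ s))
    (hn : ∀ i, pd s i (X u) = if i = Fin.last 3 then 1 else 0) :
    willmoreExpr h A u = Real.exp (-(4 * φ (X u))) * b (X u) := by
  have hXu := hX.self_of_nhds
  have hXc : Filter.Tendsto X (𝓝 u) (𝓝 (X u)) := hXu.continuousAt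
  have hφX := hXc.eventually hφ
  have hsX := hXc.eventually hsol.eventually
  have hφu := hφ.self_of_nhds
  have hsu := hsol.smooth.self_of_nhds
  have hsm : ∀ i j, ContDiffAt ℝ ∞ (fun v => h v i j) u := fun i j =>
    (contDiffAt_pullMetric hXu (fun k l => contDiffAt_confMetric hφu k l) i j).congr_of_eventuallyEq
      (by filter_upwards [hh] with v hv; rw [hv])
  have huX : ∀ᶠ v in 𝓝 u, IsUnit (h v).det := by
    filter_upwards [(contDiffAt_det hsm).continuousAt.eventually_ne hu.ne_zero] with v hv
      using hv.isUnit
  have hR : ∀ᶠ v in 𝓝 u, Related X (christoffel h) (ambSymbols φ s) v := by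
    filter_upwards [hφX, hsX, hX.eventually_nhds, h0.eventually_nhds, hh.eventually_nhds, huX,
      hsX.eventually_nhds] with v h1 h2 h3 h4 h5 h6 h7
    refine related_ambSymbols h1 ?_ h3 h4 (h2.sum_sq h4.self_of_nhds) h5 h6
    filter_upwards [h7] with w hw using hw.smooth.self_of_nhds
  have hN := jacMat_mul_inv_mul_transpose (φ := φ) hXu hsu h0 (hsol.sum_sq h0.self_of_nhds)
    (by rw [← hh.self_of_nhds]; exact hu)
  rw [← hh.self_of_nhds] at hN
  -- With `∇s` equal to the last coordinate vector, `1 - n nᵀ` is the projection onto the first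
  -- three coordinates.
  have hT : IsTangential (jacMat X u * (h u)⁻¹ * (jacMat X u).transpose)
      (Real.exp (-(2 * φ (X u)))) := by
    intro p q
    rw [hN]
    simp only [Matrix.smul_apply, Matrix.sub_apply, Matrix.one_apply, Matrix.of_apply, hn,
      smul_eq_mul]
    congr 1
    fin_cases p <;> fin_cases q <;> simp [Fin.sum_univ_three, Fin.ext_iff]
  rw [willmoreExpr_pull (c := Real.exp (-(2 * φ (X u)))) (Real.exp_pos _).ne' hX ?_ ?_ hR hA hT ?_
    fun d a b => contDiffAt_christoffel hsm hu d a b]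
  · have key := remainder_eq_tfCube (Fin.castSucc_injective 3) Fin.castSucc_ne_last
      (fun f => Fin.sum_univ_castSucc f) hφ hsol h0.self_of_nhds hn
    simp only [covWith_tfTensor hφu hsu, covWith_covWith_tfTensor hφ hsol.smooth, tfTensor_apply,
      mul_pow, ← Finset.mul_sum]
    rw [key]
    -- The tensor is `e^φ P` and each inverse metric contributes `e^{-2φ}`. The terms quadratic in
    -- the tensor scale as `e^{-6φ}e^{2φ}` and the quartic one as `e^{-8φ}e^{4φ}`, so `e^{-4φ}`
    -- factors out of everything.
    have e1 : Real.exp (-(2 * φ (X u))) = (Real.exp (φ (X u)) ^ 2)⁻¹ := by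
      rw [← Real.exp_nat_mul, Real.exp_neg]; norm_num
    have e2 : Real.exp (-(4 * φ (X u))) = (Real.exp (φ (X u)) ^ 4)⁻¹ := by
      rw [← Real.exp_nat_mul, Real.exp_neg]; norm_num
    have e3 : Real.exp (φ (X u)) ≠ 0 := (Real.exp_pos _).ne'
    rw [e1, e2]
    simp only [mul_left_comm _ (Real.exp (φ (X u))),
      mul_assoc (Real.exp (φ (X u))), ← Finset.mul_sum]
    field_simp
  · filter_upwards [hφX, hsX] with v h1 h2 i using contDiffAt_tfTensor h1 h2.smooth.self_of_nhds i
  · filter_upwards [hφX, hsX] with v h1 h2 l p q using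
      contDiffAt_ambSymbols h1 h2.smooth.self_of_nhds l p q
  · have e : (Real.exp (-(2 * φ (X u))))⁻¹ • (1 : Matrix (Fin 4) (Fin 4) ℝ)
        = confMetric φ (X u) := by
      rw [confMetric, Real.exp_neg, inv_inv]
    rw [e]
    have e' : (jacMat X u).transpose * confMetric φ (X u) * jacMat X u = h u :=
      hh.self_of_nhds.symm
    rw [e', Matrix.nonsing_inv_mul _ hu]

end FlatHypersurface

end ConfHyp

namespace ConfHyp

/-! ### The second fundamental form -/

section SecondFundamentalForm

variable {m n k : ℕ}

theorem pull_zero_apply (X : E m → E n) (T : CoordTensor n 0) (u : E m) (a : Fin 0 → Fin m) :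
    pull X T u a = T (X u) ![] := by
  unfold pull
  rw [Fintype.sum_unique]
  simp only [Finset.univ_eq_empty, Finset.prod_empty, one_mul]
  congr 1

theorem pull_two_apply (X : E m → E n) (T : CoordTensor n 2) (u : E m) (a : Fin 2 → Fin m) :
    pull X T u a = ∑ i, ∑ j, jac X i (a 0) u * jac X j (a 1) u * T (X u) ![i, j] := by
  unfold pull
  rw [sum_cons]
  refine Finset.sum_congr rfl fun i _ => ?_
  rw [sum_cons]
  refine Finset.sum_congr rfl fun j _ => ?_
  rw [Fintype.sum_unique, Fin.prod_univ_two]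
  rfl

theorem pullback₂_eq_pull (X : E m → E n) (T : CoordTensor n 2) : pullback₂ X T = pull X T := by
  ext u a
  rw [pull_two_apply]
  rfl

theorem pull_comp {l : ℕ} {Y : E l → E m} {X : E m → E n} {u : E l} (hY : ContDiffAt ℝ ∞ Y u)
    (hX : ContDiffAt ℝ ∞ X (Y u)) (T : CoordTensor n 2) :
    pull (X ∘ Y) T u = pull Y (pull X T) u := by
  have hJ : ∀ k a, jac (X ∘ Y) k a u = ∑ p, jac Y p a u * jac X k p (Y u) := fun k a =>
    pd_comp_jac (f := fun y => X y k) (contDiffAt_coord hX k) hY a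
  ext a
  simp only [pull_two_apply, hJ, Finset.sum_mul, Finset.mul_sum, Function.comp_apply]
  have : ∀ F : Fin n → Fin n → Fin m → Fin m → ℝ, ∑ i, ∑ j, ∑ p, ∑ q, F i j p q
      = ∑ p, ∑ q, ∑ i, ∑ j, F i j q p := by
    intro F
    calc ∑ i, ∑ j, ∑ p, ∑ q, F i j p q = ∑ i, ∑ p, ∑ j, ∑ q, F i j p q :=
          Finset.sum_congr rfl fun i _ => Finset.sum_comm
      _ = ∑ p, ∑ i, ∑ j, ∑ q, F i j p q := Finset.sum_comm
      _ = ∑ p, ∑ i, ∑ q, ∑ j, F i j p q :=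
          Finset.sum_congr rfl fun p _ => Finset.sum_congr rfl fun i _ => Finset.sum_comm
      _ = ∑ p, ∑ q, ∑ i, ∑ j, F i j p q := Finset.sum_congr rfl fun p _ => Finset.sum_comm
      _ = ∑ p, ∑ q, ∑ i, ∑ j, F i j q p := Finset.sum_comm
  rw [this]
  refine Finset.sum_congr rfl fun p _ => Finset.sum_congr rfl fun q _ =>
    Finset.sum_congr rfl fun i _ => Finset.sum_congr rfl fun j _ => ?_
  simp only [Matrix.cons_val_zero, Matrix.cons_val_one]
  ring

/-- For a square Jacobian, `h = Jᵀ G J` invertible forces `J h⁻¹ Jᵀ G = 1`, since one-sided inverses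
of square matrices are two-sided. -/
theorem related_of_isUnit {X : E n → E n} {G h : E n → Matrix (Fin n) (Fin n) ℝ} {u : E n}
    (hX : ContDiffAt ℝ ∞ X u) (hG : ∀ k l, ContDiffAt ℝ ∞ (fun y => G y k l) (X u))
    (hs : ∀ y k l, G y k l = G y l k) (hu : IsUnit (h u).det) (hh : h =ᶠ[𝓝 u] pullMetric X G) :
    Related X (christoffel h) (christoffel G) u := by
  have e : h u = (jacMat X u).transpose * G (X u) * jacMat X u := hh.self_of_nhds
  refine related_of_proj_eq hX hG hs ?_ hh ?_
  · rw [e, Matrix.det_mul, Matrix.det_mul] at hu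
    exact isUnit_of_mul_isUnit_right (isUnit_of_mul_isUnit_left hu)
  · rw [Matrix.mul_assoc _ _ (G (X u)), mul_eq_one_comm, ← Matrix.mul_assoc, ← e,
      Matrix.mul_nonsing_inv _ hu]

/-- Naturality of the Hessian under changes of coordinates. -/
theorem hessian_naturality {X : E n → E n} {G h : E n → Matrix (Fin n) (Fin n) ℝ}
    {f f' : E n → ℝ} {u : E n} (hX : ∀ᶠ v in 𝓝 u, ContDiffAt ℝ ∞ X v)
    (hG : ∀ᶠ y in 𝓝 (X u), ∀ k l, ContDiffAt ℝ ∞ (fun y => G y k l) y)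
    (hs : ∀ y k l, G y k l = G y l k) (hf : ∀ᶠ y in 𝓝 (X u), ContDiffAt ℝ ∞ f y)
    (hu : ∀ v, IsUnit (h v).det)
    (hh : h =ᶠ[𝓝 u] pullMetric X G) (hf' : f' =ᶠ[𝓝 u] f ∘ X) :
    covDeriv h (covDeriv h (ofFun f')) u = pull X (covDeriv G (covDeriv G (ofFun f))) u := by
  have hXc : Filter.Tendsto X (𝓝 u) (𝓝 (X u)) := hX.self_of_nhds.continuousAt
  have hR : ∀ᶠ v in 𝓝 u, Related X (christoffel h) (christoffel G) v := by
    filter_upwards [hX, hXc.eventually hG, hh.eventually_nhds] with v h1 h2 h3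
      using related_of_isUnit h1 h2 hs (hu v) h3
  have h0 : ofFun f' =ᶠ[𝓝 u] pull X (ofFun f) := by
    filter_upwards [hf'] with v hv
    ext a
    rw [pull_zero_apply]
    exact hv
  have h1 := covWith_pull_eventually hX
    (by filter_upwards [hXc.eventually hf] with v hv i using hv) hR h0
  refine (covWith_pull_eventually hX ?_ hR h1).self_of_nhds
  filter_upwards [hXc.eventually hf] with v hv i
  change ContDiffAt ℝ ∞ (fun y => covDeriv G (ofFun f) y i) (X v)
  simp only [covDeriv_ofFun]
  fun_prop

theorem contDiffAt_pairing_gradient {G : E n → Matrix (Fin n) (Fin n) ℝ} {f : E n → ℝ} {x : E n}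
    (hG : ∀ k l, ContDiffAt ℝ ∞ (fun y => G y k l) x) (hx : IsUnit (G x).det)
    (hf : ContDiffAt ℝ ∞ f x) :
    ContDiffAt ℝ ∞ (fun y => pairing G (covDeriv G (ofFun f)) (covDeriv G (ofFun f)) y) x := by
  simp only [pairing_one, covDeriv_ofFun]
  exact ContDiffAt.sum fun i _ => ContDiffAt.sum fun j _ =>
    ((contDiffAt_matrix_inv hG hx i j).mul (contDiffAt_pd hf _)).mul (contDiffAt_pd hf _)

/-- Along a level set on which the gradient of `f` has unit length, the second fundamental form is
the restriction of the Hessian of `f`. -/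
theorem pull_covDeriv_unitConormal {Y : E m → E n} {G : E n → Matrix (Fin n) (Fin n) ℝ}
    {f : E n → ℝ} {u : E m} (hY : ContDiffAt ℝ ∞ Y u)
    (hG : ∀ k l, ContDiffAt ℝ ∞ (fun y => G y k l) (Y u)) (hx : IsUnit (G (Y u)).det)
    (hf : ContDiffAt ℝ ∞ f (Y u)) (h0 : ∀ᶠ v in 𝓝 u, f (Y v) = 0)
    (h1 : pairing G (covDeriv G (ofFun f)) (covDeriv G (ofFun f)) (Y u) = 1) :
    pull Y (covDeriv G (unitConormal G f)) u = pull Y (covDeriv G (covDeriv G (ofFun f))) u := by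
  set lam : E n → ℝ := fun y =>
    (√(pairing G (covDeriv G (ofFun f)) (covDeriv G (ofFun f)) y))⁻¹ with hlam
  have hl : ContDiffAt ℝ ∞ lam (Y u) := by
    refine ((contDiffAt_pairing_gradient hG hx hf).sqrt ?_).inv ?_ <;> rw [h1] <;> simp
  have hl1 : lam (Y u) = 1 := by simp [hlam, h1]
  have hν : unitConormal G f = fun y a => lam y * pd f (a 0) y := by
    ext y a
    rw [unitConormal, covDeriv_ofFun, div_eq_mul_inv, mul_comm]
  have hJ : ∀ b, ∑ j, pd f j (Y u) * jac Y j b u = 0 := sum_pd_mul_jac hY hf h0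
  have hc : ∀ i j, covDeriv G (unitConormal G f) (Y u) ![i, j]
      = covDeriv G (covDeriv G (ofFun f)) (Y u) ![i, j] + pd lam i (Y u) * pd f j (Y u) := by
    intro i j
    rw [covDeriv_eq_covWith, covDeriv_eq_covWith, covWith_one, covWith_one, hν]
    simp only [covDeriv_ofFun, hl1, Matrix.cons_val_zero, one_mul]
    rw [pd_mul hl (contDiffAt_pd hf j), hl1]
    ring
  ext a
  simp only [pull_two_apply, hc, mul_add, Finset.sum_add_distrib]
  rw [add_eq_left]
  have : ∀ i, ∑ j, jac Y i (a 0) u * jac Y j (a 1) u * (pd lam i (Y u) * pd f j (Y u))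
      = jac Y i (a 0) u * pd lam i (Y u) * ∑ j, pd f j (Y u) * jac Y j (a 1) u := by
    intro i
    rw [Finset.mul_sum]
    exact Finset.sum_congr rfl fun j _ => by ring
  simp [this, hJ]

end SecondFundamentalForm

/-! ### Conformal invariance of the trace-free second fundamental form -/

section FlatSecondFundamentalForm

variable {φ s b : E 4 → ℝ} {x : E 4}

/-- Where `s = 0`, the terms `dφ ⊗ ds + ds ⊗ dφ` from differentiating `e^φ` are cancelled by the
first two terms of the Christoffel symbols. The remaining Christoffel term and the trace part of
`Hess s` are multiples of the metric. -/
theorem hessian_confMetric (hφ : ContDiffAt ℝ ∞ φ x) (hs : ∀ᶠ y in 𝓝 x, ContDiffAt ℝ ∞ s y)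
    (hφ' : ∀ᶠ y in 𝓝 x, ContDiffAt ℝ ∞ φ y) (h0 : s x = 0) (i j : Fin 4) :
    covDeriv (confMetric φ) (covDeriv (confMetric φ) (ofFun fun y => Real.exp (φ y) * s y)) x
        ![i, j]
      = tfTensor φ s x ![i, j] + Real.exp (-φ x) * ((∑ i, pd φ i x * pd s i x) - rho s x)
        * confMetric φ x i j := by
  have hsx := hs.self_of_nhds
  have e : ∀ j, (fun y => pd (fun y => Real.exp (φ y) * s y) j y) =ᶠ[𝓝 x]
      fun y => Real.exp (φ y) * (pd φ j y * s y + pd s j y) := by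
    intro j
    filter_upwards [hφ', hs] with y h1 h2
    rw [pd_mul (by fun_prop) h2, pd_exp h1]
    ring
  have e2 : Real.exp (2 * φ x) = Real.exp (φ x) ^ 2 := by rw [← Real.exp_nat_mul]; norm_num
  have e3 : Real.exp (φ x) ≠ 0 := (Real.exp_pos _).ne'
  rw [covDeriv_eq_covWith, covWith_one, tfTensor_apply, confMetric_apply, Real.exp_neg, e2]
  simp only [covDeriv_ofFun, christoffel_confMetric hφ, Matrix.cons_val_zero, tfHess]
  rw [pd_congr (e j), pd_mul (by fun_prop) (by fun_prop), pd_exp hφ, pd_add (by fun_prop)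
    (by fun_prop), pd_mul (by fun_prop) hsx, pd₂_comm hsx i j]
  simp only [fun l => (e l).self_of_nhds, h0]
  have hΓ : ∑ l, confSymbols φ l i j x * (Real.exp (φ x) * (pd φ l x * 0 + pd s l x))
      = Real.exp (φ x) * (pd φ j x * pd s i x + pd φ i x * pd s j x
        - (if i = j then 1 else 0) * ∑ l, pd φ l x * pd s l x) := by
    simp only [confSymbols, add_mul, sub_mul, Finset.sum_add_distrib, Finset.sum_sub_distrib,
      ite_mul, one_mul, zero_mul, Finset.sum_ite_eq', Finset.mem_univ, if_true, mul_zero, zero_add,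
      Finset.mul_sum]
    split_ifs
    · simp only [mul_left_comm _ (Real.exp (φ x)), ← Finset.mul_sum]
      ring
    · simp only [Finset.sum_const_zero]
      ring
  rw [hΓ]
  unfold pd₂
  field_simp
  ring

theorem traceFree_add_metric {T A : CoordTensor 3 2} {h : E 3 → Matrix (Fin 3) (Fin 3) ℝ}
    {u : E 3} {μ : ℝ} (hA : ∀ a, A u a = T u a + μ * h u (a 0) (a 1)) (hu : IsUnit (h u).det)
    (hs : ∀ i j, h u i j = h u j i)
    (hT : traceFirstTwo h T u ![] = 0) : traceFree h A u = T u := by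
  have h3 : ∑ i, ∑ j, (h u)⁻¹ i j * h u i j = 3 := by
    have := congrArg Matrix.trace (Matrix.nonsing_inv_mul _ hu)
    simpa [Matrix.trace, Matrix.mul_apply, hs] using this
  have ht : traceFirstTwo h A u ![] = 3 * μ := by
    unfold traceFirstTwo at hT ⊢
    simp only [hA, mul_add, Finset.sum_add_distrib, hT]
    rw [← h3, Finset.sum_mul, zero_add]
    refine Finset.sum_congr rfl fun i _ => ?_
    rw [Finset.sum_mul]
    refine Finset.sum_congr rfl fun j _ => ?_
    simp only [Fin.cons_zero, Fin.cons_one]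
    ring
  ext a
  rw [traceFree, ht, hA]
  push_cast
  ring

/-- The trace-free second fundamental form, computed in an arbitrary chart `F` of the ambient
space, is the pullback of `e^φ P`. -/
theorem traceFree_secondFF_eq {Y : E 3 → E 4} {h : E 3 → Matrix (Fin 3) (Fin 3) ℝ} {u : E 3}
    {F : E 4 → E 4} {G : E 4 → Matrix (Fin 4) (Fin 4) ℝ} {f : E 4 → ℝ}
    (hφ : ∀ᶠ y in 𝓝 (Y u), ContDiffAt ℝ ∞ φ y) (hsol : IsFlatSolution s b (Y u))
    (hY : ContDiffAt ℝ ∞ Y u) (h0 : ∀ᶠ v in 𝓝 u, s (Y v) = 0)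
    (hh : h u = pullMetric Y (confMetric φ) u) (hu : IsUnit (h u).det)
    (hF : ∀ᶠ y in 𝓝 (Y u), ContDiffAt ℝ ∞ F y)
    (hG : ∀ᶠ y in 𝓝 (F (Y u)), ∀ k l, ContDiffAt ℝ ∞ (fun y => G y k l) y)
    (hs : ∀ y k l, G y k l = G y l k) (hf : ∀ᶠ y in 𝓝 (F (Y u)), ContDiffAt ℝ ∞ f y)
    (hGF : confMetric φ =ᶠ[𝓝 (Y u)] pullMetric F G)
    (hfF : (fun y => Real.exp (φ y) * s y) =ᶠ[𝓝 (Y u)] f ∘ F)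
    (h1 : pairing G (covDeriv G (ofFun f)) (covDeriv G (ofFun f)) (F (Y u)) = 1) :
    traceFree h (pullback₂ (F ∘ Y) (covDeriv G (unitConormal G f))) u
      = pull Y (tfTensor φ s) u := by
  have hFu := hF.self_of_nhds
  have hφu := hφ.self_of_nhds
  have hsu := hsol.smooth.self_of_nhds
  have hGu : IsUnit (G (F (Y u))).det := by
    have := isUnit_det_confMetric (φ := φ) (Y u)
    rw [hGF.self_of_nhds, pullMetric, Matrix.det_mul, Matrix.det_mul] at this
    exact isUnit_of_mul_isUnit_right (isUnit_of_mul_isUnit_left this)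
  have hYc : Filter.Tendsto Y (𝓝 u) (𝓝 (Y u)) := hY.continuousAt
  have hA : ∀ a, pullback₂ (F ∘ Y) (covDeriv G (unitConormal G f)) u a
      = pull Y (tfTensor φ s) u a + Real.exp (-φ (Y u)) *
        ((∑ i, pd φ i (Y u) * pd s i (Y u)) - rho s (Y u)) * h u (a 0) (a 1) := by
    intro a
    rw [pullback₂_eq_pull, pull_covDeriv_unitConormal (hFu.comp u hY) hG.self_of_nhds hGu
      hf.self_of_nhds _ h1, pull_comp hY hFu, pull_congr (hessian_naturality hF hG hs hf
      isUnit_det_confMetric hGF hfF).symm]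
    · simp only [pull_two_apply, hessian_confMetric hφu hsol.smooth hφ h0.self_of_nhds]
      rw [hh, pullMetric_apply, Finset.mul_sum, ← Finset.sum_add_distrib]
      refine Finset.sum_congr rfl fun i _ => ?_
      rw [Finset.mul_sum, ← Finset.sum_add_distrib]
      exact Finset.sum_congr rfl fun j _ => by ring
    · filter_upwards [h0, hYc.eventually hfF] with v h2 h3
      rw [Function.comp_apply, ← Function.comp_apply (f := f), ← h3, h2, mul_zero]
  refine traceFree_add_metric hA hu ?_ ?_
  · intro i j
    rw [hh, pullMetric_apply, pullMetric_apply, Finset.sum_comm]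
    refine Finset.sum_congr rfl fun k _ => Finset.sum_congr rfl fun l _ => ?_
    rw [confMetric_symm]
    ring
  -- The tangential trace of `P` is `tr P - P(∇s, ∇s)`, and both terms vanish on the zero set.
  · rw [traceFirstTwo_pull, pull_zero_apply, hh,
      jacMat_mul_inv_mul_transpose hY hsu h0 (hsol.sum_sq h0.self_of_nhds) (by rwa [← hh])]
    have hn := hsol.sum_tfHess_mul_eq_zero h0.self_of_nhds
    have ht := sum_tfHess (s := s) (y := Y u)
    have hP : ∀ p q, tfTensor φ s (Y u) (Fin.cons p (Fin.cons q ![]))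
        = Real.exp (φ (Y u)) * tfHess s p q (Y u) := fun p q => rfl
    have hq : ∀ p, ∑ q, pd s p (Y u) * pd s q (Y u) * tfHess s p q (Y u)
        = pd s p (Y u) * ∑ q, tfHess s p q (Y u) * pd s q (Y u) := by
      intro p
      rw [Finset.mul_sum]
      exact Finset.sum_congr rfl fun q _ => by ring
    have key : ∑ p, ∑ q, ((1 : Matrix (Fin 4) (Fin 4) ℝ) p q
        - pd s p (Y u) * pd s q (Y u)) * tfHess s p q (Y u) = 0 := by
      simp [sub_mul, hq, hn, ht, Matrix.one_apply]
    simp only [hP, Matrix.smul_apply, Matrix.sub_apply, Matrix.of_apply, smul_eq_mul]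
    rw [← mul_zero (Real.exp (-(2 * φ (Y u))) * Real.exp (φ (Y u))), ← key, Finset.mul_sum]
    refine Finset.sum_congr rfl fun p _ => ?_
    rw [Finset.mul_sum]
    exact Finset.sum_congr rfl fun q _ => by ring

end FlatSecondFundamentalForm

end ConfHyp

namespace ConfHyp

/-! ### Components of the metric in charts -/

section Gram

variable {m n k : ℕ} {M : Type*} [TopologicalSpace M] [ChartedSpace (E n) M]
  [IsManifold 𝓘(ℝ, E n) ∞ M]

theorem gram_symm (g : Metric n M) (X : E m → M) (u : E m) (i j : Fin m) :
    gram g X u i j = gram g X u j i := g.symm _ _ _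

theorem gram_congr (g : Metric n M) {X X' : E m → M} {u : E m} (h : X =ᶠ[𝓝 u] X') :
    gram g X u = gram g X' u := by
  have key : ∀ p p' : M, p = p' → ∀ v w : E n, g.inner p v w = g.inner p' v w := by
    rintro p _ rfl v w; rfl
  ext i j
  have hd : (mfderiv 𝓘(ℝ, E m) 𝓘(ℝ, E n) X u : E m →L[ℝ] E n)
      = mfderiv 𝓘(ℝ, E m) 𝓘(ℝ, E n) X' u := h.mfderiv_eq
  refine (key _ _ h.self_of_nhds _ _).trans ?_
  rw [hd]
  rfl

theorem clm_apply_eq_sum (D : E k →L[ℝ] E n) (v : E k) :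
    D v = ∑ p, v p • D (EuclideanSpace.single p 1) := by
  have h : v = ∑ i, v i • EuclideanSpace.single i (1 : ℝ) := by
    simpa using ((EuclideanSpace.basisFun (Fin k) ℝ).sum_repr v).symm
  conv_lhs => rw [h]
  simp

theorem gram_comp (g : Metric n M) {Z : E k → M} {Y : E m → E k} {u : E m}
    (hZ : MDifferentiableAt 𝓘(ℝ, E k) 𝓘(ℝ, E n) Z (Y u)) (hY : DifferentiableAt ℝ Y u) :
    gram g (Z ∘ Y) u = pullMetric Y (gram g Z) u := by
  have hd : ∀ i : Fin m,
      (mfderiv 𝓘(ℝ, E m) 𝓘(ℝ, E n) (Z ∘ Y) u (EuclideanSpace.single i (1 : ℝ) : E m) : E n)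
      = ∑ p, jac Y p i u • (mfderiv 𝓘(ℝ, E k) 𝓘(ℝ, E n) Z (Y u)
        (EuclideanSpace.single p (1 : ℝ) : E k) : E n) := by
    intro i
    have e1 : (mfderiv 𝓘(ℝ, E m) 𝓘(ℝ, E n) (Z ∘ Y) u (EuclideanSpace.single i (1 : ℝ) : E m) : E n)
        = (mfderiv 𝓘(ℝ, E k) 𝓘(ℝ, E n) Z (Y u) : E k →L[ℝ] E n)
          (fderiv ℝ Y u (EuclideanSpace.single i 1)) := by
      rw [mfderiv_comp u hZ hY.mdifferentiableAt, mfderiv_eq_fderiv]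
      rfl
    refine e1.trans ((clm_apply_eq_sum _ _).trans (Finset.sum_congr rfl fun p _ => ?_))
    rw [jac, pd_coord hY]
    rfl
  ext i j
  rw [pullMetric_apply]
  change g.inner ((Z ∘ Y) u)
    (mfderiv 𝓘(ℝ, E m) 𝓘(ℝ, E n) (Z ∘ Y) u (EuclideanSpace.single i (1 : ℝ) : E m) : E n)
    (mfderiv 𝓘(ℝ, E m) 𝓘(ℝ, E n) (Z ∘ Y) u (EuclideanSpace.single j (1 : ℝ) : E m) : E n) = _
  rw [hd, hd]
  have hs : ∀ (B : E n →L[ℝ] E n →L[ℝ] ℝ) (a a' : Fin k → ℝ) (v : Fin k → E n),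
      B (∑ p, a p • v p) (∑ q, a' q • v q) = ∑ p, ∑ q, a p * a' q * B (v p) (v q) := by
    intro B a a' v
    simp only [map_sum, sum_apply, map_smul, smul_apply,
      smul_eq_mul, Finset.mul_sum]
    rw [Finset.sum_comm]
    exact Finset.sum_congr rfl fun p _ => Finset.sum_congr rfl fun q _ => by ring
  exact hs (g.inner (Z (Y u))) _ _ _

end Gram

/-! ### Dependence of curvature expressions on the germ of the metric -/

section Congruence

variable {n k : ℕ} {h h' : E n → Matrix (Fin n) (Fin n) ℝ} {x : E n}

theorem christoffel_congr (hh : h =ᶠ[𝓝 x] h') (l i j : Fin n) :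
    christoffel h l i j =ᶠ[𝓝 x] christoffel h' l i j := by
  filter_upwards [hh.eventually_nhds] with y hy
  have e : ∀ p q, (fun z => h z p q) =ᶠ[𝓝 y] fun z => h' z p q := fun p q => by
    filter_upwards [hy] with z hz; rw [hz]
  unfold christoffel
  simp only [fun p q => pd_congr (e p q), hy.self_of_nhds]

theorem yamabeS_congr (hh : h =ᶠ[𝓝 x] h') (s : E n → ℝ) : yamabeS h s x = yamabeS h' s x := by
  have e0 := hh.self_of_nhds
  have e1 : covDeriv h (ofFun s) = covDeriv h' (ofFun s) := by
    ext y a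
    rw [covDeriv_ofFun, covDeriv_ofFun]
  have e2 : covDeriv h (covDeriv h' (ofFun s)) x = covDeriv h' (covDeriv h' (ofFun s)) x := by
    ext a
    unfold covDeriv
    simp only [fun l i j => (christoffel_congr hh l i j).self_of_nhds]
  have e3 : ∀ i j, ricci h i j x = ricci h' i j x := by
    intro i j
    unfold ricci
    simp only [fun l i j => (christoffel_congr hh l i j).self_of_nhds,
      fun l i j k => pd_congr (christoffel_congr hh l i j) k]
  unfold yamabeS pairing laplacian traceFirstTwo schoutenTrace scalarCurv
  simp only [e0, e1, e2, e3]

end Congruence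

/-! ### Smoothness in charts and rotation of a chart -/

section Charts

variable {n : ℕ} {M : Type*} [TopologicalSpace M] [ChartedSpace (E n) M]
  [IsManifold 𝓘(ℝ, E n) ∞ M]

theorem contDiffAt_transition {e e' : OpenPartialHomeomorph M (E n)} (he : Chart n M e)
    (he' : Chart n M e') {y : E n} (hy : y ∈ e.target) (hy' : e.symm y ∈ e'.source) :
    ContDiffAt ℝ ∞ (e' ∘ e.symm) y := by
  rw [← contMDiffAt_iff_contDiffAt]
  exact (contMDiffAt_of_mem_maximalAtlas he' hy').comp y (contMDiffAt_symm_of_mem_maximalAtlas he hy)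

theorem contDiffAt_comp_symm {e : OpenPartialHomeomorph M (E n)} (he : Chart n M e) {U : Set M}
    (hU : IsOpen U) {f : M → ℝ} (hf : ContMDiffOn 𝓘(ℝ, E n) 𝓘(ℝ, ℝ) ∞ f U) {y : E n}
    (hy : y ∈ e.target) (hy' : e.symm y ∈ U) : ContDiffAt ℝ ∞ (f ∘ e.symm) y := by
  rw [← contMDiffAt_iff_contDiffAt]
  exact (hf.contMDiffAt (hU.mem_nhds hy')).comp y (contMDiffAt_symm_of_mem_maximalAtlas he hy)

/-- Composition of a chart with a linear isometry. -/
noncomputable def rotate (e : OpenPartialHomeomorph M (E n)) (L : E n ≃ₗᵢ[ℝ] E n) :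
    OpenPartialHomeomorph M (E n) :=
  e.transHomeomorph L.toHomeomorph

theorem chart_rotate {e : OpenPartialHomeomorph M (E n)} (he : Chart n M e)
    (L : E n ≃ₗᵢ[ℝ] E n) : Chart n M (rotate e L) := by
  have hL : ContMDiff 𝓘(ℝ, E n) 𝓘(ℝ, E n) ∞ L := L.contDiff.contMDiff
  have hL' : ContMDiff 𝓘(ℝ, E n) 𝓘(ℝ, E n) ∞ L.symm := L.symm.contDiff.contMDiff
  refine (IsManifold.mem_maximalAtlas_iff_contMDiffOn _).2 ⟨?_, ?_⟩
  · exact hL.comp_contMDiffOn (contMDiffOn_of_mem_maximalAtlas he)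
  · exact (contMDiffOn_symm_of_mem_maximalAtlas he).comp hL'.contMDiffOn fun y hy => hy

theorem gram_rotate (g : Metric n M) {e : OpenPartialHomeomorph M (E n)} (he : Chart n M e)
    (L : E n ≃ₗᵢ[ℝ] E n) {y : E n} (hy : L.symm y ∈ e.target) {c : ℝ}
    (hc : gram g e.symm (L.symm y) = c • (1 : Matrix (Fin n) (Fin n) ℝ)) :
    gram g (rotate e L).symm y = c • (1 : Matrix (Fin n) (Fin n) ℝ) := by
  have hL : DifferentiableAt ℝ L.symm y := L.symm.contDiff.differentiable (n := 1) (by simp) y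
  change gram g (e.symm ∘ L.symm) y = _
  rw [gram_comp g ((contMDiffAt_symm_of_mem_maximalAtlas he hy).mdifferentiableAt (by simp)) hL]
  have hj : ∀ k a, jac L.symm k a y = L.symm (EuclideanSpace.single a 1) k := by
    intro k a
    rw [jac, pd_coord hL]
    exact congrArg (fun D : E n →L[ℝ] E n => D (EuclideanSpace.single a 1) k)
      (L.symm.toContinuousLinearEquiv.fderiv)
  ext a b
  rw [pullMetric_apply]
  have hi := L.symm.inner_map_map (EuclideanSpace.single a (1 : ℝ)) (EuclideanSpace.single b 1)
  simp only [hc, hj, Matrix.smul_apply, Matrix.one_apply, smul_eq_mul, mul_ite, mul_one, mul_zero,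
    Finset.sum_ite_eq, Finset.mem_univ, if_true]
  rw [← Finset.sum_mul]
  rw [PiLp.inner_apply, PiLp.inner_apply] at hi
  simp at hi
  simp only [mul_comm _ (L.symm (EuclideanSpace.single b 1) _), hi, ite_mul, one_mul, zero_mul]

end Charts

end ConfHyp

namespace ConfHyp

/-! ### Conformally flat charts adapted to a hypersurface -/

section Adapted

variable {M : Type*} [TopologicalSpace M] [ChartedSpace (E 4) M]
  [IsManifold 𝓘(ℝ, E 4) ∞ M] {g : Metric 4 M} {U : Set M} {σ B : M → ℝ} {p : M}
  {e : OpenPartialHomeomorph M (E 4)} {φ : E 4 → ℝ}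

/-- Conformal covariance applied to `σ = e^φ s`; since `σ⁴B = s⁴ e^{4φ}B`, the flat remainder is
`e^{4φ}B`. -/
theorem isFlatSolution_of_chart (hU : IsOpen U) (hσ : ContMDiffOn 𝓘(ℝ, E 4) 𝓘(ℝ, ℝ) ∞ σ U)
    (hB : SolvesSingularYamabe g U σ B) (hp : p ∈ U) (he : Chart 4 M e) (hpe : p ∈ e.source)
    (hφ : ∀ᶠ y in 𝓝 (e p), ContDiffAt ℝ ∞ φ y)
    (hg : gram g e.symm =ᶠ[𝓝 (e p)] confMetric φ) :
    IsFlatSolution (fun y => Real.exp (-φ y) * σ (e.symm y))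
      (fun y => Real.exp (4 * φ y) * B (e.symm y)) (e p) := by
  have hU' : ∀ᶠ y in 𝓝 (e p), e.symm y ∈ U ∧ y ∈ e.target := by
    have hc : Filter.Tendsto e.symm (𝓝 (e p)) (𝓝 p) := by
      have := e.continuousAt_symm (e.map_source hpe)
      rwa [ContinuousAt, e.left_inv hpe] at this
    exact (hc.eventually (hU.mem_nhds hp)).and (e.open_target.mem_nhds (e.map_source hpe))
  have hs : ∀ᶠ y in 𝓝 (e p), ContDiffAt ℝ ∞ (fun y => Real.exp (-φ y) * σ (e.symm y)) y := by
    filter_upwards [hφ, hU'] with y h1 h2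
    have := contDiffAt_comp_symm he hU hσ h2.2 h2.1
    exact h1.neg.exp.mul this
  refine ⟨hs, ?_, ?_⟩
  · filter_upwards [hφ, hU'] with y h1 h2
    have := contDiffAt_comp_symm he hU hB.1 h2.2 h2.1
    exact (contDiffAt_const.mul h1).exp.mul this
  · filter_upwards [hφ.eventually_nhds, hs.eventually_nhds, hU', hg.eventually_nhds]
      with y h1 h2 h3 h4
    have h5 := hB.2 e he (e.symm y) ⟨h3.1, e.map_target h3.2⟩
    rw [e.right_inv h3.2, yamabeS_congr h4, yamabeS_confMetric h1 h2
      (Filter.Eventually.of_forall fun z => ?_)] at h5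
    · unfold pd₂
      rw [h5, mul_pow, ← Real.exp_nat_mul]
      have : Real.exp ((4 : ℕ) * -φ y) * Real.exp (4 * φ y) = 1 := by
        rw [← Real.exp_add]; simp
      linear_combination (-σ (e.symm y) ^ 4 * B (e.symm y)) * this
    · simp [← mul_assoc, ← Real.exp_add]

theorem exists_linearIsometry {n : ℕ} {v w : E n} (h : ‖v‖ = ‖w‖) : ∃ L : E n ≃ₗᵢ[ℝ] E n, L v = w :=
  ⟨_, Submodule.reflection_sub h⟩

/-- The flat gradient of `s = e^{-φ}σ`, with `φ = log Ω`, is a unit vector on the zero set, so a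
linear isometry takes it to the last coordinate vector. Composing the chart with this isometry keeps
the metric a multiple of the identity. -/
theorem exists_adapted_chart (hflat : IsConformallyFlat g) (hU : IsOpen U)
    (hσ : ContMDiffOn 𝓘(ℝ, E 4) 𝓘(ℝ, ℝ) ∞ σ U) (hB : SolvesSingularYamabe g U σ B) (hp : p ∈ U)
    (h0 : σ p = 0) :
    ∃ e : OpenPartialHomeomorph M (E 4), Chart 4 M e ∧ p ∈ e.source ∧ ∃ φ : E 4 → ℝ,
      (∀ᶠ y in 𝓝 (e p), ContDiffAt ℝ ∞ φ y) ∧ gram g e.symm =ᶠ[𝓝 (e p)] confMetric φ ∧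
      ∀ i, pd (fun y => Real.exp (-φ y) * σ (e.symm y)) i (e p)
        = if i = Fin.last 3 then 1 else 0 := by
  obtain ⟨e, he, hpe, Ω, hΩ, hgΩ⟩ := hflat p
  have htgt := e.map_source hpe
  have hφ : ∀ y ∈ e.target, ContDiffAt ℝ ∞ (fun y => Real.log (Ω y)) y := fun y hy =>
    (hΩ.contDiffAt (e.open_target.mem_nhds hy)).log (hgΩ y hy).1.ne'
  have hexp : ∀ y ∈ e.target, Real.exp (2 * Real.log (Ω y)) = Ω y ^ 2 := fun y hy => by
    have := Real.exp_nat_mul (Real.log (Ω y)) 2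
    rw [Real.exp_log (hgΩ y hy).1] at this
    exact_mod_cast this
  have hnhds := e.open_target.mem_nhds htgt
  have hsol := isFlatSolution_of_chart (φ := fun y => Real.log (Ω y)) hU hσ hB hp he hpe
    (by filter_upwards [hnhds] with y hy using hφ y hy)
    (by
      filter_upwards [hnhds] with y hy
      rw [(hgΩ y hy).2, confMetric, hexp y hy])
  set s : E 4 → ℝ := fun y => Real.exp (-Real.log (Ω y)) * σ (e.symm y) with hs
  have hs0 : s (e p) = 0 := by simp [hs, e.left_inv hpe, h0]
  have hnorm := hsol.sum_sq hs0
  set v : E 4 := WithLp.toLp 2 fun i => pd s i (e p) with hv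
  obtain ⟨L, hL⟩ := exists_linearIsometry (v := v)
    (w := EuclideanSpace.single (Fin.last 3) (1 : ℝ)) (by
      rw [EuclideanSpace.norm_eq]
      simp [hv, sq_abs, hnorm])
  have hLp : L.symm (rotate e L p) = e p := L.symm_apply_apply _
  have hc : ∀ᶠ y in 𝓝 (rotate e L p), L.symm y ∈ e.target :=
    L.symm.continuous.continuousAt.eventually (by rw [hLp]; exact hnhds)
  refine ⟨rotate e L, chart_rotate he L, hpe, fun y => Real.log (Ω (L.symm y)), ?_, ?_, ?_⟩
  · filter_upwards [hc] with y hy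
    exact (hφ _ hy).comp y L.symm.contDiff.contDiffAt
  · filter_upwards [hc] with y hy
    rw [gram_rotate g he L hy (hgΩ _ hy).2, confMetric, hexp _ hy]
  · intro i
    have hsd : DifferentiableAt ℝ s (L.symm (rotate e L p)) := by
      rw [hLp]; exact smooth_differentiableAt hsol.smooth.self_of_nhds
    change fderiv ℝ (s ∘ L.symm) (rotate e L p) (EuclideanSpace.single i 1) = _
    rw [fderiv_comp _ hsd L.symm.contDiff.contDiffAt.differentiableAt_one]
    have hLd : fderiv ℝ L.symm (rotate e L p) (EuclideanSpace.single i 1)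
        = L.symm (EuclideanSpace.single i 1) :=
      congrArg (fun D : E 4 →L[ℝ] E 4 => D (EuclideanSpace.single i 1))
        L.symm.toContinuousLinearEquiv.fderiv
    rw [ContinuousLinearMap.comp_apply, hLd, hLp, sum_pd_mul_eq_fderiv]
    -- `∂_i(s ∘ L⁻¹) = ⟨v, L⁻¹ e_i⟩ = ⟨Lv, e_i⟩`, and `Lv` is the last coordinate vector.
    have hi := L.inner_map_map v (L.symm (EuclideanSpace.single i 1))
    rw [hL, L.apply_symm_apply, PiLp.inner_apply (x := v)] at hi
    simp [hv] at hi
    rw [← hi, EuclideanSpace.inner_single_left]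
    simp [eq_comm]

end Adapted

end ConfHyp

namespace ConfHyp

/-! ### Parametrizations of an immersed hypersurface -/

section Immersion

/-- A differentiable left inverse makes the Jacobian injective by the chain rule, and the Gram
matrix of an injective matrix is positive definite. -/
theorem isUnit_det_transpose_mul_of_leftInverse {m n : ℕ} {Y : E m → E n} {R : E n → E m} {u : E m}
    (hY : DifferentiableAt ℝ Y u) (hR : DifferentiableAt ℝ R (Y u)) (h : R ∘ Y =ᶠ[𝓝 u] id) :
    IsUnit ((jacMat Y u).transpose * jacMat Y u).det := by
  have hd : (fderiv ℝ R (Y u)).comp (fderiv ℝ Y u) = ContinuousLinearMap.id ℝ (E m) := by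
    rw [← fderiv_comp u hR hY, h.fderiv_eq, fderiv_id]
  have hinj : Function.Injective (jacMat Y u).mulVec := by
    rw [← Matrix.coe_mulVecLin, ← LinearMap.ker_eq_bot, LinearMap.ker_eq_bot']
    intro w hw
    have h1 : fderiv ℝ Y u (WithLp.toLp 2 w) = 0 := by
      rw [clm_apply_eq_sum]
      ext k
      have := congrFun hw k
      simp only [Matrix.mulVecLin_apply, Matrix.mulVec, dotProduct, jacMat, Matrix.of_apply,
        jac, pd_coord hY] at this
      simpa [mul_comm] using this
    have h2 := congrArg (fun D : E m →L[ℝ] E m => D (WithLp.toLp 2 w)) hd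
    simp only [ContinuousLinearMap.comp_apply, h1, map_zero, ContinuousLinearMap.id_apply] at h2
    have := congrArg WithLp.ofLp h2
    simpa using this.symm
  have := (Matrix.PosDef.conjTranspose_mul_self (jacMat Y u) hinj).det_pos
  rw [Matrix.conjTranspose_eq_transpose_of_trivial] at this
  exact this.ne'.isUnit

variable {m n : ℕ} {M N : Type*} [TopologicalSpace M] [ChartedSpace (E n) M]
  [IsManifold 𝓘(ℝ, E n) ∞ M] [TopologicalSpace N] [ChartedSpace (E m) N]
  [IsManifold 𝓘(ℝ, E m) ∞ N]

theorem contDiffAt_parametrization {ι : N → M} (hι : ContMDiff 𝓘(ℝ, E m) 𝓘(ℝ, E n) ∞ ι)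
    {c : OpenPartialHomeomorph N (E m)} (hc : Chart m N c)
    {e : OpenPartialHomeomorph M (E n)} (he : Chart n M e) {u : E m} (hu : u ∈ c.target)
    (hue : ι (c.symm u) ∈ e.source) : ContDiffAt ℝ ∞ (e ∘ ι ∘ c.symm) u := by
  rw [← contMDiffAt_iff_contDiffAt]
  exact (contMDiffAt_of_mem_maximalAtlas he hue).comp u
    (hι.contMDiffAt.comp u (contMDiffAt_symm_of_mem_maximalAtlas hc hu))

/-- In the normal form of an immersion the map is `y ↦ (y, 0)` up to a linear equivalence, so
projection to the first factor is a left inverse. Transition maps carry it to the given charts. -/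
theorem exists_leftInverse {ι : N → M} {q : N}
    (hι : Manifold.IsImmersionAt 𝓘(ℝ, E m) 𝓘(ℝ, E n) ∞ ι q)
    {c : OpenPartialHomeomorph N (E m)} (hc : Chart m N c) (hqc : q ∈ c.source)
    {e : OpenPartialHomeomorph M (E n)} (he : Chart n M e) (hqe : ι q ∈ e.source) :
    ∃ R : E n → E m, ContDiffAt ℝ ∞ R (e (ι q)) ∧
      R ∘ (e ∘ ι ∘ c.symm) =ᶠ[𝓝 (c q)] id := by
  set d := hι.domChart
  set k := hι.codChart
  have hd : Chart m N d := hι.domChart_mem_maximalAtlas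
  have hk : Chart n M k := hι.codChart_mem_maximalAtlas
  have hqd : q ∈ d.source := hι.mem_domChart_source
  have hqk : ι q ∈ k.source := hι.mem_codChart_source
  have hw : ∀ y ∈ d.target, k (ι (d.symm y)) = hι.equiv (y, 0) := by
    intro y hy
    have := hι.writtenInCharts (show y ∈ (d.extend 𝓘(ℝ, E m)).target by simpa using hy)
    exact this
  have hfst : ∀ p ∈ d.source, (hι.equiv.symm (k (ι p))).1 = d p := by
    intro p hp
    have := hw (d p) (d.map_source hp)
    rw [d.left_inv hp] at this
    rw [this, ContinuousLinearEquiv.symm_apply_apply]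
  have hcont : ContinuousAt ι q := hι.continuousAt
  refine ⟨fun y => (c ∘ d.symm) (hι.equiv.symm ((k ∘ e.symm) y)).1, ?_, ?_⟩
  · have h1 : ContDiffAt ℝ ∞ (k ∘ e.symm) (e (ι q)) :=
      contDiffAt_transition he hk (e.map_source hqe) (by rwa [e.left_inv hqe])
    have h2 : ContDiffAt ℝ ∞ (fun y => (hι.equiv.symm ((k ∘ e.symm) y)).1) (e (ι q)) :=
      (hι.equiv.symm.contDiff.contDiffAt.comp _ h1).fst
    have h3 : (hι.equiv.symm ((k ∘ e.symm) (e (ι q)))).1 = d q := by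
      rw [Function.comp_apply, e.left_inv hqe, hfst q hqd]
    refine ContDiffAt.comp (g := c ∘ d.symm) (e (ι q)) ?_ h2
    rw [h3]
    exact contDiffAt_transition hd hc (d.map_source hqd) (by rwa [d.left_inv hqd])
  · have hcs : Filter.Tendsto c.symm (𝓝 (c q)) (𝓝 q) := by
      have := c.continuousAt_symm (c.map_source hqc)
      rwa [ContinuousAt, c.left_inv hqc] at this
    filter_upwards [c.open_target.mem_nhds (c.map_source hqc),
      hcs.eventually (d.open_source.mem_nhds hqd),
      (hcont.tendsto.comp hcs).eventually (e.open_source.mem_nhds hqe)] with v h1 h2 h3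
    simp only [Function.comp_apply, id] at h3 ⊢
    rw [e.left_inv h3, hfst _ h2, d.left_inv h2, c.right_inv h1]

end Immersion

/-! ### Change of ambient chart -/

section Transition

variable {m n : ℕ} {M : Type*} [TopologicalSpace M] [ChartedSpace (E n) M]
  [IsManifold 𝓘(ℝ, E n) ∞ M] {e e' : OpenPartialHomeomorph M (E n)} {y : E n}

theorem eventually_symm_mem (hy : y ∈ e.target) {V : Set M} (hV : IsOpen V) (hyV : e.symm y ∈ V) :
    ∀ᶠ z in 𝓝 y, z ∈ e.target ∧ e.symm z ∈ V :=
  Filter.Eventually.and (e.open_target.mem_nhds hy)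
    ((e.continuousAt_symm hy).eventually (hV.mem_nhds hyV))

theorem gram_transition (g : Metric n M) (he : Chart n M e) (he' : Chart n M e')
    (hy : y ∈ e.target) (hy' : e.symm y ∈ e'.source) :
    gram g e.symm y = pullMetric (e' ∘ e.symm) (gram g e'.symm) y := by
  have h : e.symm =ᶠ[𝓝 y] e'.symm ∘ (e' ∘ e.symm) := by
    filter_upwards [eventually_symm_mem hy e'.open_source hy'] with z hz
    exact (e'.left_inv hz.2).symm
  rw [gram_congr g h, gram_comp g ((contMDiffAt_symm_of_mem_maximalAtlas he'
    (e'.map_source hy')).mdifferentiableAt (by simp))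
    (smooth_differentiableAt (contDiffAt_transition he he' hy hy'))]

theorem contDiffAt_gram {g : Metric n M} {φ : E n → ℝ} (he : Chart n M e) (he' : Chart n M e')
    (hy : y ∈ e.target) (hy' : e.symm y ∈ e'.source)
    (hφ : ContDiffAt ℝ ∞ φ (e' (e.symm y)))
    (hg : gram g e'.symm =ᶠ[𝓝 (e' (e.symm y))] confMetric φ) (i j : Fin n) :
    ContDiffAt ℝ ∞ (fun z => gram g e.symm z i j) y := by
  have ht := contDiffAt_transition he he' hy hy'
  refine (contDiffAt_pullMetric ht (fun k l => contDiffAt_confMetric hφ k l)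
    i j).congr_of_eventuallyEq ?_
  filter_upwards [eventually_symm_mem hy e'.open_source hy', ht.continuousAt.eventually hg]
    with z hz hz'
  rw [gram_transition g he he' hz.1 hz.2]
  unfold pullMetric
  rw [hz']

theorem pullback₂_congr {X X' : E m → E n} {T : CoordTensor n 2} {u : E m} (h : X =ᶠ[𝓝 u] X') :
    pullback₂ X T u = pullback₂ X' T u := by
  have hj : ∀ k, (fun v => X v k) =ᶠ[𝓝 u] fun v => X' v k := fun k => by
    filter_upwards [h] with v hv; rw [hv]
  ext a
  unfold pullback₂
  simp only [fun k => pd_congr (hj k), h.self_of_nhds]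

theorem traceFree_congr {h : E n → Matrix (Fin n) (Fin n) ℝ} {T S : CoordTensor n 2} {x : E n}
    (hT : T x = S x) : traceFree h T x = traceFree h S x := by
  ext a
  rw [traceFree, traceFree, traceFirstTwo_congr hT, hT]

/-- Where `σ = 0` the equation reduces to `|dσ|² = 1`. Hence normalizing `dσ` to the unit conormal
only rescales by a function equal to one on the hypersurface. -/
theorem SolvesSingularYamabe.pairing_eq_one {g : Metric n M} {U : Set M} {σ B : M → ℝ} {p : M}
    (hn : n ≠ 0) (hB : SolvesSingularYamabe g U σ B) (he : Chart n M e) (hp : p ∈ U)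
    (hpe : p ∈ e.source) (h0 : σ p = 0) :
    pairing (gram g e.symm) (covDeriv (gram g e.symm) (ofFun (σ ∘ e.symm)))
      (covDeriv (gram g e.symm) (ofFun (σ ∘ e.symm))) (e p) = 1 := by
  have := hB.2 e he p ⟨hp, hpe⟩
  simpa [yamabeS, e.left_inv hpe, h0, hn] using this

end Transition

end ConfHyp

/-! ### Assembly of the obstruction density formula -/

theorem mainTheorem4
    {M : Type*} [TopologicalSpace M] [ChartedSpace (ConfHyp.E 4) M]
    [IsManifold 𝓘(ℝ, ConfHyp.E 4) ∞ M]
    {N : Type*} [TopologicalSpace N] [ChartedSpace (ConfHyp.E 3) N]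
    [IsManifold 𝓘(ℝ, ConfHyp.E 3) ∞ N]
    (g : ConfHyp.Metric 4 M) (hg : ConfHyp.IsConformallyFlat g)
    (ι : N → M) (hι : Manifold.IsSmoothEmbedding 𝓘(ℝ, ConfHyp.E 3) 𝓘(ℝ, ConfHyp.E 4) ∞ ι)
    (U : Set M) (σ B : M → ℝ)
    (hσ : ConfHyp.IsDefiningFunction (n := 4) (Set.range ι) U σ)
    (hB : ConfHyp.SolvesSingularYamabe g U σ B)
    (q : N)
    (c : OpenPartialHomeomorph N (ConfHyp.E 3)) (hc : ConfHyp.Chart 3 N c) (hqc : q ∈ c.source)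
    (e : OpenPartialHomeomorph M (ConfHyp.E 4)) (he : ConfHyp.Chart 4 M e)
    (hqe : ι q ∈ e.source) :
    B (ι q) =
      ConfHyp.willmoreExpr (ConfHyp.gram g (ι ∘ c.symm))
        (ConfHyp.traceFree (ConfHyp.gram g (ι ∘ c.symm)) (ConfHyp.secondFF g σ ι c e))
        (c q) := by
  open ConfHyp in
  have hιs := hι.contMDiff
  have hιU : ∀ p, ι p ∈ U := fun p => hσ.subset ⟨p, rfl⟩
  have hσ0 : ∀ p, σ (ι p) = 0 := fun p => (hσ.zero_iff _ (hιU p)).2 ⟨p, rfl⟩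
  -- The conformally flat chart `e₁` is independent of the given chart `e`, in which the second
  -- fundamental form is written. Its alignment with the normal is known only at `ι q`.
  obtain ⟨e₁, he₁, hqe₁, φ, hφ, hflat, hn⟩ :=
    exists_adapted_chart hg hσ.isOpen hσ.smooth hB (hιU q) (hσ0 q)
  have hsol := isFlatSolution_of_chart hσ.isOpen hσ.smooth hB (hιU q) he₁ hqe₁ hφ hflat
  set s : E 4 → ℝ := fun y => Real.exp (-φ y) * σ (e₁.symm y) with hs
  set b : E 4 → ℝ := fun y => Real.exp (4 * φ y) * B (e₁.symm y) with hb
  set Y : E 3 → E 4 := e₁ ∘ ι ∘ c.symm with hYdef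
  set u := c q with hu
  have hut : u ∈ c.target := c.map_source hqc
  have hcu : c.symm u = q := c.left_inv hqc
  have hYu : Y u = e₁ (ι q) := by simp [hYdef, hcu]
  rw [← hYu] at hφ hflat hn hsol
  have hιc : ContinuousAt (ι ∘ c.symm) u :=
    hιs.continuous.continuousAt.comp (c.continuousAt_symm hut)
  have hdom : ∀ᶠ v in 𝓝 u, v ∈ c.target ∧ ι (c.symm v) ∈ e₁.source ∧ ι (c.symm v) ∈ e.source := by
    refine (c.open_target.mem_nhds hut |> Filter.Eventually.and) (Filter.Eventually.and ?_ ?_)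
    · exact hιc.eventually (e₁.open_source.mem_nhds (by simpa [hcu] using hqe₁))
    · exact hιc.eventually (e.open_source.mem_nhds (by simpa [hcu] using hqe))
  have hY : ∀ᶠ v in 𝓝 u, ContDiffAt ℝ ∞ Y v := by
    filter_upwards [hdom] with v hv using contDiffAt_parametrization hιs hc he₁ hv.1 hv.2.1
  have hY0 : ∀ᶠ v in 𝓝 u, s (Y v) = 0 := by
    filter_upwards [hdom] with v hv
    simp [hs, hYdef, e₁.left_inv hv.2.1, hσ0]
  have hYc : Filter.Tendsto Y (𝓝 u) (𝓝 (Y u)) := hY.self_of_nhds.continuousAt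
  have hh : gram g (ι ∘ c.symm) =ᶠ[𝓝 u] pullMetric Y (confMetric φ) := by
    filter_upwards [hdom.eventually_nhds, hY, hYc.eventually hflat] with v h1 h2 h3
    have hv := h1.self_of_nhds
    have e2 : ι ∘ c.symm =ᶠ[𝓝 v] e₁.symm ∘ Y := by
      filter_upwards [h1] with w hw
      simp [hYdef, e₁.left_inv hw.2.1]
    rw [gram_congr g e2, gram_comp g
      ((contMDiffAt_symm_of_mem_maximalAtlas he₁ (e₁.map_source hv.2.1)).mdifferentiableAt
        (by simp)) (smooth_differentiableAt h2)]
    unfold pullMetric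
    rw [h3]
  have hdet : IsUnit (gram g (ι ∘ c.symm) u).det := by
    obtain ⟨R, hR, hRY⟩ := exists_leftInverse (hι.isImmersion.isImmersionAt q) hc hqc he₁ hqe₁
    rw [hh.self_of_nhds, pullMetric_confMetric, Matrix.det_smul]
    refine IsUnit.mul ((Real.exp_pos _).ne'.isUnit.pow _)
      (isUnit_det_transpose_mul_of_leftInverse (smooth_differentiableAt hY.self_of_nhds) ?_ hRY)
    rw [hYu]
    exact smooth_differentiableAt hR
  have hdetv : ∀ᶠ v in 𝓝 u, IsUnit (gram g (ι ∘ c.symm) v).det := by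
    have hsm := contDiffAt_det fun i j => contDiffAt_pullMetric hY.self_of_nhds
      (fun k l => contDiffAt_confMetric hφ.self_of_nhds k l) i j
    rw [hh.self_of_nhds] at hdet
    filter_upwards [hh, hsm.continuousAt.eventually_ne hdet.ne_zero] with v h1 h2
    rw [h1]
    exact h2.isUnit
  -- The identification is needed on a neighbourhood, because the Willmore expression differentiates
  -- the tensor twice. It passes from `e` to `e₁` through the transition map, by naturality of the
  -- Hessian.
  have hA : traceFree (gram g (ι ∘ c.symm)) (secondFF g σ ι c e) =ᶠ[𝓝 u]
      pull Y (tfTensor φ s) := by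
    filter_upwards [hdom.eventually_nhds, hY, hY0.eventually_nhds, hYc.eventually hφ.eventually_nhds,
      hYc.eventually hflat.eventually_nhds, hYc.eventually hsol.eventually, hh, hdetv]
      with v h1 h2 h3 h4 h5 h6 h7 h8
    have hv := h1.self_of_nhds
    have hYe : e₁.symm (Y v) = ι (c.symm v) := e₁.left_inv hv.2.1
    have hYt : Y v ∈ e₁.target := e₁.map_source hv.2.1
    have hFY : (e ∘ e₁.symm) (Y v) = e (ι (c.symm v)) := congrArg e hYe
    have hFt : (e ∘ e₁.symm) (Y v) ∈ e.target := by rw [hFY]; exact e.map_source hv.2.2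
    have hFs : e.symm ((e ∘ e₁.symm) (Y v)) = ι (c.symm v) := by
      rw [hFY, e.left_inv hv.2.2]
    have hFe : e₁ (e.symm ((e ∘ e₁.symm) (Y v))) = Y v := congrArg e₁ hFs
    have hy₁ := eventually_symm_mem hYt e.open_source (by rw [hYe]; exact hv.2.2)
    have hy₂ := eventually_symm_mem hFt e₁.open_source (by rw [hFs]; exact hv.2.1)
    have hy₃ := eventually_symm_mem hFt hσ.isOpen (by rw [hFs]; exact hιU _)
    have hback : Filter.Tendsto (e₁ ∘ e.symm) (𝓝 ((e ∘ e₁.symm) (Y v))) (𝓝 (Y v)) := by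
      have := (contDiffAt_transition he he₁ hFt (by rw [hFs]; exact hv.2.1)).continuousAt.tendsto
      rwa [show (e₁ ∘ e.symm) ((e ∘ e₁.symm) (Y v)) = Y v from hFe] at this
    have key := traceFree_secondFF_eq (F := e ∘ e₁.symm) (G := gram g e.symm) (f := σ ∘ e.symm)
      h4 h6 h2 h3 h7 h8 ?_ ?_ (gram_symm g e.symm) ?_ ?_ ?_ ?_
    · rw [← key]
      refine traceFree_congr (pullback₂_congr ?_)
      filter_upwards [h1] with w hw
      simp [hYdef, e₁.left_inv hw.2.1]
    · filter_upwards [hy₁] with y hy using contDiffAt_transition he₁ he hy.1 hy.2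
    · filter_upwards [hy₂, hback.eventually h4, hback.eventually h5.eventually_nhds]
        with y hy ha hb i j
      exact contDiffAt_gram he he₁ hy.1 hy.2 ha hb i j
    · filter_upwards [hy₃] with y hy using contDiffAt_comp_symm he hσ.isOpen hσ.smooth hy.1 hy.2
    · filter_upwards [hy₁, h5] with y hy ha
      rw [← ha, gram_transition g he₁ he hy.1 hy.2]
    · filter_upwards [hy₁] with y hy
      simp [hs, e.left_inv hy.2, ← mul_assoc, ← Real.exp_add]
    · rw [hFY]
      exact hB.pairing_eq_one (by norm_num) he (hιU _) hv.2.2 (hσ0 _)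
  -- The factor `e^{-4φ}` of the Willmore expression cancels the `e^{4φ}` in `b = e^{4φ}B`.
  rw [willmoreExpr_eq_remainder hφ hsol hY hY0 hh hdet hA hn, hYu]
  simp [hb, e₁.left_inv hqe₁, ← mul_assoc, ← Real.exp_add]
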